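/- Let $R>0$. Write $L^2_{\mathrm{rad}}(R)$ for the real Hilbert space of radial functions in $L^2(\{x\in\mathbb{R}^6:|x|>R\})$, with norm $\|f\|^2=\int_R^\infty |f(r)|^2r^5\,dr$. Let $\Pi_R$ be the orthogonal projection of this space onto the line $\mathrm{span}(1/r^4)$, and let $\Pi_R^\perp=\mathrm{Id}-\Pi_R$. Let $u_1\in L^2_{\mathrm{rad}}(R)$ and let $u_L=u_L(t,r)$, $r=|x|$, be the radial solution of $$\partial_t^2u_L-\Delta u_L=0,\qquad (t,x)\in\mathbb{R}\times\mathbb{R}^6,\quad |x|>R+|t|,\qquad (u_L,\partial_tu_L)_{\restriction t=0}=(0,u_1),$$ that is, the restriction to $\{|x|>R+|t|\}$ of $$\cos(t\sqrt{-\Delta})\,\tilde u_0+\frac{\sin(t\sqrt{-\Delta})}{\sqrt{-\Delta}}\,\tilde u_1,$$ where $(\tilde u_0,\tilde u_1)\in\dot H^1(\mathbb{R}^6)\times L^2(\mathbb{R}^6)$ is any real radial pair that agrees with $(0,u_1)$ for $|x|>R$. Then $\int_{t+R}^\infty|\partial_ru_L(t,r)|^2r^5\,dr$ and $\int_{t+R}^\infty|\partial_tu_L(t,r)|^2r^5\,dr$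 are finite for all $t\ge0$, both have a finite limit as $t\to\infty$, the two limits are equal, and $$\lim_{t\to\infty}\int_{t+R}^{\infty}|\partial_r u_L(t,r)|^2r^5\,dr=\lim_{t\to\infty}\int_{t+R}^{\infty}|\partial_t u_L(t,r)|^2r^5\,dr\;\ge\;\frac{3}{20}\int_R^\infty\left|\Pi_R^\perp u_1(r)\right|^2r^5\,dr .$$ -/

import Mathlib

open MeasureTheory Filter Topology Set
open scoped ENNReal FourierTransform ContDiff

noncomputable section

/-- Euclidean space `ℝ⁶`. -/
abbrev E6 : Type := EuclideanSpace ℝ (Fin 6)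

/-- The Hilbert space `L²(ℝ⁶; ℂ)`. -/
abbrev L2E6 : Type := Lp ℂ 2 (volume : Measure E6)

/-- The measure `r⁵ dr` on the half-line `(ρ, ∞)`, i.e. (up to the area of the unit sphere) the
Lebesgue measure of `{x ∈ ℝ⁶ : |x| > ρ}` read on radial functions of `r = |x|`. -/
def radialMeasure (ρ : ℝ) : Measure ℝ :=
  (volume.restrict (Ioi ρ)).withDensity (fun r => ENNReal.ofReal (r ^ 5))

/-- The real Hilbert space of radial functions in `L²({x ∈ ℝ⁶ : |x| > R})`, as functions
of `r = |x|`, normed by `∫_R^∞ |f(r)|² r⁵ dr`. -/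
abbrev RadialL2 (R : ℝ) : Type := Lp ℝ 2 (radialMeasure R)

theorem memLp_inv_pow_four {R : ℝ} (hR : 0 < R) :
    MemLp (fun r : ℝ => 1 / r ^ 4) 2 (radialMeasure R) := by
  have hm : Measurable (fun r : ℝ => 1 / r ^ 4) := by fun_prop
  rw [memLp_two_iff_integrable_sq hm.aestronglyMeasurable, radialMeasure,
    integrable_withDensity_iff_integrable_smul' (by fun_prop) (by simp)]
  refine (integrableOn_Ioi_rpow_of_lt (a := -3) (by norm_num) hR).congr_fun ?_ measurableSet_Ioi
  intro r hr
  have hr0 : (0 : ℝ) < r := hR.trans hr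
  have h3 : r ^ (-3 : ℝ) = (r ^ 3)⁻¹ := by
    rw [Real.rpow_neg hr0.le]
    norm_cast
  simp only [h3, ENNReal.toReal_ofReal (pow_pos hr0 5).le, smul_eq_mul]
  field_simp

/-- The function `1 / r⁴` as an element of the radial `L²` space on `{|x| > R}`. -/
def invPowFour {R : ℝ} (hR : 0 < R) : RadialL2 R := (memLp_inv_pow_four hR).toLp _

/-- `Π_R`: the orthogonal projection of the radial `L²` space on `{|x| > R}`
onto the line spanned by `1 / r⁴`. -/
def radialProj {R : ℝ} (hR : 0 < R) : RadialL2 R →L[ℝ] RadialL2 R :=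
  (Submodule.span ℝ {invPowFour hR}).starProjection

/-- `Π_R^⊥ = Id - Π_R`. -/
def radialProjPerp {R : ℝ} (hR : 0 < R) : RadialL2 R →L[ℝ] RadialL2 R :=
  ContinuousLinearMap.id ℝ (RadialL2 R) - radialProj hR

/-- `f ∈ L²(ℝ⁶)` is real-valued and radial. -/
def IsRealRadial (f : L2E6) : Prop :=
  ∃ a : ℝ → ℝ, ∀ᵐ x : E6, f x = ((a ‖x‖ : ℝ) : ℂ)

/-- `f ∈ L²(ℝ⁶)` has a gradient in `L²(ℝ⁶)`: `|ξ| f̂(ξ)` is square integrable. -/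
def HasFiniteDirichletEnergy (f : L2E6) : Prop :=
  MemLp (fun ξ : E6 => ((‖ξ‖ : ℝ) : ℂ) * (𝓕 f : L2E6) ξ) 2 volume

/-- `U` is the solution of the free wave equation on `ℝ × ℝ⁶` with data `(f, g)` at `t = 0`:
`U(t) = cos(t√-Δ) f + (sin(t√-Δ)/√-Δ) g`. With Mathlib's normalisation of the Fourier transform,
`√-Δ` is the Fourier multiplier `2π|ξ|`. (The value of the second multiplier at the single
frequency `ξ = 0` is irrelevant, as the identity is one in `L²`.) -/
def IsFreeWave (U : ℝ → L2E6) (f g : L2E6) : Prop :=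
  ∀ t : ℝ, ∀ᵐ ξ : E6, (𝓕 (U t) : L2E6) ξ =
    ((Real.cos (t * (2 * Real.pi * ‖ξ‖)) : ℝ) : ℂ) * (𝓕 f : L2E6) ξ +
    ((Real.sin (t * (2 * Real.pi * ‖ξ‖)) / (2 * Real.pi * ‖ξ‖) : ℝ) : ℂ) * (𝓕 g : L2E6) ξ

/-- `u = u(t, r)` is a radial solution of the free wave equation in `{(t,x) : |x| > R + |t|}`
(space dimension 6) with data `(0, u₁)` at `t = 0`, `u₁` radial in `L²({|x| > R})`: it is the
restriction to that region of a solution on `ℝ × ℝ⁶` with radial data `(f, g)` of finite energy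
which extend `(0, u₁)`. As `f` vanishes outside a ball, it is in `L²` as soon as it is in `Ḣ¹`. -/
def IsExteriorSolution (R : ℝ) (u₁ : RadialL2 R) (u : ℝ → ℝ → ℝ) : Prop :=
  ∃ (f g : L2E6) (U : ℝ → L2E6),
    IsRealRadial f ∧ IsRealRadial g ∧ HasFiniteDirichletEnergy f ∧
    (∀ᵐ x : E6, R < ‖x‖ → f x = 0) ∧
    (∀ᵐ x : E6, R < ‖x‖ → g x = ((u₁ ‖x‖ : ℝ) : ℂ)) ∧
    IsFreeWave U f g ∧
    ∀ t : ℝ, ∀ᵐ x : E6, R + |t| < ‖x‖ → U t x = ((u t ‖x‖ : ℝ) : ℂ)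

/-- `ut = ∂ₜu` in `{r > R + |t|}`: for every `t`, the difference quotients of `u` at time `t`
converge to `ut t` in `L²(r⁵ dr)` as the increment `h` tends to `0`, on the half-lines
`r > R + |t| + |h|` on which both `u t` and `u (t + h)` are given. -/
def IsTimeDeriv (R : ℝ) (u ut : ℝ → ℝ → ℝ) : Prop :=
  ∀ t : ℝ, AEStronglyMeasurable (ut t) (volume.restrict (Ioi (R + |t|))) ∧
    Tendsto (fun h : ℝ => eLpNorm (fun r => (u (t + h) r - u t r) / h - ut t r) 2
      (radialMeasure (R + |t| + |h|))) (𝓝[≠] 0) (𝓝 0)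

/-- `ur = ∂ᵣu` in `{r > R + |t|}`: for every `t`, the function `ur t` is the weak derivative of
`u t` on the half-line `(R + |t|, ∞)`. For radial functions, `|∇u| = |∂ᵣu|`. -/
def IsRadialDeriv (R : ℝ) (u ur : ℝ → ℝ → ℝ) : Prop :=
  ∀ t : ℝ, LocallyIntegrableOn (ur t) (Ioi (R + |t|)) ∧
    ∀ φ : ℝ → ℝ, ContDiff ℝ ∞ φ → HasCompactSupport φ → tsupport φ ⊆ Ioi (R + |t|) →
      ∫ r, u t r * deriv φ r = -∫ r, ur t r * φ r

end

noncomputable section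

/-- The quadratic form of the Cauchy matrix `1 / (p i + p j)`. -/
def cauchyForm (s : Finset ℕ) (p v : ℕ → ℝ) : ℝ :=
  ∑ i ∈ s, ∑ j ∈ s, v i * v j / (p i + p j)

theorem cauchyForm_nonneg (s : Finset ℕ) {p : ℕ → ℝ} (hp : ∀ i, 0 < p i) (v : ℕ → ℝ) :
    0 ≤ cauchyForm s p v := by
  have key : ∫ t in Ioi (0 : ℝ), (∑ i ∈ s, v i * Real.exp (-p i * t)) ^ 2 = cauchyForm s p v := by
    have h1 : ∀ t : ℝ, (∑ i ∈ s, v i * Real.exp (-p i * t)) ^ 2 =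
        ∑ i ∈ s, ∑ j ∈ s, v i * v j * Real.exp ((-(p i + p j)) * t) := by
      intro t
      rw [sq, Finset.sum_mul_sum]
      refine Finset.sum_congr rfl fun i _ => Finset.sum_congr rfl fun j _ => ?_
      rw [show (-(p i + p j)) * t = -p i * t + -p j * t by ring, Real.exp_add]
      ring
    have hint : ∀ i j, IntegrableOn (fun t => v i * v j * Real.exp ((-(p i + p j)) * t))
        (Ioi (0 : ℝ)) := fun i j =>
      (integrableOn_exp_mul_Ioi (by have := hp i; have := hp j; linarith) 0).const_mul _
    simp_rw [h1]
    rw [integral_finsetSum _ fun i _ => integrable_finsetSum _ fun j _ => hint i j]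
    refine Finset.sum_congr rfl fun i _ => ?_
    rw [integral_finsetSum _ fun j _ => hint i j]
    refine Finset.sum_congr rfl fun j _ => ?_
    have hpp : 0 < p i + p j := add_pos (hp i) (hp j)
    rw [integral_const_mul, integral_exp_mul_Ioi (by linarith)]
    simp only [mul_zero, Real.exp_zero]
    field_simp
  rw [← key]
  exact integral_nonneg fun t => sq_nonneg _

theorem cauchyForm_mul_div_le (s : Finset ℕ) {p : ℕ → ℝ} (hp : ∀ i, 0 < p i) (v : ℕ → ℝ)
    {a b : ℝ} (hab : |b| ≤ a) :
    cauchyForm s p (fun i => v i * ((p i - b) / (p i + a))) ≤ cauchyForm s p v := by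
  have ha : 0 ≤ a := (abs_nonneg b).trans hab
  have hb := abs_le.1 hab
  have key : cauchyForm s p v - cauchyForm s p (fun i => v i * ((p i - b) / (p i + a))) =
      (a + b) * (∑ i ∈ s, v i / (p i + a)) ^ 2 +
        (a ^ 2 - b ^ 2) * cauchyForm s p (fun i => v i / (p i + a)) := by
    rw [sq (∑ i ∈ s, v i / (p i + a)), Finset.sum_mul_sum]
    simp only [cauchyForm, Finset.mul_sum, ← Finset.sum_sub_distrib, ← Finset.sum_add_distrib]
    refine Finset.sum_congr rfl fun i _ => Finset.sum_congr rfl fun j _ => ?_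
    have h1 := hp i
    have h2 := hp j
    have h3 : p i + a ≠ 0 := by positivity
    have h4 : p j + a ≠ 0 := by positivity
    have h5 : p i + p j ≠ 0 := by positivity
    field_simp
    ring
  have h1 := cauchyForm_nonneg s hp (fun i => v i / (p i + a))
  have h2 : 0 ≤ (a + b) * (∑ i ∈ s, v i / (p i + a)) ^ 2 :=
    mul_nonneg (by linarith) (sq_nonneg _)
  have h3 : 0 ≤ (a ^ 2 - b ^ 2) * cauchyForm s p (fun i => v i / (p i + a)) :=
    mul_nonneg (by nlinarith) h1
  linarith

theorem cauchyForm_const_div_le (s : Finset ℕ) {p : ℕ → ℝ} (hp : ∀ i, 0 < p i) (v : ℕ → ℝ)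
    {a : ℝ} (ha : 0 ≤ a) :
    cauchyForm s p (fun i => v i * (a / (p i + a))) ≤ cauchyForm s p v := by
  have key : cauchyForm s p v - cauchyForm s p (fun i => v i * (a / (p i + a))) =
      a * (∑ i ∈ s, v i / (p i + a)) ^ 2 +
        cauchyForm s p (fun i => v i * (p i / (p i + a))) := by
    rw [sq (∑ i ∈ s, v i / (p i + a)), Finset.sum_mul_sum]
    simp only [cauchyForm, Finset.mul_sum, ← Finset.sum_sub_distrib, ← Finset.sum_add_distrib]
    refine Finset.sum_congr rfl fun i _ => Finset.sum_congr rfl fun j _ => ?_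
    have h1 := hp i
    have h2 := hp j
    have h3 : p i + a ≠ 0 := by positivity
    have h4 : p j + a ≠ 0 := by positivity
    have h5 : p i + p j ≠ 0 := by positivity
    field_simp
    ring
  have h1 := cauchyForm_nonneg s hp (fun i => v i * (p i / (p i + a)))
  have h2 : 0 ≤ a * (∑ i ∈ s, v i / (p i + a)) ^ 2 := mul_nonneg ha (sq_nonneg _)
  linarith

theorem cauchyForm_add_le (s : Finset ℕ) {p : ℕ → ℝ} (hp : ∀ i, 0 < p i) (u w : ℕ → ℝ)
    {c : ℝ} (hc : 0 ≤ c) :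
    cauchyForm s p (fun i => u i + c * w i) ≤
      (1 + c) * (cauchyForm s p u + c * cauchyForm s p w) := by
  have key : (1 + c) * (cauchyForm s p u + c * cauchyForm s p w) -
      cauchyForm s p (fun i => u i + c * w i) = c * cauchyForm s p (fun i => u i - w i) := by
    simp only [cauchyForm, Finset.mul_sum, ← Finset.sum_sub_distrib, ← Finset.sum_add_distrib]
    refine Finset.sum_congr rfl fun i _ => Finset.sum_congr rfl fun j _ => ?_
    have h5 : p i + p j ≠ 0 := by
      have h1 := hp i
      have h2 := hp j
      positivity
    field_simp
    ring
  have := mul_nonneg hc (cauchyForm_nonneg s hp (fun i => u i - w i))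
  linarith

theorem cauchyForm_add_le_sq (s : Finset ℕ) {p : ℕ → ℝ} (hp : ∀ i, 0 < p i) {u w v : ℕ → ℝ}
    {c : ℝ} (hc : 0 ≤ c) (hu : cauchyForm s p u ≤ cauchyForm s p v)
    (hw : cauchyForm s p w ≤ cauchyForm s p v) :
    cauchyForm s p (fun i => u i + c * w i) ≤ (1 + c) ^ 2 * cauchyForm s p v := by
  have h := cauchyForm_add_le s hp u w hc
  have h1 : cauchyForm s p u + c * cauchyForm s p w ≤ (1 + c) * cauchyForm s p v := by
    nlinarith
  calc _ ≤ _ := h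
    _ ≤ (1 + c) * ((1 + c) * cauchyForm s p v) := by gcongr
    _ = _ := by ring

theorem cauchyForm_neg (s : Finset ℕ) (p v : ℕ → ℝ) :
    cauchyForm s p (fun i => -v i) = cauchyForm s p v := by
  simp [cauchyForm]

/-- The factors of the infinite product for the inverse radiation symbol. -/
def symbolFactor (p : ℝ) (m : ℕ) : ℝ := 1 - 1 / (4 * (p + 1 + 2 * m) ^ 2)

theorem cauchyForm_symbolFactor_zero_le (s : Finset ℕ) {p : ℕ → ℝ} (hp : ∀ i, 0 < p i)
    (v : ℕ → ℝ) :
    cauchyForm s p (fun i => v i * symbolFactor (p i) 0) ≤ (9 / 8) ^ 2 * cauchyForm s p v := by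
  have h1 := cauchyForm_mul_div_le s hp v (a := 1) (b := -7 / 8) (by norm_num [abs_le])
  have h2 := cauchyForm_const_div_le s hp v (a := 1) (by norm_num)
  have h3 := cauchyForm_mul_div_le s hp (fun i => v i * (1 / (p i + 1))) (a := 1) (b := 1)
    (by norm_num)
  have h4 := cauchyForm_add_le_sq s hp (c := 1 / 8) (by norm_num) h1 (h3.trans h2)
  have h5 : (fun i => v i * symbolFactor (p i) 0) = fun i =>
      v i * ((p i - -7 / 8) / (p i + 1)) +
        1 / 8 * (v i * (1 / (p i + 1)) * ((p i - 1) / (p i + 1))) := by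
    funext i
    have h1 := hp i
    have h3 : p i + 1 ≠ 0 := by positivity
    simp only [symbolFactor, Nat.cast_zero, mul_zero, add_zero]
    field_simp
    ring
  rw [h5]
  refine h4.trans (le_of_eq ?_)
  norm_num

theorem cauchyForm_symbolFactor_le (s : Finset ℕ) {p : ℕ → ℝ} (hp : ∀ i, 0 < p i)
    (v : ℕ → ℝ) (m : ℕ) :
    cauchyForm s p (fun i => v i * symbolFactor (p i) m) ≤
      (1 + 1 / (4 * (1 + 2 * m) ^ 2)) ^ 2 * cauchyForm s p v := by
  have h2 := cauchyForm_const_div_le s hp v (a := 1 + 2 * m) (by positivity)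
  have h3 := cauchyForm_const_div_le s hp (fun i => v i * ((1 + 2 * m) / (p i + (1 + 2 * m))))
    (a := 1 + 2 * m) (by positivity)
  rw [← cauchyForm_neg] at h3
  have h4 := cauchyForm_add_le_sq s hp (c := 1 / (4 * (1 + 2 * m) ^ 2)) (by positivity)
    (le_refl (cauchyForm s p v)) (h3.trans h2)
  have h5 : (fun i => v i * symbolFactor (p i) m) = fun i => v i + 1 / (4 * (1 + 2 * (m : ℝ)) ^ 2) *
      -(v i * ((1 + 2 * m) / (p i + (1 + 2 * m))) * ((1 + 2 * m) / (p i + (1 + 2 * m)))) := by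
    funext i
    have h1 := hp i
    have h3 : p i + 1 + 2 * m ≠ 0 := by positivity
    have h4 : (1 : ℝ) + 2 * m ≠ 0 := by positivity
    simp only [symbolFactor, ← add_assoc]
    field_simp
    ring
  rw [h5]
  exact h4

theorem cauchyForm_prod_symbolFactor_le (s : Finset ℕ) {p : ℕ → ℝ} (hp : ∀ i, 0 < p i)
    (v : ℕ → ℝ) (N : ℕ) :
    cauchyForm s p (fun i => v i * ∏ m ∈ Finset.range (N + 1), symbolFactor (p i) m) ≤
      (6 / 5 * (1 - 1 / (16 * ((N : ℝ) + 1)))) ^ 2 * cauchyForm s p v := by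
  induction N with
  | zero =>
    refine le_trans (le_of_eq ?_) ((cauchyForm_symbolFactor_zero_le s hp v).trans
      (le_of_eq ?_)) <;> norm_num
  | succ N ih =>
    have h1 := cauchyForm_symbolFactor_le s hp
      (fun i => v i * ∏ m ∈ Finset.range (N + 1), symbolFactor (p i) m) (N + 1)
    have h0 := cauchyForm_nonneg s hp v
    have hN : (0 : ℝ) < N + 1 := by positivity
    have hA : 0 ≤ 1 - 1 / (16 * ((N : ℝ) + 1)) := by
      rw [sub_nonneg, div_le_one (by positivity)]
      linarith
    have hc : 1 / (4 * (1 + 2 * ((N + 1 : ℕ) : ℝ)) ^ 2) ≤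
        1 / (16 * ((N : ℝ) + 1)) - 1 / (16 * (((N + 1 : ℕ) : ℝ) + 1)) := by
      push_cast
      rw [div_sub_div _ _ (by positivity) (by positivity), div_le_div_iff₀ (by positivity)
        (by positivity)]
      nlinarith
    calc _ = cauchyForm s p (fun i => v i * (∏ m ∈ Finset.range (N + 1), symbolFactor (p i) m) *
            symbolFactor (p i) (N + 1)) := by
          simp only [Finset.prod_range_succ _ (N + 1), mul_assoc]
      _ ≤ _ := h1
      _ ≤ (1 + 1 / (4 * (1 + 2 * ((N + 1 : ℕ) : ℝ)) ^ 2)) ^ 2 *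
          ((6 / 5 * (1 - 1 / (16 * ((N : ℝ) + 1)))) ^ 2 * cauchyForm s p v) := by gcongr
      _ = ((1 + 1 / (4 * (1 + 2 * ((N + 1 : ℕ) : ℝ)) ^ 2)) *
          (6 / 5 * (1 - 1 / (16 * ((N : ℝ) + 1))))) ^ 2 * cauchyForm s p v := by ring
      _ ≤ _ := by
        have hc0 : 0 ≤ 1 / (4 * (1 + 2 * ((N + 1 : ℕ) : ℝ)) ^ 2) := by positivity
        have ha : 0 ≤ 1 / (16 * ((N : ℝ) + 1)) := by positivity
        refine mul_le_mul_of_nonneg_right (pow_le_pow_left₀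
          (mul_nonneg (by linarith) (mul_nonneg (by norm_num) hA)) ?_ 2) h0
        nlinarith [mul_nonneg hc0 ha]

/-- If `μ` satisfies the recursion of the radiation symbol and tends to `1 / 2`, then dividing
by `μ` is bounded by the factor `12 / 5` off the zero of the symbol. -/
theorem cauchyForm_le_of_symbol {μ : ℕ → ℝ} (hpos : ∀ n, 0 < μ n)
    (hrec : ∀ n : ℕ, μ (n + 1) =
      μ n * ((9 / 4 + n) * (11 / 4 + n) / ((3 / 2 + n) * (7 / 2 + n))))
    (hlim : Tendsto μ atTop (𝓝 (1 / 2))) (s : Finset ℕ) (a : ℕ → ℝ) :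
    (3 / 20) * cauchyForm s (fun n => 2 * (n : ℝ) + 4)
      (fun n => a n * ((2 * (n : ℝ) + 3) / (2 * n + 5))) ≤
      cauchyForm s (fun n => 2 * (n : ℝ) + 4) (fun n => a n * μ n) := by
  set p : ℕ → ℝ := fun n => 2 * (n : ℝ) + 4 with hpdef
  have hp : ∀ n, 0 < p n := fun n => by positivity
  set θ : ℕ → ℝ := fun n => (2 * (n : ℝ) + 3) / (2 * n + 5) / (2 * μ n) with hθ
  have hθrec : ∀ n m : ℕ, θ (n + m) = symbolFactor (p n) m * θ (n + m + 1) := by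
    intro n m
    have h0 := hpos (n + m)
    have h1 : symbolFactor (p n) m =
        (9 / 4 + (n + m : ℕ)) * (11 / 4 + (n + m : ℕ)) / (5 / 2 + (n + m : ℕ)) ^ 2 := by
      simp only [symbolFactor, hpdef]
      push_cast
      have : (5 / 2 + ((n : ℝ) + m)) ≠ 0 := by positivity
      have : (2 * (n : ℝ) + 4 + 1 + 2 * m) ≠ 0 := by positivity
      field_simp
      ring
    simp only [hθ, h1, hrec (n + m)]
    generalize n + m = k at *
    push_cast
    have h2 : μ k ≠ 0 := h0.ne'
    field_simp
    ring
  have hprod : ∀ n N : ℕ, θ n = (∏ m ∈ Finset.range N, symbolFactor (p n) m) * θ (n + N) := by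
    intro n N
    induction N with
    | zero => simp
    | succ N ih => rw [ih, hθrec n N, Finset.prod_range_succ, mul_assoc, add_assoc]
  have hθlim : Tendsto θ atTop (𝓝 1) := by
    have h1 : Tendsto (fun n : ℕ => (2 * (n : ℝ) + 3) / (2 * n + 5)) atTop (𝓝 1) := by
      have h2 : Tendsto (fun n : ℕ => 1 - 2 / (2 * (n : ℝ) + 5)) atTop (𝓝 (1 - 0)) := by
        refine tendsto_const_nhds.sub (Tendsto.const_div_atTop ?_ 2)
        exact tendsto_atTop_add_const_right _ _
          (tendsto_natCast_atTop_atTop.const_mul_atTop (by norm_num))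
      rw [sub_zero] at h2
      refine h2.congr fun n => ?_
      have : (2 * (n : ℝ) + 5) ≠ 0 := by positivity
      field_simp
      ring
    have := h1.div (hlim.const_mul 2) (by norm_num)
    rwa [show (1 : ℝ) / (2 * (1 / 2)) = 1 by norm_num] at this
  have hmain : ∀ b : ℕ → ℝ, cauchyForm s p (fun n => b n * θ n) ≤
      (6 / 5) ^ 2 * cauchyForm s p b := by
    intro b
    have hN : ∀ N : ℕ, cauchyForm s p (fun n => b n * (θ n / θ (n + (N + 1)))) ≤
        (6 / 5) ^ 2 * cauchyForm s p b := by
      intro N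
      have h0 := cauchyForm_nonneg s hp b
      have hA : 0 ≤ 1 - 1 / (16 * ((N : ℝ) + 1)) := by
        rw [sub_nonneg, div_le_one (by positivity)]
        have : (0 : ℝ) ≤ N := by positivity
        linarith
      have hB : 1 - 1 / (16 * ((N : ℝ) + 1)) ≤ 1 := by
        have : 0 ≤ 1 / (16 * ((N : ℝ) + 1)) := by positivity
        linarith
      have h1 := cauchyForm_prod_symbolFactor_le s hp b N
      have h2 : ∀ n, θ n / θ (n + (N + 1)) = ∏ m ∈ Finset.range (N + 1), symbolFactor (p n) m := by
        intro n
        have : θ (n + (N + 1)) ≠ 0 := by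
          have := hpos (n + (N + 1))
          simp only [hθ]
          positivity
        rw [hprod n (N + 1), mul_div_assoc, div_self this, mul_one]
      simp only [h2]
      refine h1.trans ?_
      gcongr
      nlinarith
    have ht : Tendsto (fun N : ℕ => cauchyForm s p (fun n => b n * (θ n / θ (n + (N + 1))))) atTop
        (𝓝 (cauchyForm s p (fun n => b n * θ n))) := by
      have h1 : ∀ n, Tendsto (fun N : ℕ => b n * (θ n / θ (n + (N + 1)))) atTop
          (𝓝 (b n * θ n)) := by
        intro n
        have h2 : Tendsto (fun N : ℕ => θ (n + (N + 1))) atTop (𝓝 1) :=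
          hθlim.comp (tendsto_atTop_mono (fun N => by simp; omega) tendsto_id)
        simpa using (tendsto_const_nhds (x := θ n)).div h2 one_ne_zero |>.const_mul (b n)
      simp only [cauchyForm]
      exact tendsto_finsetSum _ fun i _ => tendsto_finsetSum _ fun j _ =>
        ((h1 i).mul (h1 j)).div_const _
    exact le_of_tendsto' ht hN
  have h1 := hmain (fun n => a n * (2 * μ n))
  have h2 : (fun n => a n * (2 * μ n) * θ n) =
      fun n => a n * ((2 * (n : ℝ) + 3) / (2 * n + 5)) := by
    funext n
    have := (hpos n).ne'
    simp only [hθ]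
    field_simp
  have h3 : cauchyForm s p (fun n => a n * (2 * μ n)) =
      4 * cauchyForm s p (fun n => a n * μ n) := by
    simp only [cauchyForm, Finset.mul_sum]
    refine Finset.sum_congr rfl fun i _ => Finset.sum_congr rfl fun j _ => ?_
    ring
  rw [h2, h3] at h1
  have h4 := cauchyForm_nonneg s hp (fun n => a n * μ n)
  linarith

/-- The rising factorial `(5/2)(5/2 + 1)⋯(5/2 + i - 1)`. -/
def risingHalf (i : ℕ) : ℝ := ∏ k ∈ Finset.range i, (5 / 2 + (k : ℝ))

theorem risingHalf_succ (i : ℕ) : risingHalf (i + 1) = risingHalf i * (5 / 2 + i) :=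
  Finset.prod_range_succ _ _

theorem risingHalf_pos (i : ℕ) : 0 < risingHalf i :=
  Finset.prod_pos fun _ _ => by positivity

/-- Up to sign, the `i`-th derivative of `a ^ (-5/2)`. -/
def powDeriv (i : ℕ) (a : ℝ) : ℝ := risingHalf i * a ^ (-(5 / 2 : ℝ) - i)

theorem powDeriv_nonneg (i : ℕ) {a : ℝ} (ha : 0 < a) : 0 ≤ powDeriv i a :=
  mul_nonneg (risingHalf_pos i).le (Real.rpow_nonneg ha.le _)

theorem hasDerivAt_powDeriv (i : ℕ) {a : ℝ} (ha : 0 < a) :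
    HasDerivAt (powDeriv i) (-powDeriv (i + 1) a) a := by
  have h := (Real.hasDerivAt_rpow_const (p := -(5 / 2 : ℝ) - i) (Or.inl ha.ne')).const_mul
    (risingHalf i)
  convert! h using 1
  simp only [powDeriv, risingHalf_succ]
  push_cast
  rw [show -(5 / 2 : ℝ) - (i + 1) = -(5 / 2 : ℝ) - i - 1 by ring]
  ring

theorem mul_powDeriv_succ (i : ℕ) {a : ℝ} (ha : 0 < a) :
    a * powDeriv (i + 1) a = (5 / 2 + i) * powDeriv i a := by
  simp only [powDeriv, risingHalf_succ]
  push_cast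
  rw [show -(5 / 2 : ℝ) - i = -(5 / 2 : ℝ) - (i + 1) + 1 by ring, Real.rpow_add_one ha.ne']
  ring

/-- The term of bidegree `(i, j)` in the light-cone coordinates `r - t`, `r + t`. -/
def coneTerm (x : ℕ × ℕ) (t r : ℝ) : ℝ := powDeriv x.1 (r - t) * powDeriv x.2 (r + t)

/-- The sum over bidegrees of total degree `m` with signed binomial weights. -/
def coneSum (m : ℕ) (F : ℕ × ℕ → ℝ) : ℝ :=
  ∑ x ∈ Finset.HasAntidiagonal.antidiagonal m, (m.choose x.1 : ℝ) * ((-1) ^ x.2 * F x)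

theorem coneSum_add (m : ℕ) (F G : ℕ × ℕ → ℝ) :
    coneSum m (fun x => F x + G x) = coneSum m F + coneSum m G := by
  simp only [coneSum, ← Finset.sum_add_distrib]
  exact Finset.sum_congr rfl fun x _ => by ring

theorem coneSum_mul (m : ℕ) (F : ℕ × ℕ → ℝ) (c : ℝ) :
    coneSum m (fun x => c * F x) = c * coneSum m F := by
  simp only [coneSum, Finset.mul_sum]
  exact Finset.sum_congr rfl fun x _ => by ring

theorem coneSum_neg (m : ℕ) (F : ℕ × ℕ → ℝ) : coneSum m (fun x => -F x) = -coneSum m F := by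
  simpa using coneSum_mul m F (-1)

theorem coneSum_congr {m : ℕ} {F G : ℕ × ℕ → ℝ} (h : ∀ x, x.1 + x.2 = m → F x = G x) :
    coneSum m F = coneSum m G :=
  Finset.sum_congr rfl fun x hx => by rw [h x (Finset.HasAntidiagonal.mem_antidiagonal.1 hx)]

theorem coneSum_succ (m : ℕ) (F : ℕ × ℕ → ℝ) :
    coneSum (m + 1) F = coneSum m (fun x => F (x.1 + 1, x.2) - F (x.1, x.2 + 1)) := by
  have h := Finset.sum_antidiagonal_choose_succ_mul (R := ℝ) (fun i j => (-1) ^ j * F (i, j)) m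
  simp only [coneSum]
  rw [show (∑ x ∈ Finset.HasAntidiagonal.antidiagonal (m + 1),
      ((m + 1).choose x.1 : ℝ) * ((-1) ^ x.2 * F x)) = _
    from h, ← Finset.sum_add_distrib]
  refine Finset.sum_congr rfl fun x hx => ?_
  have hx' := Finset.HasAntidiagonal.mem_antidiagonal.1 hx
  have : m.choose x.2 = m.choose x.1 := by
    rw [← hx']
    exact (Nat.choose_symm_add).symm
  rw [this]
  ring

theorem hasDerivAt_coneSum {m : ℕ} {F : ℕ × ℕ → ℝ → ℝ} {G : ℕ × ℕ → ℝ} {y : ℝ}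
    (h : ∀ x, HasDerivAt (F x) (G x) y) :
    HasDerivAt (fun s => coneSum m (fun x => F x s)) (coneSum m G) y := by
  simp only [coneSum]
  exact HasDerivAt.fun_sum fun x _ => ((h x).const_mul _).const_mul _

theorem hasDerivAt_coneTerm_time (x : ℕ × ℕ) {t r : ℝ} (h : |t| < r) :
    HasDerivAt (fun t => coneTerm x t r)
      (coneTerm (x.1 + 1, x.2) t r - coneTerm (x.1, x.2 + 1) t r) t := by
  have h' := abs_lt.1 h
  have h1 := (hasDerivAt_powDeriv x.1 (a := r - t) (by linarith)).comp t
    ((hasDerivAt_id t).const_sub r)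
  have h2 := (hasDerivAt_powDeriv x.2 (a := r + t) (by linarith)).comp t
    ((hasDerivAt_id t).const_add r)
  convert! h1.mul h2 using 1
  simp only [coneTerm, Function.comp]
  ring

theorem hasDerivAt_coneTerm_radial (x : ℕ × ℕ) {t r : ℝ} (h : |t| < r) :
    HasDerivAt (fun r => coneTerm x t r)
      (-(coneTerm (x.1 + 1, x.2) t r + coneTerm (x.1, x.2 + 1) t r)) r := by
  have h' := abs_lt.1 h
  have h1 := (hasDerivAt_powDeriv x.1 (a := r - t) (by linarith)).comp r
    ((hasDerivAt_id r).sub_const t)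
  have h2 := (hasDerivAt_powDeriv x.2 (a := r + t) (by linarith)).comp r
    ((hasDerivAt_id r).add_const t)
  convert! h1.mul h2 using 1
  simp only [coneTerm, Function.comp, id]
  ring

/-- The `m`-th time derivative of the homogeneous solution `(r² - t²)^(-5/2)`. -/
def homSol (m : ℕ) (t r : ℝ) : ℝ := coneSum m (fun x => coneTerm x t r)

/-- The radial derivative of `homSol m`. -/
def homSolR (m : ℕ) (t r : ℝ) : ℝ :=
  -coneSum m (fun x => coneTerm (x.1 + 1, x.2) t r + coneTerm (x.1, x.2 + 1) t r)

/-- The second radial derivative of `homSol m`. -/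
def homSolRR (m : ℕ) (t r : ℝ) : ℝ :=
  coneSum m (fun x => coneTerm (x.1 + 2, x.2) t r + 2 * coneTerm (x.1 + 1, x.2 + 1) t r +
    coneTerm (x.1, x.2 + 2) t r)

theorem hasDerivAt_homSol_time (m : ℕ) {t r : ℝ} (h : |t| < r) :
    HasDerivAt (fun t => homSol m t r) (homSol (m + 1) t r) t := by
  rw [homSol, coneSum_succ]
  exact hasDerivAt_coneSum fun x => hasDerivAt_coneTerm_time x h

theorem hasDerivAt_homSol_radial (m : ℕ) {t r : ℝ} (h : |t| < r) :
    HasDerivAt (fun r => homSol m t r) (homSolR m t r) r := by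
  rw [homSolR, ← coneSum_neg]
  exact hasDerivAt_coneSum fun x => hasDerivAt_coneTerm_radial x h

theorem hasDerivAt_homSolR_radial (m : ℕ) {t r : ℝ} (h : |t| < r) :
    HasDerivAt (fun r => homSolR m t r) (homSolRR m t r) r := by
  have h1 := (hasDerivAt_coneSum (m := m) fun x =>
    (hasDerivAt_coneTerm_radial (x.1 + 1, x.2) h).add
      (hasDerivAt_coneTerm_radial (x.1, x.2 + 1) h)).neg
  convert! h1 using 1
  rw [homSolRR, ← coneSum_neg]
  exact coneSum_congr fun x _ => by ring

/-- The Euler-Poisson-Darboux equation in light-cone coordinates. -/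
theorem coneSum_epd (m : ℕ) (t r : ℝ) :
    coneSum m (fun x => x.1 * coneTerm (x.1, x.2 + 1) t r + x.2 * coneTerm (x.1 + 1, x.2) t r)
      = 0 := by
  cases m with
  | zero => simp [coneSum]
  | succ k =>
    rw [coneSum_add]
    simp only [coneSum]
    rw [Finset.Nat.sum_antidiagonal_succ, Finset.Nat.sum_antidiagonal_succ' (n := k)]
    simp only [Nat.cast_zero, zero_mul, mul_zero, zero_add]
    rw [← Finset.sum_add_distrib]
    refine Finset.sum_eq_zero fun x hx => ?_
    have hx' := Finset.HasAntidiagonal.mem_antidiagonal.1 hx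
    have h1 : ((k + 1).choose (x.1 + 1) : ℝ) * (x.1 + 1) = (k + 1) * k.choose x.1 := by
      exact_mod_cast (Nat.add_one_mul_choose_eq k x.1).symm
    have h2 : ((k + 1).choose x.1 : ℝ) * (x.2 + 1) = (k + 1) * k.choose x.1 := by
      have := Nat.choose_mul_succ_eq k x.1
      rw [← hx', show x.1 + x.2 + 1 - x.1 = x.2 + 1 by omega] at this
      rw [← hx']
      push_cast
      have h3 : (((x.1 + x.2).choose x.1 : ℕ) : ℝ) * (x.1 + x.2 + 1) =
        ((x.1 + x.2 + 1).choose x.1 : ℕ) * (x.2 + 1) := by exact_mod_cast this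
      linarith
    push_cast
    linear_combination ((-1) ^ x.2 * coneTerm (x.1 + 1, x.2 + 1) t r) * (h1 - h2)

/-- The radial wave equation in dimension `6`. -/
theorem homSol_wave (m : ℕ) {t r : ℝ} (h : |t| < r) :
    homSol (m + 2) t r = homSolRR m t r + 5 / r * homSolR m t r := by
  have h' := abs_lt.1 h
  have hr : 0 < r := (abs_nonneg t).trans_lt h
  have key : r * (4 * coneSum m (fun x => coneTerm (x.1 + 1, x.2 + 1) t r)) =
      5 * coneSum m (fun x => coneTerm (x.1 + 1, x.2) t r + coneTerm (x.1, x.2 + 1) t r) := by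
    have h0 := coneSum_epd m t r
    rw [← coneSum_mul, ← coneSum_mul, ← coneSum_mul, ← sub_eq_zero]
    have : ∀ F G : ℕ × ℕ → ℝ, coneSum m F - coneSum m G = coneSum m (fun x => F x + -G x) := by
      intro F G
      rw [coneSum_add, coneSum_neg, sub_eq_add_neg]
    rw [this, ← mul_zero (2 : ℝ), ← h0, ← coneSum_mul]
    refine coneSum_congr fun x _ => ?_
    have h1 := mul_powDeriv_succ x.1 (a := r - t) (by linarith)
    have h2 := mul_powDeriv_succ x.2 (a := r + t) (by linarith)
    simp only [coneTerm]
    linear_combination 2 * powDeriv (x.2 + 1) (r + t) * h1 + 2 * powDeriv (x.1 + 1) (r - t) * h2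
  have e : homSol (m + 2) t r = homSolRR m t r -
      4 * coneSum m (fun x => coneTerm (x.1 + 1, x.2 + 1) t r) := by
    rw [homSol, coneSum_succ, coneSum_succ, homSolRR, ← coneSum_mul, sub_eq_add_neg, ← coneSum_neg,
      ← coneSum_add]
    exact coneSum_congr fun x _ => by ring
  rw [e, homSolR]
  field_simp
  linarith

/-- The coefficient of `r^(-5-m)` in `homSol m 0 r`. -/
def homCoef (m : ℕ) : ℝ := coneSum m (fun x => risingHalf x.1 * risingHalf x.2)

theorem coneTerm_zero (x : ℕ × ℕ) {r : ℝ} (hr : 0 < r) :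
    coneTerm x 0 r = risingHalf x.1 * risingHalf x.2 * (r ^ (5 + (x.1 + x.2)))⁻¹ := by
  have : (r ^ (5 + (x.1 + x.2)))⁻¹ = r ^ (-(5 / 2 : ℝ) - x.1) * r ^ (-(5 / 2 : ℝ) - x.2) := by
    rw [← Real.rpow_add hr, ← Real.rpow_natCast, ← Real.rpow_neg hr.le]
    congr 1
    push_cast
    ring
  rw [this, coneTerm, powDeriv, powDeriv, sub_zero, add_zero]
  ring

theorem homSol_zero (m : ℕ) {r : ℝ} (hr : 0 < r) :
    homSol m 0 r = homCoef m * (r ^ (5 + m))⁻¹ := by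
  rw [homSol, homCoef, mul_comm, ← coneSum_mul]
  refine coneSum_congr fun x hx => ?_
  rw [coneTerm_zero x hr, hx]
  ring

theorem homCoef_add_two (m : ℕ) : homCoef (m + 2) = (m + 5) * (m + 1) * homCoef m := by
  have h := homSol_wave m (t := 0) (r := 1) (by norm_num)
  have h1 : homSolR m 0 1 = -((5 + m) * homCoef m) := by
    rw [homSolR, homCoef, ← coneSum_mul, neg_inj]
    refine coneSum_congr fun x hx => ?_
    simp only [coneTerm_zero _ one_pos, one_pow, inv_one, mul_one, risingHalf_succ, ← hx]
    push_cast
    ring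
  have h2 : homSolRR m 0 1 = (5 + m) * (6 + m) * homCoef m := by
    rw [homSolRR, homCoef, ← coneSum_mul]
    refine coneSum_congr fun x hx => ?_
    simp only [coneTerm_zero _ one_pos, one_pow, inv_one, mul_one, risingHalf_succ, ← hx]
    push_cast
    ring
  rw [homSol_zero _ one_pos, h1, h2, one_pow, inv_one, mul_one] at h
  rw [h]
  ring

theorem homCoef_zero : homCoef 0 = 1 := by simp [homCoef, coneSum, risingHalf]

theorem homCoef_one : homCoef 1 = 0 := by
  rw [homCoef, coneSum_succ]
  simp [coneSum, risingHalf]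

theorem homCoef_odd (k : ℕ) : homCoef (2 * k + 1) = 0 := by
  induction k with
  | zero => exact homCoef_one
  | succ k ih => rw [show 2 * (k + 1) + 1 = 2 * k + 1 + 2 by ring, homCoef_add_two, ih, mul_zero]

theorem homCoef_even (k : ℕ) :
    homCoef (2 * k) * k.factorial = (2 * k).factorial * risingHalf k := by
  induction k with
  | zero => simp [homCoef_zero, risingHalf]
  | succ k ih =>
    rw [show 2 * (k + 1) = 2 * k + 2 by ring, homCoef_add_two, Nat.factorial_succ k,
      Nat.factorial_succ (2 * k + 1), Nat.factorial_succ (2 * k), risingHalf_succ]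
    push_cast
    linear_combination ((2 * k + 5 : ℝ) * (2 * k + 1) * (k + 1)) * ih

theorem homCoef_even_pos (k : ℕ) : 0 < homCoef (2 * k) := by
  have h := homCoef_even k
  have h1 := risingHalf_pos k
  have h2 : (0 : ℝ) < (2 * k).factorial := by exact_mod_cast Nat.factorial_pos _
  have h3 : (0 : ℝ) < k.factorial := by exact_mod_cast Nat.factorial_pos _
  exact pos_of_mul_pos_left (h ▸ mul_pos h2 h1) h3.le

/-- The ratio of the radiation field of `homSol (2k + 1)` to its initial velocity. -/
def radSymbol (k : ℕ) : ℝ := 2 ^ (-(5 / 2 : ℝ)) * risingHalf (2 * k + 2) / homCoef (2 * k + 2)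

theorem radSymbol_pos (k : ℕ) : 0 < radSymbol k := by
  have h1 := risingHalf_pos (2 * k + 2)
  have h2 := homCoef_even_pos (k + 1)
  rw [show 2 * (k + 1) = 2 * k + 2 by ring] at h2
  unfold radSymbol
  positivity

theorem radSymbol_succ (k : ℕ) : radSymbol (k + 1) =
    radSymbol k * ((9 / 4 + k) * (11 / 4 + k) / ((3 / 2 + k) * (7 / 2 + k))) := by
  have h2 := (homCoef_even_pos (k + 1)).ne'
  rw [show 2 * (k + 1) = 2 * k + 2 by ring] at h2
  simp only [radSymbol]
  rw [show 2 * (k + 1) + 2 = 2 * k + 2 + 2 by ring, homCoef_add_two, risingHalf_succ,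
    risingHalf_succ]
  push_cast
  field_simp
  ring

theorem tendsto_radSymbol : Tendsto radSymbol atTop (𝓝 (1 / 2)) := by
  set G : ℕ → ℝ := Real.GammaSeq (5 / 2) with hG
  have hΓ : 0 < Real.Gamma (5 / 2) := Real.Gamma_pos_of_pos (by norm_num)
  have hlim : Tendsto G atTop (𝓝 (Real.Gamma (5 / 2))) := Real.GammaSeq_tendsto_Gamma _
  have hform : ∀ n : ℕ, 0 < n → risingHalf n * ((5 / 2 + n) * G n) =
      (n : ℝ) ^ (5 / 2 : ℝ) * n.factorial := by
    intro n _
    have h1 := risingHalf_succ n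
    have h2 := (risingHalf_pos n).ne'
    have h3 : (5 / 2 + (n : ℝ)) ≠ 0 := by positivity
    rw [hG, Real.GammaSeq, show ∏ j ∈ Finset.range (n + 1), (5 / 2 + (j : ℝ)) = _ from h1]
    field_simp
  have hμ : ∀ k : ℕ, radSymbol k = (5 / 2 + (k + 1 : ℝ)) / (5 / 2 + 2 * (k + 1 : ℝ)) *
      (G (k + 1) / G (2 * (k + 1))) := by
    intro k
    have hf1 := hform (k + 1) (by omega)
    have hf2 := hform (2 * (k + 1)) (by omega)
    have hc := homCoef_even (k + 1)
    have hcp := homCoef_even_pos (k + 1)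
    have hr1 := risingHalf_pos (k + 1)
    have hr2 := risingHalf_pos (2 * (k + 1))
    have hfa : (0 : ℝ) < (k + 1).factorial := by exact_mod_cast Nat.factorial_pos _
    have hfb : (0 : ℝ) < (2 * (k + 1)).factorial := by exact_mod_cast Nat.factorial_pos _
    rw [radSymbol, show 2 * k + 2 = 2 * (k + 1) by ring]
    push_cast at hf1 hf2
    rw [Real.mul_rpow (by norm_num) (by positivity)] at hf2
    have hn : (0 : ℝ) < ((k : ℝ) + 1) ^ (5 / 2 : ℝ) := by positivity
    have hG2 : G (2 * (k + 1)) ≠ 0 := by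
      intro h0
      rw [h0, mul_zero, mul_zero] at hf2
      have : (0 : ℝ) < 2 ^ (5 / 2 : ℝ) * ((k : ℝ) + 1) ^ (5 / 2 : ℝ) * (2 * (k + 1)).factorial := by
        positivity
      linarith
    rw [Real.rpow_neg (by norm_num)]
    have h2 : (0 : ℝ) < 2 ^ (5 / 2 : ℝ) := by positivity
    set A := risingHalf (k + 1)
    set B := risingHalf (2 * (k + 1))
    set C := homCoef (2 * (k + 1))
    set f1 : ℝ := ((k + 1).factorial : ℝ)
    set f2 : ℝ := ((2 * (k + 1)).factorial : ℝ)
    set x : ℝ := ((k : ℝ) + 1) ^ (5 / 2 : ℝ)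
    set y : ℝ := (2 : ℝ) ^ (5 / 2 : ℝ)
    set g1 := G (k + 1)
    set g2 := G (2 * (k + 1))
    have e1 : g1 = x * f1 / (A * (5 / 2 + (k + 1))) := by
      rw [eq_div_iff (by positivity)]
      linarith
    have e2 : B = y * x * f2 / ((5 / 2 + 2 * (k + 1)) * g2) := by
      rw [eq_div_iff (mul_ne_zero (by positivity) hG2)]
      linarith
    have e3 : C = f2 * A / f1 := by
      rw [eq_div_iff hfa.ne']
      exact hc
    rw [e1, e2, e3]
    field_simp
  have l1 : Tendsto (fun k : ℕ => G (k + 1)) atTop (𝓝 (Real.Gamma (5 / 2))) :=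
    hlim.comp (tendsto_add_atTop_nat 1)
  have l2 : Tendsto (fun k : ℕ => G (2 * (k + 1))) atTop (𝓝 (Real.Gamma (5 / 2))) :=
    hlim.comp (tendsto_atTop_mono (fun k => by simp; omega) tendsto_id)
  have l3 : Tendsto (fun k : ℕ => (5 / 2 + (k + 1 : ℝ)) / (5 / 2 + 2 * (k + 1 : ℝ))) atTop
      (𝓝 (1 / 2)) := by
    have h2 : Tendsto (fun k : ℕ => 1 / 2 + 5 / 4 / (2 * (k : ℝ) + 9 / 2)) atTop
        (𝓝 (1 / 2 + 0)) := by
      refine tendsto_const_nhds.add (Tendsto.const_div_atTop ?_ _)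
      exact tendsto_atTop_add_const_right _ _
        (tendsto_natCast_atTop_atTop.const_mul_atTop (by norm_num))
    rw [add_zero] at h2
    refine h2.congr fun k => ?_
    have h3 : (2 * (k : ℝ) + 9 / 2) ≠ 0 := by positivity
    have h4 : (5 / 2 + 2 * ((k : ℝ) + 1)) ≠ 0 := by positivity
    field_simp
    ring
  have := l3.mul (l1.div l2 hΓ.ne')
  rw [div_self hΓ.ne', mul_one] at this
  exact this.congr fun k => (hμ k).symm

theorem integrable_radialMeasure_iff {ρ : ℝ} (hρ : 0 ≤ ρ) {f : ℝ → ℝ} :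
    Integrable f (radialMeasure ρ) ↔ IntegrableOn (fun r => f r * r ^ 5) (Ioi ρ) := by
  rw [radialMeasure, integrable_withDensity_iff_integrable_smul' (by fun_prop) (by simp)]
  refine integrable_congr ?_
  filter_upwards [ae_restrict_mem measurableSet_Ioi] with r hr
  rw [ENNReal.toReal_ofReal (pow_nonneg (hρ.trans (le_of_lt hr)) 5), smul_eq_mul, mul_comm]

theorem integral_radialMeasure {ρ : ℝ} (hρ : 0 ≤ ρ) (f : ℝ → ℝ) :
    ∫ r, f r ∂radialMeasure ρ = ∫ r in Ioi ρ, f r * r ^ 5 := by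
  rw [radialMeasure, integral_withDensity_eq_integral_toReal_smul (by fun_prop) (by simp)]
  refine setIntegral_congr_fun measurableSet_Ioi fun r hr => ?_
  simp only [smul_eq_mul]
  rw [ENNReal.toReal_ofReal (pow_nonneg (hρ.trans (le_of_lt hr)) 5), mul_comm]

theorem ae_radialMeasure_iff {ρ : ℝ} (hρ : 0 ≤ ρ) {p : ℝ → Prop} :
    (∀ᵐ r ∂radialMeasure ρ, p r) ↔ ∀ᵐ r ∂(volume.restrict (Ioi ρ)), p r := by
  rw [radialMeasure, ae_withDensity_iff (by fun_prop)]
  refine ⟨fun h => ?_, fun h => h.mono fun r hr _ => hr⟩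
  filter_upwards [h, ae_restrict_mem measurableSet_Ioi] with r hr hr'
  exact hr (by simpa using pow_pos (hρ.trans_lt hr') 5)

theorem radialMeasure_absolutelyContinuous (ρ : ℝ) :
    radialMeasure ρ ≪ volume.restrict (Ioi ρ) := withDensity_absolutelyContinuous _ _

theorem radialMeasure_restrict {ρ ρ' : ℝ} (h : ρ ≤ ρ') :
    (radialMeasure ρ).restrict (Ioi ρ') = radialMeasure ρ' := by
  rw [radialMeasure, restrict_withDensity measurableSet_Ioi, Measure.restrict_restrict
    measurableSet_Ioi, inter_eq_self_of_subset_left (Ioi_subset_Ioi h), radialMeasure]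

theorem radialMeasure_mono {ρ ρ' : ℝ} (h : ρ ≤ ρ') : radialMeasure ρ' ≤ radialMeasure ρ := by
  rw [← radialMeasure_restrict h]
  exact Measure.restrict_le_self

theorem memLp_radialMeasure_iff {ρ : ℝ} (hρ : 0 ≤ ρ) {f : ℝ → ℝ}
    (hf : AEStronglyMeasurable f (radialMeasure ρ)) :
    MemLp f 2 (radialMeasure ρ) ↔ IntegrableOn (fun r => |f r| ^ 2 * r ^ 5) (Ioi ρ) := by
  rw [memLp_two_iff_integrable_sq hf, integrable_radialMeasure_iff hρ]
  simp only [sq_abs]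

/-- The norm of a radial function on `(ρ, ∞)`. -/
def radialNorm (ρ : ℝ) (f : ℝ → ℝ) : ℝ := (eLpNorm f 2 (radialMeasure ρ)).toReal

theorem radialNorm_sq {ρ : ℝ} (hρ : 0 ≤ ρ) {f : ℝ → ℝ} (hf : MemLp f 2 (radialMeasure ρ)) :
    radialNorm ρ f ^ 2 = ∫ r in Ioi ρ, |f r| ^ 2 * r ^ 5 := by
  rw [← integral_radialMeasure hρ (fun r => |f r| ^ 2), radialNorm,
    hf.eLpNorm_eq_integral_rpow_norm (by norm_num) (by norm_num)]
  have h0 : 0 ≤ ∫ r, |f r| ^ 2 ∂radialMeasure ρ := integral_nonneg fun _ => by positivity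
  simp only [ENNReal.toReal_ofNat, Real.norm_eq_abs, Real.rpow_ofNat]
  rw [ENNReal.toReal_ofReal (by positivity), ← Real.rpow_natCast, ← Real.rpow_mul h0]
  norm_num

theorem radialNorm_nonneg (ρ : ℝ) (f : ℝ → ℝ) : 0 ≤ radialNorm ρ f := ENNReal.toReal_nonneg

theorem abs_radialNorm_sub_le {ρ : ℝ} {f g : ℝ → ℝ} (hf : MemLp f 2 (radialMeasure ρ))
    (hg : MemLp g 2 (radialMeasure ρ)) :
    |radialNorm ρ f - radialNorm ρ g| ≤ radialNorm ρ (f - g) := by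
  have h := abs_norm_sub_norm_le (hf.toLp f) (hg.toLp g)
  rwa [← MemLp.toLp_sub, Lp.norm_toLp, Lp.norm_toLp, Lp.norm_toLp] at h

/-- `w` decays like a free wave in the exterior of the light cone, with radiation field `G`. -/
structure HasRadiation (R : ℝ) (w : ℝ → ℝ → ℝ) (G : ℝ → ℝ) : Prop where
  meas : ∀ t, Measurable (w t)
  bound : ∃ K : ℝ, ∀ t, 0 ≤ t → ∀ s, R < s →
    |w t (t + s) * (t + s) ^ (5 / 2 : ℝ)| ≤ K * s ^ (-(5 / 2 : ℝ))
  lim : ∀ s, R < s → Tendsto (fun t => w t (t + s) * (t + s) ^ (5 / 2 : ℝ)) atTop (𝓝 (G s))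

namespace HasRadiation

variable {R : ℝ} {w w' : ℝ → ℝ → ℝ} {G G' : ℝ → ℝ}

theorem zero (R : ℝ) : HasRadiation R (fun _ _ => 0) (fun _ => 0) where
  meas _ := measurable_const
  bound := ⟨0, fun t _ s _ => by simp⟩
  lim s _ := by simp

theorem add (h : HasRadiation R w G) (h' : HasRadiation R w' G') :
    HasRadiation R (fun t r => w t r + w' t r) (fun s => G s + G' s) where
  meas t := (h.meas t).add (h'.meas t)
  bound := by
    obtain ⟨K, hK⟩ := h.bound
    obtain ⟨K', hK'⟩ := h'.bound
    refine ⟨K + K', fun t ht s hs => ?_⟩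
    rw [add_mul, add_mul]
    exact (abs_add_le _ _).trans (add_le_add (hK t ht s hs) (hK' t ht s hs))
  lim s hs := by simpa only [add_mul] using (h.lim s hs).add (h'.lim s hs)

theorem const_mul (h : HasRadiation R w G) (c : ℝ) :
    HasRadiation R (fun t r => c * w t r) (fun s => c * G s) where
  meas t := (h.meas t).const_mul c
  bound := by
    obtain ⟨K, hK⟩ := h.bound
    refine ⟨|c| * K, fun t ht s hs => ?_⟩
    rw [mul_assoc, mul_assoc, abs_mul]
    exact mul_le_mul_of_nonneg_left (hK t ht s hs) (abs_nonneg c)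
  lim s hs := by simpa only [mul_assoc] using (h.lim s hs).const_mul c

theorem sum {ι : Type*} {W : ι → ℝ → ℝ → ℝ} {G : ι → ℝ → ℝ} (s : Finset ι)
    (h : ∀ i ∈ s, HasRadiation R (W i) (G i)) :
    HasRadiation R (fun t r => ∑ i ∈ s, W i t r) (fun x => ∑ i ∈ s, G i x) := by
  classical
  induction s using Finset.induction_on with
  | empty => simpa using zero R
  | insert a s ha ih =>
    simp only [Finset.sum_insert ha]
    exact (h a (Finset.mem_insert_self a s)).add
      (ih fun i hi => h i (Finset.mem_insert_of_mem hi))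

theorem congr_right (h : HasRadiation R w G) (hG : ∀ s, R < s → G s = G' s) :
    HasRadiation R w G' :=
  ⟨h.meas, h.bound, fun s hs => hG s hs ▸ h.lim s hs⟩

theorem sq_mul_eq {t s : ℝ} (hs : 0 ≤ t + s) (x : ℝ) :
    |x| ^ 2 * (t + s) ^ 5 = (x * (t + s) ^ (5 / 2 : ℝ)) ^ 2 := by
  rw [mul_pow, sq_abs, ← Real.rpow_natCast ((t + s) ^ (5 / 2 : ℝ)), ← Real.rpow_mul hs]
  norm_num

theorem integrableOn_sq_bound (hR : 0 < R) (K : ℝ) :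
    IntegrableOn (fun s : ℝ => (K * s ^ (-(5 / 2 : ℝ))) ^ 2) (Ioi R) := by
  have h : IntegrableOn (fun s : ℝ => K ^ 2 * s ^ (-5 : ℝ)) (Ioi R) :=
    (integrableOn_Ioi_rpow_of_lt (a := -5) (by norm_num) hR).const_mul (K ^ 2)
  refine h.congr_fun (fun s hs => ?_) measurableSet_Ioi
  have hs0 : (0 : ℝ) < s := hR.trans hs
  simp only
  rw [mul_pow, ← Real.rpow_natCast (s ^ _), ← Real.rpow_mul hs0.le]
  norm_num

theorem integrableOn_shift (hR : 0 < R) (h : HasRadiation R w G) {t : ℝ} (ht : 0 ≤ t) :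
    IntegrableOn (fun s => |w t (t + s)| ^ 2 * (t + s) ^ 5) (Ioi R) := by
  obtain ⟨K, hK⟩ := h.bound
  refine (integrableOn_sq_bound hR K).mono' ?_ ?_
  · exact ((((h.meas t).comp (measurable_const_add t)).abs.pow_const 2).mul
      (by fun_prop)).aestronglyMeasurable
  · filter_upwards [ae_restrict_mem measurableSet_Ioi] with s hs
    have hs0 : (0 : ℝ) < s := hR.trans hs
    rw [sq_mul_eq (by positivity), Real.norm_eq_abs, abs_pow]
    exact pow_le_pow_left₀ (abs_nonneg _) (hK t ht s hs) 2

theorem setIntegral_shift (f : ℝ → ℝ) (t R : ℝ) :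
    ∫ r in Ioi (t + R), f r = ∫ s in Ioi R, f (t + s) := by
  have h := (measurePreserving_add_left volume t).setIntegral_preimage_emb
    (measurableEmbedding_addLeft t) f (Ioi (t + R))
  rw [← h]
  simp

theorem integrableOn_shift_iff (f : ℝ → ℝ) (t R : ℝ) :
    IntegrableOn f (Ioi (t + R)) ↔ IntegrableOn (fun s => f (t + s)) (Ioi R) := by
  have h := (measurePreserving_add_left volume t).integrableOn_comp_preimage
    (measurableEmbedding_addLeft t) (f := f) (s := Ioi (t + R))
  rw [← h]
  simp [Function.comp_def]

theorem memLp (hR : 0 < R) (h : HasRadiation R w G) {t : ℝ} (ht : 0 ≤ t) :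
    MemLp (w t) 2 (radialMeasure (t + R)) := by
  rw [memLp_radialMeasure_iff (by positivity) (h.meas t).aestronglyMeasurable,
    integrableOn_shift_iff (fun r => |w t r| ^ 2 * r ^ 5)]
  exact h.integrableOn_shift hR ht

theorem exists_radialNorm_le (hR : 0 < R) (h : HasRadiation R w G) :
    ∃ K : ℝ, ∀ t, 0 ≤ t → radialNorm (t + R) (w t) ≤ K := by
  obtain ⟨K, hK⟩ := h.bound
  refine ⟨√(∫ s in Ioi R, (K * s ^ (-(5 / 2 : ℝ))) ^ 2), fun t ht => ?_⟩
  refine Real.le_sqrt_of_sq_le ?_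
  rw [radialNorm_sq (by positivity) (h.memLp hR ht),
    setIntegral_shift (fun r => |w t r| ^ 2 * r ^ 5)]
  refine setIntegral_mono_on (h.integrableOn_shift hR ht) (integrableOn_sq_bound hR K)
    measurableSet_Ioi fun s hs => ?_
  have hs0 : (0 : ℝ) < s := hR.trans hs
  rw [sq_mul_eq (by positivity), ← sq_abs]
  exact pow_le_pow_left₀ (abs_nonneg _) (hK t ht s hs) 2

theorem tendsto_radialNorm_sq (hR : 0 < R) (h : HasRadiation R w G) :
    Tendsto (fun t => radialNorm (t + R) (w t) ^ 2) atTop (𝓝 (∫ s in Ioi R, G s ^ 2)) := by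
  obtain ⟨K, hK⟩ := h.bound
  have key : Tendsto (fun t => ∫ s in Ioi R, (w t (t + s) * (t + s) ^ (5 / 2 : ℝ)) ^ 2) atTop
      (𝓝 (∫ s in Ioi R, G s ^ 2)) := by
    refine tendsto_integral_filter_of_dominated_convergence
      (fun s : ℝ => (K * s ^ (-(5 / 2 : ℝ))) ^ 2) ?_ ?_ (integrableOn_sq_bound hR K) ?_
    · exact Eventually.of_forall fun t => ((((h.meas t).comp (measurable_const_add t)).mul
        (by fun_prop)).pow_const 2).aestronglyMeasurable
    · filter_upwards [eventually_ge_atTop 0] with t ht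
      filter_upwards [ae_restrict_mem measurableSet_Ioi] with s hs
      rw [Real.norm_eq_abs, abs_pow]
      exact pow_le_pow_left₀ (abs_nonneg _) (hK t ht s hs) 2
    · filter_upwards [ae_restrict_mem measurableSet_Ioi] with s hs
      exact (h.lim s hs).pow 2
  refine key.congr' ?_
  filter_upwards [eventually_ge_atTop 0] with t ht
  rw [radialNorm_sq (by positivity) (h.memLp hR ht),
    setIntegral_shift (fun r => |w t r| ^ 2 * r ^ 5)]
  refine setIntegral_congr_fun measurableSet_Ioi fun s hs => ?_
  have hs0 : (0 : ℝ) < s := hR.trans hs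
  rw [sq_mul_eq (by positivity)]

end HasRadiation

theorem measurable_powDeriv (i : ℕ) : Measurable (powDeriv i) := by
  unfold powDeriv
  fun_prop

theorem coneTerm_shift (x : ℕ × ℕ) {t s : ℝ} (ht : 0 ≤ t) (hs : 0 < s) :
    coneTerm x t (t + s) * (t + s) ^ (5 / 2 : ℝ) =
      powDeriv x.1 s * risingHalf x.2 * (((t + s) / (2 * t + s)) ^ (5 / 2 : ℝ) *
        (2 * t + s) ^ (-(x.2 : ℝ))) := by
  have h1 : 0 < 2 * t + s := by positivity
  have h2 : 0 ≤ t + s := by positivity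
  rw [coneTerm, powDeriv, powDeriv, Real.div_rpow h2 h1.le, add_sub_cancel_left,
    show t + s + t = 2 * t + s by ring, show -(5 / 2 : ℝ) - x.2 = -(x.2 : ℝ) - 5 / 2 by ring,
    Real.rpow_sub h1, powDeriv]
  ring

theorem hasRadiation_coneTerm {R : ℝ} (hR : 0 < R) (x : ℕ × ℕ) :
    HasRadiation R (coneTerm x)
      (fun s => if x.2 = 0 then 2 ^ (-(5 / 2 : ℝ)) * powDeriv x.1 s else 0) where
  meas t := ((measurable_powDeriv _).comp (by fun_prop)).mul
    ((measurable_powDeriv _).comp (by fun_prop))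
  bound := by
    refine ⟨risingHalf x.1 * risingHalf x.2 * R ^ (-((x.1 : ℝ) + x.2)), fun t ht s hs => ?_⟩
    have hs0 : 0 < s := hR.trans hs
    have h1 : 0 < 2 * t + s := by positivity
    have h2 : 0 ≤ t + s := by positivity
    have hr1 := (risingHalf_pos x.1).le
    have hr2 := (risingHalf_pos x.2).le
    rw [coneTerm_shift x ht hs0, abs_of_nonneg (by have := powDeriv_nonneg x.1 hs0; positivity),
      powDeriv]
    have e1 : ((t + s) / (2 * t + s)) ^ (5 / 2 : ℝ) ≤ 1 :=
      Real.rpow_le_one (by positivity) ((div_le_one h1).2 (by linarith)) (by norm_num)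
    have e2 : (2 * t + s) ^ (-(x.2 : ℝ)) ≤ s ^ (-(x.2 : ℝ)) :=
      Real.rpow_le_rpow_of_nonpos hs0 (by linarith) (by simp)
    have e3 : s ^ (-(5 / 2 : ℝ) - x.1) * s ^ (-(x.2 : ℝ)) ≤
        R ^ (-((x.1 : ℝ) + x.2)) * s ^ (-(5 / 2 : ℝ)) := by
      rw [← Real.rpow_add hs0, show -(5 / 2 : ℝ) - x.1 + -(x.2 : ℝ) =
        -((x.1 : ℝ) + x.2) + -(5 / 2 : ℝ) by ring, Real.rpow_add hs0]
      gcongr ?_ * _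
      exact Real.rpow_le_rpow_of_nonpos hR hs.le (by
        have : (0 : ℝ) ≤ x.1 + x.2 := by positivity
        linarith)
    calc risingHalf x.1 * s ^ (-(5 / 2 : ℝ) - x.1) * risingHalf x.2 *
          (((t + s) / (2 * t + s)) ^ (5 / 2 : ℝ) * (2 * t + s) ^ (-(x.2 : ℝ)))
        ≤ risingHalf x.1 * s ^ (-(5 / 2 : ℝ) - x.1) * risingHalf x.2 *
          (1 * s ^ (-(x.2 : ℝ))) := by gcongr
      _ = risingHalf x.1 * risingHalf x.2 *
          (s ^ (-(5 / 2 : ℝ) - x.1) * s ^ (-(x.2 : ℝ))) := by ring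
      _ ≤ risingHalf x.1 * risingHalf x.2 *
          (R ^ (-((x.1 : ℝ) + x.2)) * s ^ (-(5 / 2 : ℝ))) := by gcongr
      _ = _ := by ring
  lim s hs := by
    have hs0 : 0 < s := hR.trans hs
    have h0 : Tendsto (fun t : ℝ => 2 * t + s) atTop atTop :=
      tendsto_atTop_add_const_right _ _ (tendsto_id.const_mul_atTop (by norm_num))
    have h1 : Tendsto (fun t : ℝ => (t + s) / (2 * t + s)) atTop (𝓝 (1 / 2)) := by
      have h2 : Tendsto (fun t : ℝ => 1 / 2 + s / 2 / (2 * t + s)) atTop (𝓝 (1 / 2 + 0)) :=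
        tendsto_const_nhds.add (Tendsto.const_div_atTop h0 _)
      rw [add_zero] at h2
      refine h2.congr' ?_
      filter_upwards [eventually_ge_atTop 0] with t ht
      have : 2 * t + s ≠ 0 := by positivity
      field_simp
      ring
    have h2 : Tendsto (fun t : ℝ => (2 * t + s) ^ (-(x.2 : ℝ))) atTop
        (𝓝 (if x.2 = 0 then 1 else 0)) := by
      split_ifs with hx
      · simp [hx]
      · exact (tendsto_rpow_neg_atTop (by positivity)).comp h0
    have h3 := ((h1.rpow_const (p := 5 / 2) (Or.inl (by norm_num))).mul h2).const_mul
      (powDeriv x.1 s * risingHalf x.2)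
    have h4 : powDeriv x.1 s * risingHalf x.2 *
        ((1 / 2 : ℝ) ^ (5 / 2 : ℝ) * (if x.2 = 0 then 1 else 0)) =
        if x.2 = 0 then 2 ^ (-(5 / 2 : ℝ)) * powDeriv x.1 s else 0 := by
      split_ifs with hx
      · rw [hx, one_div, Real.inv_rpow (by norm_num), Real.rpow_neg (by norm_num)]
        simp [risingHalf]
        ring
      · simp
    rw [h4] at h3
    refine h3.congr' ?_
    filter_upwards [eventually_ge_atTop 0] with t ht
    exact (coneTerm_shift x ht hs0).symm

theorem hasRadiation_coneSum {R : ℝ} {m : ℕ} {F : ℕ × ℕ → ℝ → ℝ → ℝ} {G : ℕ × ℕ → ℝ → ℝ}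
    (h : ∀ x, HasRadiation R (F x) (G x)) :
    HasRadiation R (fun t r => coneSum m (fun x => F x t r))
      (fun s => coneSum m (fun x => G x s)) :=
  HasRadiation.sum _ fun x _ => ((h x).const_mul _).const_mul _

theorem coneSum_single (m : ℕ) (f : ℕ → ℝ) :
    coneSum m (fun x => if x.2 = 0 then f x.1 else 0) = f m := by
  rw [coneSum, Finset.sum_eq_single (m, 0)]
  · simp
  · intro x hx hne
    have hx' := Finset.HasAntidiagonal.mem_antidiagonal.1 hx
    have : x.2 ≠ 0 := fun h0 => hne (Prod.ext (by simpa [h0] using hx') h0)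
    simp [this]
  · simp

theorem hasRadiation_homSol {R : ℝ} (hR : 0 < R) (m : ℕ) :
    HasRadiation R (homSol m) (fun s => 2 ^ (-(5 / 2 : ℝ)) * powDeriv m s) :=
  (hasRadiation_coneSum fun x => hasRadiation_coneTerm hR x).congr_right fun s _ =>
    coneSum_single m fun i => 2 ^ (-(5 / 2 : ℝ)) * powDeriv i s

theorem hasRadiation_homSolR {R : ℝ} (hR : 0 < R) (m : ℕ) :
    HasRadiation R (homSolR m) (fun s => -(2 ^ (-(5 / 2 : ℝ)) * powDeriv (m + 1) s)) := by
  have h := (hasRadiation_coneSum (m := m) fun x =>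
    (hasRadiation_coneTerm hR (x.1 + 1, x.2)).add
      (hasRadiation_coneTerm hR (x.1, x.2 + 1))).const_mul (-1)
  have e : (fun t r => -1 * coneSum m fun x =>
      coneTerm (x.1 + 1, x.2) t r + coneTerm (x.1, x.2 + 1) t r) = homSolR m := by
    funext t r
    rw [homSolR, neg_one_mul]
  rw [e] at h
  refine h.congr_right fun s _ => ?_
  have := coneSum_single m fun i => 2 ^ (-(5 / 2 : ℝ)) * powDeriv (i + 1) s
  simp only [neg_mul, one_mul, neg_inj]
  rw [← this]
  exact coneSum_congr fun x _ => by simp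

/-- The `l`-th time derivative of the explicit exterior solution with initial velocity
`∑ a k / r^(7 + 2k)`. -/
def extSol (s : Finset ℕ) (a : ℕ → ℝ) (l : ℕ) (t r : ℝ) : ℝ :=
  ∑ k ∈ s, a k / homCoef (2 * k + 2) * homSol (2 * k + 1 + l) t r

/-- The radial derivative of the explicit exterior solution. -/
def extSolR (s : Finset ℕ) (a : ℕ → ℝ) (t r : ℝ) : ℝ :=
  ∑ k ∈ s, a k / homCoef (2 * k + 2) * homSolR (2 * k + 1) t r

/-- The second radial derivative of the explicit exterior solution. -/
def extSolRR (s : Finset ℕ) (a : ℕ → ℝ) (t r : ℝ) : ℝ :=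
  ∑ k ∈ s, a k / homCoef (2 * k + 2) * homSolRR (2 * k + 1) t r

/-- The initial velocity of the explicit exterior solution. -/
def extData (s : Finset ℕ) (a : ℕ → ℝ) (r : ℝ) : ℝ := ∑ k ∈ s, a k * (r ^ (7 + 2 * k))⁻¹

section ExplicitSolution

variable (s : Finset ℕ) (a : ℕ → ℝ)

theorem hasDerivAt_extSol_time (l : ℕ) {t r : ℝ} (h : |t| < r) :
    HasDerivAt (fun t => extSol s a l t r) (extSol s a (l + 1) t r) t :=
  HasDerivAt.fun_sum fun k _ => (hasDerivAt_homSol_time (2 * k + 1 + l) h).const_mul _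

theorem hasDerivAt_extSol_radial {t r : ℝ} (h : |t| < r) :
    HasDerivAt (fun r => extSol s a 0 t r) (extSolR s a t r) r :=
  HasDerivAt.fun_sum fun k _ => (hasDerivAt_homSol_radial (2 * k + 1) h).const_mul _

theorem hasDerivAt_extSolR_radial {t r : ℝ} (h : |t| < r) :
    HasDerivAt (fun r => extSolR s a t r) (extSolRR s a t r) r :=
  HasDerivAt.fun_sum fun k _ => (hasDerivAt_homSolR_radial (2 * k + 1) h).const_mul _

theorem extSol_wave {t r : ℝ} (h : |t| < r) :
    extSol s a 2 t r = extSolRR s a t r + 5 / r * extSolR s a t r := by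
  simp only [extSol, extSolRR, extSolR, Finset.mul_sum, ← Finset.sum_add_distrib]
  refine Finset.sum_congr rfl fun k _ => ?_
  rw [homSol_wave _ h]
  ring

theorem extSol_zero {r : ℝ} (hr : 0 < r) : extSol s a 0 0 r = 0 :=
  Finset.sum_eq_zero fun k _ => by rw [add_zero, homSol_zero _ hr, homCoef_odd]; ring

theorem extSol_one_zero {r : ℝ} (hr : 0 < r) : extSol s a 1 0 r = extData s a r := by
  refine Finset.sum_congr rfl fun k _ => ?_
  have h := (homCoef_even_pos (k + 1)).ne'
  rw [show 2 * (k + 1) = 2 * k + 2 by ring] at h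
  rw [homSol_zero _ hr, show 2 * k + 1 + 1 = 2 * k + 2 by ring,
    show 5 + (2 * k + 2) = 7 + 2 * k by ring]
  field_simp

/-- The radiation field of the explicit exterior solution. -/
def extRad (x : ℝ) : ℝ := ∑ k ∈ s, a k * radSymbol k * x ^ (-(5 / 2 : ℝ) - (2 * k + 2 : ℕ))

theorem hasRadiation_extSol {R : ℝ} (hR : 0 < R) (l : ℕ) :
    HasRadiation R (extSol s a l) (fun x => ∑ k ∈ s, a k / homCoef (2 * k + 2) *
      (2 ^ (-(5 / 2 : ℝ)) * powDeriv (2 * k + 1 + l) x)) :=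
  HasRadiation.sum s fun k _ => (hasRadiation_homSol hR (2 * k + 1 + l)).const_mul _

theorem hasRadiation_extSol_one {R : ℝ} (hR : 0 < R) :
    HasRadiation R (extSol s a 1) (extRad s a) :=
  (hasRadiation_extSol s a hR 1).congr_right fun x _ => Finset.sum_congr rfl fun k _ => by
    rw [powDeriv, radSymbol, show 2 * k + 1 + 1 = 2 * k + 2 by ring]
    ring

theorem hasRadiation_extSolR {R : ℝ} (hR : 0 < R) :
    HasRadiation R (extSolR s a) (fun x => -extRad s a x) := by
  refine (HasRadiation.sum s fun k _ =>
    (hasRadiation_homSolR hR (2 * k + 1)).const_mul (a k / homCoef (2 * k + 2))).congr_right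
    fun x _ => ?_
  rw [extRad, ← Finset.sum_neg_distrib]
  refine Finset.sum_congr rfl fun k _ => ?_
  rw [powDeriv, radSymbol, show 2 * k + 1 + 1 = 2 * k + 2 by ring]
  ring

theorem integral_inv_pow {R : ℝ} (hR : 0 < R) (n : ℕ) :
    IntegrableOn (fun x : ℝ => (x ^ (n + 2))⁻¹) (Ioi R) ∧
      ∫ x in Ioi R, (x ^ (n + 2))⁻¹ = (R ^ (n + 1))⁻¹ / (n + 1) := by
  have hlt : -((n : ℝ) + 2) < -1 := by
    have : (0 : ℝ) ≤ n := by positivity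
    linarith
  have e : ∀ x ∈ Ioi R, x ^ (-((n : ℝ) + 2)) = (x ^ (n + 2))⁻¹ := by
    intro x hx
    rw [Real.rpow_neg (hR.trans hx).le]
    exact_mod_cast rfl
  refine ⟨(integrableOn_Ioi_rpow_of_lt hlt hR).congr_fun e measurableSet_Ioi, ?_⟩
  rw [← setIntegral_congr_fun measurableSet_Ioi e, integral_Ioi_rpow_of_lt hlt hR,
    show -((n : ℝ) + 2) + 1 = -((n : ℝ) + 1) by ring, Real.rpow_neg hR.le]
  rw [show R ^ ((n : ℝ) + 1) = R ^ (n + 1) by exact_mod_cast rfl]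
  have : (n : ℝ) + 1 ≠ 0 := by positivity
  field_simp

theorem integral_extRad_sq {R : ℝ} (hR : 0 < R) :
    ∫ x in Ioi R, extRad s a x ^ 2 = cauchyForm s (fun k => 2 * (k : ℝ) + 4)
      (fun k => a k * (R ^ (2 * k + 4))⁻¹ * radSymbol k) := by
  have h1 : ∀ x ∈ Ioi R, extRad s a x ^ 2 = ∑ i ∈ s, ∑ j ∈ s,
      a i * radSymbol i * (a j * radSymbol j) * (x ^ (2 * i + 2 * j + 7 + 2))⁻¹ := by
    intro x hx
    have hx0 : 0 < x := hR.trans hx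
    rw [sq, extRad, Finset.sum_mul_sum]
    refine Finset.sum_congr rfl fun i _ => Finset.sum_congr rfl fun j _ => ?_
    have e : x ^ (-(5 / 2 : ℝ) - (2 * i + 2 : ℕ)) * x ^ (-(5 / 2 : ℝ) - (2 * j + 2 : ℕ)) =
        (x ^ (2 * i + 2 * j + 7 + 2))⁻¹ := by
      rw [← Real.rpow_add hx0, ← Real.rpow_natCast, ← Real.rpow_neg hx0.le]
      congr 1
      push_cast
      ring
    rw [← e]
    ring
  have hint : ∀ i j, IntegrableOn (fun x => a i * radSymbol i * (a j * radSymbol j) *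
      (x ^ (2 * i + 2 * j + 7 + 2))⁻¹) (Ioi R) := fun i j =>
    (integral_inv_pow hR _).1.const_mul _
  rw [setIntegral_congr_fun measurableSet_Ioi h1,
    integral_finsetSum _ fun i _ => integrable_finsetSum _ fun j _ => hint i j]
  refine Finset.sum_congr rfl fun i _ => ?_
  rw [integral_finsetSum _ fun j _ => hint i j]
  refine Finset.sum_congr rfl fun j _ => ?_
  rw [integral_const_mul, (integral_inv_pow hR _).2]
  push_cast
  have h3 : (2 * (i : ℝ) + 4 + (2 * j + 4)) ≠ 0 := by positivity
  have h4 : (2 * (i : ℝ) + 2 * j + 7 + 1) ≠ 0 := by positivity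
  field_simp
  ring

theorem exists_integral_extData_sub_sq {R : ℝ} (hR : 0 < R) :
    ∃ c : ℝ, ∫ x in Ioi R, |extData s a x - c * (1 / x ^ 4)| ^ 2 * x ^ 5 =
      cauchyForm s (fun k => 2 * (k : ℝ) + 4)
        (fun k => a k * (R ^ (2 * k + 4))⁻¹ * ((2 * (k : ℝ) + 3) / (2 * k + 5))) := by
  set S : ℝ := ∑ k ∈ s, a k * (R ^ (2 * k + 4))⁻¹ / (2 * k + 5) with hS
  set c : ℝ := 2 * R * S with hc
  refine ⟨c, ?_⟩
  have h1 : ∀ x ∈ Ioi R, |extData s a x - c * (1 / x ^ 4)| ^ 2 * x ^ 5 =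
      (∑ i ∈ s, ∑ j ∈ s, a i * a j * (x ^ (2 * i + 2 * j + 7 + 2))⁻¹) -
        (∑ i ∈ s, 2 * c * a i * (x ^ (2 * i + 4 + 2))⁻¹) + c ^ 2 * (x ^ (1 + 2))⁻¹ := by
    intro x hx
    have hx0 : x ≠ 0 := (hR.trans hx).ne'
    have e1 : (∑ i ∈ s, ∑ j ∈ s, a i * a j * (x ^ (2 * i + 2 * j + 7 + 2))⁻¹) =
        extData s a x ^ 2 * x ^ 5 := by
      rw [sq, extData, Finset.sum_mul_sum, Finset.sum_mul]
      refine Finset.sum_congr rfl fun i _ => ?_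
      rw [Finset.sum_mul]
      refine Finset.sum_congr rfl fun j _ => ?_
      field_simp
      ring
    have e2 : (∑ i ∈ s, 2 * c * a i * (x ^ (2 * i + 4 + 2))⁻¹) = 2 * c * extData s a x * x := by
      rw [extData, Finset.mul_sum, Finset.sum_mul]
      refine Finset.sum_congr rfl fun i _ => ?_
      field_simp
      ring
    rw [e1, e2, sq_abs]
    field_simp
    ring
  have hint : ∀ i j, IntegrableOn (fun x => a i * a j *
      (x ^ (2 * i + 2 * j + 7 + 2))⁻¹) (Ioi R) := fun i j =>
    (integral_inv_pow hR _).1.const_mul _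
  have hint' : ∀ i, IntegrableOn (fun x => 2 * c * a i * (x ^ (2 * i + 4 + 2))⁻¹) (Ioi R) :=
    fun i => (integral_inv_pow hR _).1.const_mul _
  have hI1 : IntegrableOn (fun x => ∑ i ∈ s, ∑ j ∈ s, a i * a j *
      (x ^ (2 * i + 2 * j + 7 + 2))⁻¹) (Ioi R) :=
    integrable_finsetSum _ fun i _ => integrable_finsetSum _ fun j _ => hint i j
  have hI2 : IntegrableOn (fun x => ∑ i ∈ s, 2 * c * a i * (x ^ (2 * i + 4 + 2))⁻¹) (Ioi R) :=
    integrable_finsetSum _ fun i _ => hint' i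
  have hI3 : IntegrableOn (fun x : ℝ => c ^ 2 * (x ^ (1 + 2))⁻¹) (Ioi R) :=
    (integral_inv_pow hR _).1.const_mul _
  have hI12 : IntegrableOn (fun x => (∑ i ∈ s, ∑ j ∈ s, a i * a j *
      (x ^ (2 * i + 2 * j + 7 + 2))⁻¹) - ∑ i ∈ s, 2 * c * a i * (x ^ (2 * i + 4 + 2))⁻¹) (Ioi R) :=
    hI1.sub hI2
  rw [setIntegral_congr_fun measurableSet_Ioi h1, integral_add hI12 hI3,
    integral_sub hI1 hI2, integral_finsetSum _ fun i _ => integrable_finsetSum _ fun j _ => hint i j,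
    integral_finsetSum _ fun i _ => hint' i]
  have hsum : ∑ i ∈ s, ∫ x in Ioi R, 2 * c * a i * (x ^ (2 * i + 4 + 2))⁻¹ = 2 * c / R * S := by
    rw [hS, Finset.mul_sum]
    refine Finset.sum_congr rfl fun i _ => ?_
    rw [integral_const_mul, (integral_inv_pow hR _).2]
    push_cast
    have h3 : (2 * (i : ℝ) + 4 + 1) ≠ 0 := by positivity
    have h4 : (2 * (i : ℝ) + 5) ≠ 0 := by positivity
    field_simp
    ring
  rw [hsum, integral_const_mul, (integral_inv_pow hR _).2, hc]
  have e3 : 2 * (2 * R * S) / R * S = 4 * (S * S) := by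
    field_simp
    ring
  have e4 : (2 * R * S) ^ 2 * ((R ^ (1 + 1))⁻¹ / ((1 : ℕ) + 1)) = 2 * (S * S) := by
    field_simp
    norm_num
    ring
  rw [e3, e4, sub_add, show 4 * (S * S) - 2 * (S * S) = 2 * (S * S) by ring, hS,
    Finset.sum_mul_sum, Finset.mul_sum, ← Finset.sum_sub_distrib, cauchyForm]
  refine Finset.sum_congr rfl fun i _ => ?_
  rw [integral_finsetSum _ fun j _ => hint i j, Finset.mul_sum, ← Finset.sum_sub_distrib]
  refine Finset.sum_congr rfl fun j _ => ?_
  rw [integral_const_mul, (integral_inv_pow hR _).2]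
  push_cast
  have h3 : (2 * (i : ℝ) + 4 + (2 * j + 4)) ≠ 0 := by positivity
  have h4 : (2 * (i : ℝ) + 2 * j + 7 + 1) ≠ 0 := by positivity
  have h5 : (2 * (i : ℝ) + 5) ≠ 0 := by positivity
  have h6 : (2 * (j : ℝ) + 5) ≠ 0 := by positivity
  field_simp
  ring

theorem exists_integral_extData_sub_sq_le {R : ℝ} (hR : 0 < R) :
    ∃ c : ℝ, (3 / 20) * ∫ x in Ioi R, |extData s a x - c * (1 / x ^ 4)| ^ 2 * x ^ 5 ≤
      ∫ x in Ioi R, extRad s a x ^ 2 := by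
  obtain ⟨c, hc⟩ := exists_integral_extData_sub_sq s a hR
  refine ⟨c, ?_⟩
  rw [hc, integral_extRad_sq s a hR]
  exact cauchyForm_le_of_symbol radSymbol_pos radSymbol_succ tendsto_radSymbol s _

end ExplicitSolution

/-- Smooth functions with compact support in the open interval `(a, b)`. -/
structure IsTest (a b : ℝ) (χ : ℝ → ℝ) : Prop where
  smooth : ContDiff ℝ ∞ χ
  compact : HasCompactSupport χ
  supp : tsupport χ ⊆ Ioo a b

namespace IsTest

variable {a b a' b' : ℝ} {χ η : ℝ → ℝ}

theorem mono (h : IsTest a b χ) (ha : a' ≤ a) (hb : b ≤ b') : IsTest a' b' χ :=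
  ⟨h.smooth, h.compact, h.supp.trans (Ioo_subset_Ioo ha hb)⟩

theorem eq_zero (h : IsTest a b χ) {r : ℝ} (hr : r ∉ Ioo a b) : χ r = 0 :=
  image_eq_zero_of_notMem_tsupport fun h' => hr (h.supp h')

/-- The support stays away from the end points. -/
theorem exists_shrink (h : IsTest a b χ) : ∃ δ > 0, IsTest (a + δ) (b - δ) χ := by
  obtain ⟨δ, hδ, hsub⟩ := h.compact.isCompact.exists_cthickening_subset_open isOpen_Ioo h.supp
  refine ⟨δ, hδ, h.smooth, h.compact, fun r hr => ?_⟩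
  have hball : Metric.closedBall r δ ⊆ Ioo a b :=
    (Metric.closedBall_subset_cthickening hr δ).trans hsub
  have h1 : r - δ ∈ Ioo a b := hball (by simp [abs_of_pos hδ])
  have h2 : r + δ ∈ Ioo a b := hball (by simp [abs_of_pos hδ])
  exact ⟨by linarith [h1.1], by linarith [h2.2]⟩

theorem of_eq_zero (hs : ContDiff ℝ ∞ χ) {c d : ℝ} (hc : a < c) (hd : d < b)
    (h : ∀ r, r ∉ Icc c d → χ r = 0) : IsTest a b χ := by
  have hsub : tsupport χ ⊆ Icc c d :=
    closure_minimal (fun r hr => by_contra fun h' => hr (h r h')) isClosed_Icc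
  exact ⟨hs, isCompact_Icc.of_isClosed_subset (isClosed_tsupport χ) hsub,
    hsub.trans (Icc_subset_Ioo hc hd)⟩

theorem exists_Icc (h : IsTest a b χ) :
    ∃ c d, a < c ∧ d < b ∧ ∀ r, r ∉ Icc c d → χ r = 0 := by
  obtain ⟨δ, hδ, h'⟩ := h.exists_shrink
  exact ⟨a + δ, b - δ, by linarith, by linarith, fun r hr => h'.eq_zero fun h2 =>
    hr (Ioo_subset_Icc_self h2)⟩

theorem add_mul (h : IsTest a b χ) (h' : IsTest a b η) (c : ℝ) :
    IsTest a b (fun r => χ r + c * η r) := by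
  obtain ⟨δ, hδ, h1⟩ := h.exists_shrink
  obtain ⟨δ', hδ', h2⟩ := h'.exists_shrink
  have hm : 0 < min δ δ' := lt_min hδ hδ'
  have h3 := h1.mono (a' := a + min δ δ') (b' := b - min δ δ')
    (by linarith [min_le_left δ δ']) (by linarith [min_le_left δ δ'])
  have h4 := h2.mono (a' := a + min δ δ') (b' := b - min δ δ')
    (by linarith [min_le_right δ δ']) (by linarith [min_le_right δ δ'])
  refine of_eq_zero (h.smooth.add (contDiff_const.mul h'.smooth))
    (c := a + min δ δ') (d := b - min δ δ') (by linarith) (by linarith) fun r hr => ?_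
  have hr' : r ∉ Ioo (a + min δ δ') (b - min δ δ') := fun h => hr (Ioo_subset_Icc_self h)
  rw [h3.eq_zero hr', h4.eq_zero hr', mul_zero, add_zero]

theorem const_mul (h : IsTest a b η) (c : ℝ) : IsTest a b (fun r => c * η r) := by
  obtain ⟨x, y, hx, hy, h0⟩ := h.exists_Icc
  exact of_eq_zero (contDiff_const.mul h.smooth) hx hy fun r hr => by rw [h0 r hr, mul_zero]

theorem derivative (h : IsTest a b χ) : IsTest a b (deriv χ) :=
  ⟨(contDiff_infty_iff_deriv.1 h.smooth).2, h.compact.deriv, tsupport_deriv_subset.trans h.supp⟩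

theorem mul_left (h : IsTest a b χ) {g : ℝ → ℝ} (hg : ∀ r ∈ Ioo a b, ContDiffAt ℝ ∞ g r) :
    IsTest a b (fun r => g r * χ r) := by
  obtain ⟨c, d, hc, hd, h0⟩ := h.exists_Icc
  refine of_eq_zero (contDiff_iff_contDiffAt.2 fun r => ?_) hc hd
    fun r hr => by rw [h0 r hr, mul_zero]
  by_cases hr : r ∈ tsupport χ
  · exact (hg r (h.supp hr)).mul h.smooth.contDiffAt
  · have : (fun r => g r * χ r) =ᶠ[𝓝 r] fun _ => 0 := by
      filter_upwards [(isClosed_tsupport χ).isOpen_compl.mem_nhds hr] with x hx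
      rw [image_eq_zero_of_notMem_tsupport hx, mul_zero]
    exact contDiffAt_const.congr_of_eventuallyEq this

theorem exists_bound (h : IsTest a b χ) : ∃ M, 0 ≤ M ∧ ∀ r, |χ r| ≤ M := by
  obtain ⟨M, hM⟩ := h.smooth.continuous.bounded_above_of_compact_support h.compact
  exact ⟨M, (norm_nonneg _).trans (hM 0), hM⟩

theorem differentiable (h : IsTest a b χ) : Differentiable ℝ χ := h.smooth.differentiable (by simp)

end IsTest

/-- The product rule for a differentiable family of bounded functionals applied to a
differentiable family of test functions. -/
theorem hasDerivWithinAt_functional_apply {R T B C : ℝ} {Z Z' : ℝ → (ℝ → ℝ) → ℝ}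
    {w w' : ℝ → ℝ → ℝ} {t δ M : ℝ} (ht : t ∈ Icc 0 T) (hδ : 0 < δ)
    (hlin : ∀ τ ∈ Icc 0 T, ∀ χ η : ℝ → ℝ, IsTest (R + τ) B χ → IsTest (R + τ) B η → ∀ c : ℝ,
      Z τ (fun r => χ r + c * η r) = Z τ χ + c * Z τ η)
    (hbd : ∀ τ ∈ Icc 0 T, ∀ χ : ℝ → ℝ, IsTest (R + τ) B χ → ∀ N, (∀ r, |χ r| ≤ N) →
      |Z τ χ| ≤ C * N)
    (hd : ∀ χ : ℝ → ℝ, IsTest (R + t) B χ →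
      HasDerivWithinAt (fun τ => Z τ χ) (Z' t χ) (Icc 0 T) t)
    (hw : ∀ τ ∈ Icc 0 T, |τ - t| < δ → IsTest (R + τ) B (w τ) ∧ IsTest (R + τ) B (w t) ∧
      IsTest (R + τ) B (w' t))
    (hww : ∀ τ r, |w τ r - w t r - (τ - t) * w' t r| ≤ M * (τ - t) ^ 2) :
    HasDerivWithinAt (fun τ => Z τ (w τ)) (Z' t (w t) + Z t (w' t)) (Icc 0 T) t := by
  obtain ⟨-, hwt, hwt'⟩ := hw t ht (by simpa using hδ)
  have h1 := hd _ hwt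
  have h2 := hd _ hwt'
  have h3 : HasDerivWithinAt (fun τ => (τ - t) * Z τ (w' t)) (Z t (w' t)) (Icc 0 T) t := by
    convert! ((hasDerivWithinAt_id t (Icc 0 T)).sub_const t).mul h2 using 1
    simp
  have h4 : HasDerivWithinAt (fun τ => Z τ (w τ) - Z τ (w t) - (τ - t) * Z τ (w' t)) 0
      (Icc 0 T) t := by
    rw [hasDerivWithinAt_iff_isLittleO]
    have hO : (fun τ => Z τ (w τ) - Z τ (w t) - (τ - t) * Z τ (w' t)) =O[𝓝[Icc 0 T] t]
        fun τ => (τ - t) ^ 2 := by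
      refine Asymptotics.IsBigO.of_bound (C * M) ?_
      have hmem : ∀ᶠ τ in 𝓝[Icc 0 T] t, |τ - t| < δ := by
        refine eventually_nhdsWithin_of_eventually_nhds ?_
        exact Metric.eventually_nhds_iff.2 ⟨δ, hδ, fun {y} hy => by simpa [Real.dist_eq] using hy⟩
      filter_upwards [hmem, self_mem_nhdsWithin] with τ hτ hτ'
      obtain ⟨ha, hb, hc⟩ := hw τ hτ' hτ
      have e : Z τ (w τ) - Z τ (w t) - (τ - t) * Z τ (w' t) =
          Z τ (fun r => (w τ r + (-1) * w t r) + (-(τ - t)) * w' t r) := by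
        rw [hlin τ hτ' (fun r => w τ r + (-1) * w t r) (w' t) (ha.add_mul hb _) hc,
          hlin τ hτ' _ _ ha hb]
        ring
      rw [e, Real.norm_eq_abs, Real.norm_eq_abs, abs_of_nonneg (sq_nonneg (τ - t)), mul_assoc]
      refine hbd τ hτ' _ ((ha.add_mul hb _).add_mul hc _) _ fun r => ?_
      convert hww τ r using 2
      ring
    have hsq : (fun τ : ℝ => (τ - t) ^ 2) =o[𝓝[Icc 0 T] t] fun τ => τ - t := by
      have h0 : Tendsto (fun τ : ℝ => τ - t) (𝓝[Icc 0 T] t) (𝓝 0) := by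
        have : Tendsto (fun τ : ℝ => τ - t) (𝓝 t) (𝓝 (t - t)) := tendsto_id.sub_const t
        rw [sub_self] at this
        exact this.mono_left nhdsWithin_le_nhds
      have := (Asymptotics.isLittleO_one_iff ℝ).2 h0
      simpa [sq] using this.mul_isBigO (Asymptotics.isBigO_refl (fun τ : ℝ => τ - t) _)
    simpa using hO.trans_isLittleO hsq
  have h5 := (h4.add h1).add h3
  refine (h5.congr_deriv (by ring)).congr_of_mem (fun τ _ => ?_) ht
  simp only [Pi.add_apply]
  ring

/-- Half the difference of two translates of `P`: for a primitive `P` of `χ` this is the mean of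
`χ` over `(r - s, r + s)` times `s`. -/
def dalembert (P : ℝ → ℝ) (s r : ℝ) : ℝ := (P (r + s) - P (r - s)) / 2

/-- Half the sum of two translates. -/
def dalembertSum (χ : ℝ → ℝ) (s r : ℝ) : ℝ := (χ (r + s) + χ (r - s)) / 2

theorem abs_taylor_two_le {g g' g'' : ℝ → ℝ} {M : ℝ} (h1 : ∀ x, HasDerivAt g (g' x) x)
    (h2 : ∀ x, HasDerivAt g' (g'' x) x) (hM : ∀ x, |g'' x| ≤ M) (x h : ℝ) :
    |g (x + h) - g x - h * g' x| ≤ M * h ^ 2 := by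
  have hg' : ∀ y, |g' y - g' x| ≤ M * |y - x| := fun y => by
    simpa using convex_univ.norm_image_sub_le_of_norm_hasDerivWithin_le (f := g') (f' := g'')
      (C := M) (fun z _ => (h2 z).hasDerivWithinAt) (fun z _ => hM z) (mem_univ x) (mem_univ y)
  have hd : ∀ y ∈ uIcc x (x + h), HasDerivWithinAt (fun y => g y - (y - x) * g' x)
      (g' y - g' x) (uIcc x (x + h)) y := fun y _ => by
    convert! ((h1 y).sub (((hasDerivAt_id y).sub_const x).mul_const (g' x))).hasDerivWithinAt
      using 1
    simp
  have hM0 : 0 ≤ M := (abs_nonneg _).trans (hM x)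
  have hb : ∀ y ∈ uIcc x (x + h), ‖g' y - g' x‖ ≤ M * |h| := fun y hy => by
    refine (hg' y).trans (mul_le_mul_of_nonneg_left ?_ hM0)
    have := abs_sub_left_of_mem_uIcc hy
    simpa using this
  have := (convex_uIcc x (x + h)).norm_image_sub_le_of_norm_hasDerivWithin_le hd hb
    left_mem_uIcc right_mem_uIcc
  simp only [Real.norm_eq_abs, add_sub_cancel_left, sub_self, zero_mul, sub_zero] at this
  calc _ = |g (x + h) - h * g' x - g x| := by congr 1; ring
    _ ≤ _ := this
    _ = M * h ^ 2 := by rw [mul_assoc, ← sq, sq_abs]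

theorem exists_primitive {a b : ℝ} {χ : ℝ → ℝ} (h : IsTest a b χ) :
    ∃ P : ℝ → ℝ, ContDiff ℝ ∞ P ∧ (∀ r, HasDerivAt P (χ r) r) ∧
      ∀ x y, P y - P x = ∫ z in x..y, χ z := by
  have hc := h.smooth.continuous
  have hd : ∀ r, HasDerivAt (fun r => ∫ z in (0 : ℝ)..r, χ z) (χ r) r := fun r =>
    hc.deriv_integral χ 0 r ▸ (intervalIntegral.differentiable_integral_of_continuous hc
      r).hasDerivAt
  refine ⟨fun r => ∫ z in (0 : ℝ)..r, χ z, contDiff_infty_iff_deriv.2 ⟨fun r =>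
    (hd r).differentiableAt, ?_⟩, hd, fun x y => ?_⟩
  · rw [show _root_.deriv (fun r => ∫ z in (0 : ℝ)..r, χ z) = χ from funext fun r => (hd r).deriv]
    exact h.smooth
  · exact intervalIntegral.integral_interval_sub_left (hc.intervalIntegrable _ _)
      (hc.intervalIntegrable _ _)

section Dalembert

variable {a b : ℝ} {χ P : ℝ → ℝ}

theorem IsTest.dalembert (h : IsTest a b χ) (hP : ContDiff ℝ ∞ P)
    (hint : ∀ x y, P y - P x = ∫ z in x..y, χ z) {s : ℝ} (hs : 0 ≤ s) :
    IsTest (a - s) (b + s) (dalembert P s) := by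
  obtain ⟨c, d, hc, hd, h0⟩ := h.exists_Icc
  refine IsTest.of_eq_zero ?_ (c := c - s) (d := d + s) (by linarith) (by linarith) fun r hr => ?_
  · exact ((hP.comp (contDiff_id.add contDiff_const)).sub
      (hP.comp (contDiff_id.sub contDiff_const))).div_const _
  · rw [_root_.dalembert, hint, intervalIntegral.integral_zero_ae, zero_div]
    refine Eventually.of_forall fun z hz => h0 z fun hz' => hr ?_
    rw [uIoc_of_le (by linarith)] at hz
    exact ⟨by linarith [hz.2, hz'.1], by linarith [hz.1, hz'.2]⟩

theorem IsTest.dalembertSum (h : IsTest a b χ) {s : ℝ} (hs : 0 ≤ s) :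
    IsTest (a - s) (b + s) (dalembertSum χ s) := by
  obtain ⟨c, d, hc, hd, h0⟩ := h.exists_Icc
  refine IsTest.of_eq_zero ?_ (c := c - s) (d := d + s) (by linarith) (by linarith) fun r hr => ?_
  · exact ((h.smooth.comp (contDiff_id.add contDiff_const)).add
      (h.smooth.comp (contDiff_id.sub contDiff_const))).div_const _
  · rw [_root_.dalembertSum, h0, h0, add_zero, zero_div]
    · exact fun hr' => hr ⟨by linarith [hr'.1], by linarith [hr'.2]⟩
    · exact fun hr' => hr ⟨by linarith [hr'.1], by linarith [hr'.2]⟩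

theorem abs_dalembert_le (hint : ∀ x y, P y - P x = ∫ z in x..y, χ z) {M : ℝ}
    (hM : ∀ r, |χ r| ≤ M) {s : ℝ} (hs : 0 ≤ s) (r : ℝ) : |dalembert P s r| ≤ s * M := by
  rw [dalembert, hint, abs_div, abs_two, div_le_iff₀ two_pos]
  have := intervalIntegral.norm_integral_le_of_norm_le_const (a := r - s) (b := r + s) (f := χ)
    (C := M) fun x _ => hM x
  rw [Real.norm_eq_abs, show r + s - (r - s) = 2 * s by ring,
    abs_of_nonneg (a := 2 * s) (by linarith)] at this
  linarith

theorem deriv_deriv_dalembert (h : IsTest a b χ) (hP : ∀ r, HasDerivAt P (χ r) r) (s : ℝ) :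
    deriv (deriv (dalembert P s)) = dalembert (deriv χ) s := by
  have h1 : deriv (dalembert P s) = dalembert χ s := funext fun r =>
    (((hP (r + s)).comp_add_const r s).sub ((hP (r - s)).comp_sub_const r s)).div_const 2 |>.deriv
  have h2 := fun r => (h.differentiable r).hasDerivAt
  rw [h1]
  exact funext fun r =>
    (((h2 (r + s)).comp_add_const r s).sub ((h2 (r - s)).comp_sub_const r s)).div_const 2 |>.deriv

theorem abs_dalembert_taylor_le {g g' g'' : ℝ → ℝ} {M : ℝ} (h1 : ∀ x, HasDerivAt g (g' x) x)
    (h2 : ∀ x, HasDerivAt g' (g'' x) x) (hM : ∀ x, |g'' x| ≤ M) (s s' r : ℝ) :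
    |dalembert g s' r - dalembert g s r - (s' - s) * dalembertSum g' s r| ≤
      M * (s' - s) ^ 2 := by
  have e1 := abs_taylor_two_le h1 h2 hM (r + s) (s' - s)
  have e2 := abs_taylor_two_le h1 h2 hM (r - s) (-(s' - s))
  rw [show r + s + (s' - s) = r + s' by ring] at e1
  rw [show r - s + -(s' - s) = r - s' by ring, neg_sq] at e2
  have e3 := abs_sub _ _ |>.trans (add_le_add e1 e2)
  simp only [dalembert, dalembertSum]
  rw [abs_le] at *
  constructor <;> linarith [e3.1, e3.2]

theorem abs_dalembertSum_taylor_le {g g' g'' : ℝ → ℝ} {M : ℝ} (h1 : ∀ x, HasDerivAt g (g' x) x)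
    (h2 : ∀ x, HasDerivAt g' (g'' x) x) (hM : ∀ x, |g'' x| ≤ M) (s s' r : ℝ) :
    |dalembertSum g s' r - dalembertSum g s r - (s' - s) * dalembert g' s r| ≤
      M * (s' - s) ^ 2 := by
  have e1 := abs_taylor_two_le h1 h2 hM (r + s) (s' - s)
  have e2 := abs_taylor_two_le h1 h2 hM (r - s) (-(s' - s))
  rw [show r + s + (s' - s) = r + s' by ring] at e1
  rw [show r - s + -(s' - s) = r - s' by ring, neg_sq] at e2
  have e3 := abs_add_le _ _ |>.trans (add_le_add e1 e2)
  simp only [dalembert, dalembertSum]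
  rw [abs_le] at *
  constructor <;> linarith [e3.1, e3.2]

end Dalembert

/-- A weak solution, on the truncated exterior of the light cone, of the equation
`q_tt = q_rr - (15 / 4) r⁻² q` satisfied by `q = r^(5/2) u` for a radial wave `u` in dimension `6`,
with vanishing initial data. It is given by its pairings `Y` and those of its time
derivative `Y'` with test functions. -/
structure IsWeakWave (R T B : ℝ) (Y Y' : ℝ → (ℝ → ℝ) → ℝ) : Prop where
  lin : ∀ τ ∈ Icc 0 T, ∀ χ η : ℝ → ℝ, IsTest (R + τ) B χ → IsTest (R + τ) B η → ∀ c : ℝ,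
    Y τ (fun r => χ r + c * η r) = Y τ χ + c * Y τ η
  lin' : ∀ τ ∈ Icc 0 T, ∀ χ η : ℝ → ℝ, IsTest (R + τ) B χ → IsTest (R + τ) B η → ∀ c : ℝ,
    Y' τ (fun r => χ r + c * η r) = Y' τ χ + c * Y' τ η
  bdd : ∃ C, ∀ τ ∈ Icc 0 T, ∀ χ : ℝ → ℝ, IsTest (R + τ) B χ → ∀ N, (∀ r, |χ r| ≤ N) →
    |Y τ χ| ≤ C * N
  bdd' : ∃ C, ∀ τ ∈ Icc 0 T, ∀ χ : ℝ → ℝ, IsTest (R + τ) B χ → ∀ N, (∀ r, |χ r| ≤ N) →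
    |Y' τ χ| ≤ C * N
  deriv : ∀ t ∈ Icc 0 T, ∀ χ : ℝ → ℝ, IsTest (R + t) B χ →
    HasDerivWithinAt (fun τ => Y τ χ) (Y' t χ) (Icc 0 T) t
  deriv' : ∀ t ∈ Icc 0 T, ∀ χ : ℝ → ℝ, IsTest (R + t) B χ →
    HasDerivWithinAt (fun τ => Y' τ χ)
      (Y t (_root_.deriv (_root_.deriv χ)) - 15 / 4 * Y t (fun r => (r ^ 2)⁻¹ * χ r)) (Icc 0 T) t
  init : ∀ χ : ℝ → ℝ, IsTest R B χ → Y 0 χ = 0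
  init' : ∀ χ : ℝ → ℝ, IsTest R B χ → Y' 0 χ = 0

theorem functional_smul {a b : ℝ} {Z : (ℝ → ℝ) → ℝ}
    (hlin : ∀ χ η : ℝ → ℝ, IsTest a b χ → IsTest a b η → ∀ c : ℝ,
      Z (fun r => χ r + c * η r) = Z χ + c * Z η) {η : ℝ → ℝ} (h : IsTest a b η) (c : ℝ) :
    Z (fun r => c * η r) = c * Z η := by
  have h1 := hlin η η h h (c - 1)
  rw [show (fun r => c * η r) = fun r => η r + (c - 1) * η r by funext r; ring, h1]
  ring

namespace IsWeakWave

variable {R T B : ℝ} {Y Y' : ℝ → (ℝ → ℝ) → ℝ}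

theorem mono (h : IsWeakWave R T B Y Y') {T' : ℝ} (hT : T' ≤ T) : IsWeakWave R T' B Y Y' where
  lin τ hτ := h.lin τ ⟨hτ.1, hτ.2.trans hT⟩
  lin' τ hτ := h.lin' τ ⟨hτ.1, hτ.2.trans hT⟩
  bdd := h.bdd.imp fun _ hC τ hτ => hC τ ⟨hτ.1, hτ.2.trans hT⟩
  bdd' := h.bdd'.imp fun _ hC τ hτ => hC τ ⟨hτ.1, hτ.2.trans hT⟩
  deriv t ht χ hχ := (h.deriv t ⟨ht.1, ht.2.trans hT⟩ χ hχ).mono (Icc_subset_Icc_right hT)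
  deriv' t ht χ hχ := (h.deriv' t ⟨ht.1, ht.2.trans hT⟩ χ hχ).mono (Icc_subset_Icc_right hT)
  init := h.init
  init' := h.init'

/-- The pairing of a weak wave with the backward d'Alembert solution. -/
theorem hasDerivWithinAt_pairing (h : IsWeakWave R T B Y Y') {χ P : ℝ → ℝ}
    (hχ : IsTest (R + T) (B - T) χ) (hP : ContDiff ℝ ∞ P) (hP' : ∀ r, HasDerivAt P (χ r) r)
    (hint : ∀ x y, P y - P x = ∫ z in x..y, χ z) {t : ℝ} (ht : t ∈ Icc 0 T) :
    HasDerivWithinAt (fun τ => Y' τ (dalembert P (T - τ)) + Y τ (dalembertSum χ (T - τ)))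
      (-(15 / 4) * Y t (fun r => (r ^ 2)⁻¹ * dalembert P (T - t) r)) (Icc 0 T) t := by
  obtain ⟨δ, hδ, hχδ⟩ := hχ.exists_shrink
  obtain ⟨C, hC⟩ := h.bdd
  obtain ⟨C', hC'⟩ := h.bdd'
  obtain ⟨M1, -, hM1⟩ := hχ.derivative.exists_bound
  obtain ⟨M2, -, hM2⟩ := hχ.derivative.derivative.exists_bound
  have d1 : ∀ x, HasDerivAt χ (_root_.deriv χ x) x := fun x => (hχ.differentiable x).hasDerivAt
  have d2 : ∀ x, HasDerivAt (_root_.deriv χ) (_root_.deriv (_root_.deriv χ) x) x :=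
    fun x => (hχ.derivative.differentiable x).hasDerivAt
  have key : ∀ τ ∈ Icc 0 T, ∀ σ ∈ Icc 0 T, |τ - σ| < δ →
      IsTest (R + τ) B (dalembert P (T - σ)) ∧ IsTest (R + τ) B (dalembertSum χ (T - σ)) ∧
      IsTest (R + τ) B (dalembert (_root_.deriv χ) (T - σ)) := by
    intro τ hτ σ hσ hd
    have hd' := abs_lt.1 hd
    have h0 : 0 ≤ T - σ := by linarith [hσ.2]
    refine ⟨(hχδ.dalembert hP hint h0).mono (a' := R + τ) (b' := B) (by linarith) (by linarith [hσ.1]),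
      (hχδ.dalembertSum h0).mono (a' := R + τ) (b' := B) (by linarith) (by linarith [hσ.1]), ?_⟩
    refine (hχδ.derivative.derivative.dalembert (P := _root_.deriv χ) hχ.derivative.smooth (fun x y => ?_) h0).mono
      (a' := R + τ) (b' := B) (by linarith)
      (by linarith [hσ.1])
    exact (intervalIntegral.integral_deriv_eq_sub (fun z _ => hχ.derivative.differentiable z)
      (hχ.derivative.derivative.smooth.continuous.intervalIntegrable _ _)).symm
  have neg : ∀ {η : ℝ → ℝ}, IsTest (R + t) B η → IsTest (R + t) B (fun r => (-1) * η r) :=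
    fun hη => hη.const_mul _
  obtain ⟨k1, k2, k3⟩ := key t ht t ht (by simpa using hδ)
  have A1 := hasDerivWithinAt_functional_apply (Z := Y')
    (Z' := fun t χ => Y t (_root_.deriv (_root_.deriv χ)) - 15 / 4 * Y t (fun r => (r ^ 2)⁻¹ * χ r))
    (w := fun τ => dalembert P (T - τ)) (w' := fun τ r => (-1) * dalembertSum χ (T - τ) r)
    (M := M1) ht hδ h.lin' hC' (h.deriv' t ht)
    (fun τ hτ hd => ⟨(key τ hτ τ hτ (by simpa using hδ)).1, (key τ hτ t ht hd).1,
      (key τ hτ t ht hd).2.1.const_mul _⟩)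
    (fun τ r => by
      have := abs_dalembert_taylor_le hP' d1 hM1 (T - t) (T - τ) r
      rw [show T - τ - (T - t) = -(τ - t) by ring, neg_sq] at this
      convert this using 2
      ring)
  have A2 := hasDerivWithinAt_functional_apply (Z := Y) (Z' := Y')
    (w := fun τ => dalembertSum χ (T - τ))
    (w' := fun τ r => (-1) * dalembert (_root_.deriv χ) (T - τ) r)
    (M := M2) ht hδ h.lin hC (h.deriv t ht)
    (fun τ hτ hd => ⟨(key τ hτ τ hτ (by simpa using hδ)).2.1, (key τ hτ t ht hd).2.1,
      (key τ hτ t ht hd).2.2.const_mul _⟩)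
    (fun τ r => by
      have := abs_dalembertSum_taylor_le d1 d2 hM2 (T - t) (T - τ) r
      rw [show T - τ - (T - t) = -(τ - t) by ring, neg_sq] at this
      convert this using 2
      ring)
  refine (A1.add A2).congr_deriv ?_
  rw [functional_smul (h.lin' t ht) k2, functional_smul (h.lin t ht) k3,
    deriv_deriv_dalembert hχ hP']
  ring

theorem abs_le (hR : 0 < R) (h : IsWeakWave R T B Y Y') {C : ℝ}
    (hC : ∀ τ ∈ Icc 0 T, ∀ χ : ℝ → ℝ, IsTest (R + τ) B χ → ∀ N, (∀ r, |χ r| ≤ N) →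
      |Y τ χ| ≤ C * N) (n : ℕ) :
    ∀ t ∈ Icc 0 T, ∀ χ : ℝ → ℝ, IsTest (R + t) (B - t) χ → ∀ N, (∀ r, |χ r| ≤ N) →
      |Y t χ| ≤ C * N * (15 / 4 / R ^ 2) ^ n * (t ^ (2 * n) / (2 * n).factorial) := by
  induction n with
  | zero =>
    intro t ht χ hχ N hN
    simpa using hC t ht χ (hχ.mono le_rfl (by linarith [ht.1])) N hN
  | succ n ih =>
    intro T' hT' χ hχ N hN
    have h' := h.mono hT'.2
    obtain ⟨P, hP, hP', hint⟩ := exists_primitive hχ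
    set f : ℝ → ℝ := fun τ => Y' τ (dalembert P (T' - τ)) + Y τ (dalembertSum χ (T' - τ))
    have hd : ∀ t ∈ Icc 0 T', HasDerivWithinAt f _ (Icc 0 T') t := fun t ht =>
      h'.hasDerivWithinAt_pairing hχ hP hP' hint ht
    have hX : ∀ t ∈ Icc 0 T', IsTest (R + t) (B - t) (dalembert P (T' - t)) := fun t ht =>
      (hχ.dalembert hP hint (sub_nonneg.2 ht.2)).mono (by linarith) (by linarith)
    set K : ℝ := C * N * (15 / 4 / R ^ 2) ^ (n + 1)
    have hf0 : f 0 = 0 := by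
      have k1 := (hX 0 ⟨le_rfl, hT'.1⟩)
      have k2 := (hχ.dalembertSum (s := T' - 0) (by simpa using hT'.1)).mono (a' := R) (b' := B)
        (by linarith) (by linarith)
      rw [add_zero, sub_zero] at k1
      simp only [f]
      rw [h.init' _ k1, h.init _ k2, add_zero]
    have hfT : f T' = Y T' χ := by
      have e1 : dalembert P (T' - T') = fun r => 0 * χ r := by
        funext r
        simp [dalembert]
      have e2 : dalembertSum χ (T' - T') = χ := by
        funext r
        simp [dalembertSum]
      simp only [f]
      rw [e1, e2, functional_smul (h.lin' T' hT') (hχ.mono le_rfl (by linarith [hT'.1]))]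
      ring
    have hbound : ∀ t ∈ Ico 0 T',
        ‖-(15 / 4) * Y t (fun r => (r ^ 2)⁻¹ * dalembert P (T' - t) r)‖ ≤
        K * ((T' - t) * (t ^ (2 * n) / (2 * n).factorial)) := by
      intro t ht
      have ht' : t ∈ Icc 0 T' := Ico_subset_Icc_self ht
      have hs : 0 ≤ T' - t := sub_nonneg.2 ht'.2
      have hX' : IsTest (R + t) (B - t) (fun r => (r ^ 2)⁻¹ * dalembert P (T' - t) r) :=
        (hX t ht').mul_left fun r hr => by
          have : r ^ 2 ≠ 0 := pow_ne_zero _ (by linarith [hr.1, ht.1] : (0 : ℝ) < r).ne'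
          exact (contDiffAt_id.pow 2).inv this
      have hb := ih t ⟨ht.1, ht'.2.trans hT'.2⟩ _ hX' ((R ^ 2)⁻¹ * ((T' - t) * N)) fun r => by
        by_cases hr : R < r
        · rw [abs_mul, abs_inv, abs_of_nonneg (sq_nonneg r)]
          have := abs_dalembert_le hint hN hs r
          have hN0 : 0 ≤ N := (abs_nonneg _).trans (hN 0)
          gcongr
        · have hN0 : 0 ≤ N := (abs_nonneg _).trans (hN 0)
          rw [hX'.eq_zero fun hr' => hr (by linarith [hr'.1, ht.1]), abs_zero]
          positivity
      rw [norm_mul, Real.norm_eq_abs, Real.norm_eq_abs]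
      have : |-(15 / 4 : ℝ)| = 15 / 4 := by norm_num
      rw [this]
      refine (mul_le_mul_of_nonneg_left hb (by norm_num)).trans (le_of_eq ?_)
      simp only [K, pow_succ _ n]
      field_simp
    have hcont : ContinuousOn f (Icc 0 T') := fun t ht => (hd t ht).continuousWithinAt
    have hB : ∀ t, HasDerivAt (fun t : ℝ => K * (T' * (t ^ (2 * n + 1) / (2 * n + 1).factorial) -
        (2 * n + 1) * (t ^ (2 * n + 2) / (2 * n + 2).factorial)))
        (K * ((T' - t) * (t ^ (2 * n) / (2 * n).factorial))) t := by
      intro t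
      have e1 := ((hasDerivAt_pow (2 * n + 1) t).div_const ((2 * n + 1).factorial : ℝ)).const_mul T'
      have e2 := ((hasDerivAt_pow (2 * n + 2) t).div_const
        ((2 * n + 2).factorial : ℝ)).const_mul (2 * (n : ℝ) + 1)
      refine ((e1.sub e2).const_mul K).congr_deriv ?_
      rw [Nat.factorial_succ (2 * n + 1), Nat.factorial_succ (2 * n)]
      have h1 : ((2 * n).factorial : ℝ) ≠ 0 := by exact_mod_cast Nat.factorial_ne_zero _
      simp only [Nat.add_sub_cancel, show 2 * n + 2 - 1 = 2 * n + 1 by omega]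
      push_cast
      have h2 : (2 * (n : ℝ) + 1) ≠ 0 := by positivity
      have h3 : (2 * (n : ℝ) + 1 + 1) ≠ 0 := by positivity
      have h4 : (2 * (n : ℝ) + 2) ≠ 0 := by positivity
      field_simp
      ring
    have := image_norm_le_of_norm_deriv_right_le_deriv_boundary hcont
      (fun t ht => (hd t (Ico_subset_Icc_self ht)).mono_of_mem_nhdsWithin
        (Icc_mem_nhdsGE_of_mem ht)) (by simp [hf0]) hB hbound (x := T') ⟨hT'.1, le_rfl⟩
    rw [hfT, Real.norm_eq_abs] at this
    refine this.trans (le_of_eq ?_)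
    simp only [K]
    congr 1
    rw [show 2 * (n + 1) = 2 * n + 2 by ring, Nat.factorial_succ (2 * n + 1)]
    have h1 : ((2 * n + 1).factorial : ℝ) ≠ 0 := by exact_mod_cast Nat.factorial_ne_zero _
    push_cast
    have h3 : (2 * (n : ℝ) + 1 + 1) ≠ 0 := by positivity
    field_simp
    ring

/-- Finite speed of propagation for weak waves. -/
theorem eq_zero (hR : 0 < R) (hT : 0 ≤ T) (h : IsWeakWave R T B Y Y') {χ : ℝ → ℝ}
    (hχ : IsTest (R + T) (B - T) χ) : Y T χ = 0 := by
  obtain ⟨C, hC⟩ := h.bdd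
  obtain ⟨N, hN0, hN⟩ := hχ.exists_bound
  set x : ℝ := √(15 / 4 / R ^ 2) * T
  have hlim : Tendsto (fun n : ℕ => C * N * (x ^ (2 * n) / (2 * n).factorial)) atTop
      (𝓝 (C * N * 0)) :=
    ((FloorSemiring.tendsto_pow_div_factorial_atTop x).comp
      (tendsto_id.const_mul_atTop' (by norm_num : 0 < 2))).const_mul _
  rw [mul_zero] at hlim
  refine abs_eq_zero.1 (le_antisymm (ge_of_tendsto' hlim fun n => ?_) (abs_nonneg _))
  refine (h.abs_le hR hC n T ⟨hT, le_rfl⟩ χ hχ N hN).trans (le_of_eq ?_)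
  rw [show x ^ (2 * n) = (15 / 4 / R ^ 2) ^ n * T ^ (2 * n) by
    rw [mul_pow, pow_mul, Real.sq_sqrt (by positivity)]]
  ring

end IsWeakWave

open scoped SchwartzMap LineDeriv

/-- The radial function on `ℝ⁶` with profile `φ`. -/
def radLift (φ : ℝ → ℝ) (x : E6) : ℂ := (φ ‖x‖ : ℂ)

/-- The `j`-th component of the radial vector field `φ(|x|) x`. -/
def radLiftVec (φ : ℝ → ℝ) (j : Fin 6) (x : E6) : ℂ := (φ ‖x‖ : ℂ) * (x j : ℂ)

section Smooth

variable {a b : ℝ} {φ : ℝ → ℝ}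

theorem IsTest.radLift_eventuallyEq_zero (h : IsTest a b φ) (ha : 0 ≤ a) :
    radLift φ =ᶠ[𝓝 0] fun _ => 0 := by
  obtain ⟨c, d, hc, -, h0⟩ := h.exists_Icc
  filter_upwards [Metric.ball_mem_nhds (0 : E6) (ha.trans_lt hc)] with x hx
  have : ‖x‖ < c := by simpa using hx
  simp [radLift, h0 ‖x‖ fun h' => absurd h'.1 (not_le.2 this)]

theorem IsTest.contDiff_radLift (h : IsTest a b φ) (ha : 0 ≤ a) : ContDiff ℝ ∞ (radLift φ) := by
  refine contDiff_iff_contDiffAt.2 fun x => ?_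
  by_cases hx : x = 0
  · rw [hx]
    exact contDiffAt_const.congr_of_eventuallyEq (h.radLift_eventuallyEq_zero ha)
  · exact Complex.ofRealCLM.contDiff.contDiffAt.comp x
      (h.smooth.contDiffAt.comp x (contDiffAt_norm ℝ hx))

theorem IsTest.hasCompactSupport_radLift (h : IsTest a b φ) : HasCompactSupport (radLift φ) := by
  refine HasCompactSupport.of_support_subset_isCompact (isCompact_closedBall (0 : E6) b)
    fun x hx => ?_
  by_contra hx'
  refine hx ?_
  have : φ ‖x‖ = 0 := h.eq_zero fun h' => hx' (by simpa using h'.2.le)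
  simp [radLift, this]

theorem contDiff_coord (j : Fin 6) : ContDiff ℝ ∞ (fun x : E6 => (x j : ℂ)) :=
  Complex.ofRealCLM.contDiff.comp (EuclideanSpace.proj (𝕜 := ℝ) j).contDiff

open Classical in
/-- The radial Schwartz function with profile `φ` (zero unless `φ` is smooth and supported
away from `0`). -/
def radSchwartz (φ : ℝ → ℝ) : 𝓢(E6, ℂ) :=
  if h : HasCompactSupport (radLift φ) ∧ ContDiff ℝ ∞ (radLift φ) then h.1.toSchwartzMap h.2 else 0

open Classical in
/-- The components of the radial Schwartz vector field `φ(|x|) x`. -/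
def radSchwartzVec (φ : ℝ → ℝ) (j : Fin 6) : 𝓢(E6, ℂ) :=
  if h : HasCompactSupport (radLiftVec φ j) ∧ ContDiff ℝ ∞ (radLiftVec φ j) then
    h.1.toSchwartzMap h.2 else 0

theorem IsTest.coe_radSchwartz (h : IsTest a b φ) (ha : 0 ≤ a) :
    ⇑(radSchwartz φ) = radLift φ := by
  rw [radSchwartz, dif_pos ⟨h.hasCompactSupport_radLift, h.contDiff_radLift ha⟩]
  rfl

theorem IsTest.coe_radSchwartzVec (h : IsTest a b φ) (ha : 0 ≤ a) (j : Fin 6) :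
    ⇑(radSchwartzVec φ j) = radLiftVec φ j := by
  rw [radSchwartzVec, dif_pos ⟨h.hasCompactSupport_radLift.mul_right (f' := fun x : E6 => (x j : ℂ)),
    (h.contDiff_radLift ha).mul (contDiff_coord j)⟩]
  rfl

/-- The standard basis vectors of `ℝ⁶`. -/
def stdVec (j : Fin 6) : E6 := EuclideanSpace.single j 1

theorem inner_stdVec (x : E6) (j : Fin 6) : inner ℝ x (stdVec j) = x j := by
  simp [stdVec, EuclideanSpace.inner_single_right]

theorem IsTest.hasDerivAt_radLift_line (h : IsTest a b φ) (ha : 0 ≤ a) (x : E6) (j : Fin 6) :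
    HasDerivAt (fun s : ℝ => radLift φ (x + s • stdVec j))
      (radLiftVec (fun r => r⁻¹ * deriv φ r) j x) 0 := by
  by_cases hx : x = 0
  · have h1 : (fun s : ℝ => radLift φ (x + s • stdVec j)) =ᶠ[𝓝 0] fun _ => 0 := by
      have hc : Tendsto (fun s : ℝ => x + s • stdVec j) (𝓝 0) (𝓝 0) := by
        have : Continuous (fun s : ℝ => x + s • stdVec j) := by fun_prop
        simpa [hx] using this.tendsto 0
      exact hc.eventually (h.radLift_eventuallyEq_zero ha)
    refine ((hasDerivAt_const (0 : ℝ) (0 : ℂ)).congr_of_eventuallyEq h1).congr_deriv ?_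
    simp [radLiftVec, hx]
  · have hn : ‖x‖ ≠ 0 := norm_ne_zero_iff.2 hx
    have h1 : HasDerivAt (fun s : ℝ => x + s • stdVec j) (stdVec j) 0 := by
      simpa using ((hasDerivAt_id (0 : ℝ)).smul_const (stdVec j)).const_add x
    have h2 : HasDerivAt (fun s : ℝ => ‖x + s • stdVec j‖) (x j / ‖x‖) 0 := by
      have h3 := (h1.norm_sq).sqrt (by simpa using hx)
      simp only [Real.sqrt_sq (norm_nonneg _), zero_smul, add_zero, inner_stdVec] at h3
      convert h3 using 1
      field_simp
    have h4 : HasDerivAt φ (deriv φ ‖x‖) (‖x + (0 : ℝ) • stdVec j‖) := by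
      simpa using (h.differentiable ‖x‖).hasDerivAt
    have h5 := (h4.comp 0 h2).ofReal_comp
    refine h5.congr_deriv ?_
    simp only [radLiftVec]
    push_cast
    ring

end Smooth

section Fourier

variable {a b : ℝ} {φ : ℝ → ℝ}

theorem IsTest.lineDeriv_radSchwartz (h : IsTest a b φ) (ha : 0 ≤ a) (j : Fin 6) :
    ∂_{stdVec j} (radSchwartz φ) = radSchwartzVec (fun r => r⁻¹ * deriv φ r) j := by
  have h' : IsTest a b (fun r => r⁻¹ * deriv φ r) := h.derivative.mul_left fun r hr =>
    contDiffAt_id.inv (ha.trans_lt hr.1).ne'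
  ext x
  rw [SchwartzMap.lineDerivOp_apply, h'.coe_radSchwartzVec ha, h.coe_radSchwartz ha]
  exact (h.hasDerivAt_radLift_line ha x j).deriv

theorem IsTest.sum_lineDeriv_radSchwartzVec (h : IsTest a b φ) (ha : 0 ≤ a) :
    ∑ j, ∂_{stdVec j} (radSchwartzVec φ j) = radSchwartz (fun r => r * deriv φ r + 6 * φ r) := by
  have h' : IsTest a b (fun r => r * deriv φ r + 6 * φ r) :=
    (h.derivative.mul_left fun r _ => contDiffAt_id).add_mul h 6
  ext x
  rw [sum_apply, h'.coe_radSchwartz ha]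
  have h1 : ∀ j, (∂_{stdVec j} (radSchwartzVec φ j)) x =
      radLiftVec (fun r => r⁻¹ * deriv φ r) j x * (x j : ℂ) + radLift φ x := by
    intro j
    rw [SchwartzMap.lineDerivOp_apply, h.coe_radSchwartzVec ha]
    have h2 : HasDerivAt (fun s : ℝ => ((x + s • stdVec j) j : ℂ)) 1 0 := by
      have : HasDerivAt (fun s : ℝ => (x + s • stdVec j) j) 1 0 := by
        simpa [stdVec] using (hasDerivAt_id (0 : ℝ)).const_add (x j)
      simpa using this.ofReal_comp
    have h3 := (h.hasDerivAt_radLift_line ha x j).mul h2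
    refine (show HasDerivAt (fun s : ℝ => radLiftVec φ j (x + s • stdVec j)) _ 0 from
      h3).deriv.trans ?_
    simp
  simp only [h1, Finset.sum_add_distrib]
  simp only [radLiftVec, radLift, Finset.sum_const, Finset.card_univ, Fintype.card_fin]
  have h4 : ∑ j, (((‖x‖⁻¹ * deriv φ ‖x‖ : ℝ) : ℂ) * (x j : ℂ)) * (x j : ℂ) =
      ((‖x‖ * deriv φ ‖x‖ : ℝ) : ℂ) := by
    have h5 : ∑ j, x j * x j = ‖x‖ ^ 2 := by
      rw [EuclideanSpace.norm_sq_eq]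
      simp [sq]
    simp only [mul_assoc, ← Finset.mul_sum]
    have h6 : ∑ j, (x j : ℂ) * (x j : ℂ) = ((‖x‖ ^ 2 : ℝ) : ℂ) := by
      rw [← h5]
      push_cast
      rfl
    rw [h6, ← Complex.ofReal_mul]
    congr 1
    by_cases hx : ‖x‖ = 0
    · simp [hx]
    · field_simp
  rw [h4]
  push_cast
  simp

theorem fourier_lineDeriv_apply (f : 𝓢(E6, ℂ)) (j : Fin 6) (ξ : E6) :
    𝓕 (∂_{stdVec j} f) ξ = 2 * Real.pi * Complex.I * (ξ j : ℂ) * 𝓕 f ξ := by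
  have : (fun x : E6 => inner ℝ x (stdVec j)).HasTemperateGrowth :=
    ((innerSL ℝ).flip (stdVec j)).hasTemperateGrowth
  rw [SchwartzMap.fourier_lineDerivOp_eq, smul_apply,
    SchwartzMap.smulLeftCLM_apply_apply this, inner_stdVec]
  simp only [smul_eq_mul, Complex.real_smul]
  ring

theorem IsTest.fourier_div (h : IsTest a b φ) (ha : 0 ≤ a) (ξ : E6) :
    𝓕 (radSchwartz (fun r => r * deriv φ r + 6 * φ r)) ξ =
      ∑ j, 2 * Real.pi * Complex.I * (ξ j : ℂ) * 𝓕 (radSchwartzVec φ j) ξ := by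
  rw [← h.sum_lineDeriv_radSchwartzVec ha,
    ← SchwartzMap.fourierTransformCLM_apply (𝕜 := ℂ), map_sum, sum_apply]
  exact Finset.sum_congr rfl fun j _ => by
    rw [SchwartzMap.fourierTransformCLM_apply, fourier_lineDeriv_apply]

/-- The Fourier transform of the Laplacian of a radial function. -/
theorem IsTest.fourier_laplacian (h : IsTest a b φ) (ha : 0 ≤ a) (ξ : E6) :
    𝓕 (radSchwartz (fun r => deriv (deriv φ) r + 5 * (r⁻¹ * deriv φ r))) ξ =
      -((2 * Real.pi * ‖ξ‖ : ℝ) : ℂ) ^ 2 * 𝓕 (radSchwartz φ) ξ := by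
  have h' : IsTest a b (fun r => r⁻¹ * deriv φ r) := h.derivative.mul_left fun r hr =>
    contDiffAt_id.inv (ha.trans_lt hr.1).ne'
  have e : (fun r => deriv (deriv φ) r + 5 * (r⁻¹ * deriv φ r)) =
      fun r => r * deriv (fun r => r⁻¹ * deriv φ r) r + 6 * (r⁻¹ * deriv φ r) := by
    funext r
    by_cases hr : r ∈ Ioo a b
    · have hr0 : r ≠ 0 := (ha.trans_lt hr.1).ne'
      have := (hasDerivAt_inv hr0).mul (h.derivative.differentiable r).hasDerivAt
      rw [show deriv (fun r => r⁻¹ * deriv φ r) r = _ from this.deriv]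
      field_simp
      ring
    · rw [h'.derivative.eq_zero hr, h.derivative.derivative.eq_zero hr, h.derivative.eq_zero hr]
      ring
  rw [e, h'.fourier_div ha]
  have h1 : ∀ j, 𝓕 (radSchwartzVec (fun r => r⁻¹ * deriv φ r) j) ξ =
      2 * Real.pi * Complex.I * (ξ j : ℂ) * 𝓕 (radSchwartz φ) ξ := fun j => by
    rw [← h.lineDeriv_radSchwartz ha, fourier_lineDeriv_apply]
  simp only [h1]
  have h5 : ∑ j, (ξ j : ℂ) * (ξ j : ℂ) = ((‖ξ‖ ^ 2 : ℝ) : ℂ) := by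
    rw [EuclideanSpace.norm_sq_eq]
    simp [sq]
  have h6 : ∀ j, 2 * Real.pi * Complex.I * (ξ j : ℂ) * (2 * Real.pi * Complex.I * (ξ j : ℂ) *
      𝓕 (radSchwartz φ) ξ) = -(2 * Real.pi) ^ 2 * 𝓕 (radSchwartz φ) ξ *
      ((ξ j : ℂ) * (ξ j : ℂ)) := fun j => by
    linear_combination (4 * Real.pi ^ 2 * (ξ j : ℂ) ^ 2 * 𝓕 (radSchwartz φ) ξ) * Complex.I_sq
  simp only [h6, ← Finset.mul_sum, h5]
  push_cast
  ring

end Fourier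

/-- The area of the unit sphere of `ℝ⁶`. -/
def sphereArea : ℝ := 6 * (volume : Measure E6).real (Metric.ball 0 1)

theorem sphereArea_pos : 0 < sphereArea :=
  mul_pos (by norm_num) (ENNReal.toReal_pos (Metric.measure_ball_pos _ _ one_pos).ne'
    measure_ball_lt_top.ne)

theorem integral_radial {F : Type*} [NormedAddCommGroup F] [NormedSpace ℝ F] (f : ℝ → F) :
    ∫ x : E6, f ‖x‖ = sphereArea • ∫ r in Ioi (0 : ℝ), r ^ 5 • f r := by
  have := integral_fun_norm_addHaar (volume : Measure E6) f
  simp only [finrank_euclideanSpace, Fintype.card_fin] at this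
  rw [this, sphereArea, mul_smul, ← Nat.cast_smul_eq_nsmul ℝ]
  norm_num

theorem integrable_radial_iff {F : Type*} [NormedAddCommGroup F] [NormedSpace ℝ F] {f : ℝ → F} :
    Integrable (fun x : E6 => f ‖x‖) ↔ IntegrableOn (fun r => r ^ 5 • f r) (Ioi (0 : ℝ)) := by
  have := integrable_fun_norm_addHaar (volume : Measure E6) (f := f)
  simpa only [finrank_euclideanSpace, Fintype.card_fin] using this

theorem IsTest.integral_radSchwartz_sq {a b : ℝ} {φ : ℝ → ℝ} (h : IsTest a b φ) (ha : 0 ≤ a) :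
    ∫ x, ‖radSchwartz φ x‖ ^ 2 = sphereArea * ∫ r in Ioi (0 : ℝ), φ r ^ 2 * r ^ 5 := by
  rw [h.coe_radSchwartz ha]
  have := integral_radial (fun r => φ r ^ 2)
  simp only [smul_eq_mul, mul_comm _ (φ _ ^ 2)] at this
  rw [← this]
  simp [radLift]

theorem IsTest.sum_integral_radSchwartzVec_sq {a b : ℝ} {φ : ℝ → ℝ} (h : IsTest a b φ)
    (ha : 0 ≤ a) : ∑ j, ∫ x, ‖radSchwartzVec φ j x‖ ^ 2 =
      sphereArea * ∫ r in Ioi (0 : ℝ), (r * φ r) ^ 2 * r ^ 5 := by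
  have := integral_radial (fun r => (r * φ r) ^ 2)
  simp only [smul_eq_mul, mul_comm _ ((_ * φ _) ^ 2)] at this
  rw [← this, ← integral_finsetSum _ fun j _ => ?_]
  · refine integral_congr_ae (Eventually.of_forall fun x => ?_)
    simp only [h.coe_radSchwartzVec ha, radLiftVec, norm_mul, mul_pow, ← Finset.mul_sum]
    rw [EuclideanSpace.norm_sq_eq]
    simp [mul_comm]
  · exact (memLp_two_iff_integrable_sq_norm
      ((radSchwartzVec φ j).continuous.aestronglyMeasurable)).1 ((radSchwartzVec φ j).memLp 2)

/-- The symbol of `√-Δ`. -/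
def freq (ξ : E6) : ℝ := 2 * Real.pi * ‖ξ‖

theorem freq_nonneg (ξ : E6) : 0 ≤ freq ξ := by unfold freq; positivity

theorem continuous_freq : Continuous freq := by unfold freq; fun_prop

theorem ae_freq_ne_zero : ∀ᵐ ξ : E6, freq ξ ≠ 0 := by
  filter_upwards [compl_mem_ae_iff.2 (measure_singleton (0 : E6))] with ξ hξ
  have : ξ ≠ 0 := hξ
  have h2 := Real.pi_pos
  have h3 := norm_pos_iff.2 this
  unfold freq
  positivity

/-- The pairing of a free wave with a fixed function, in terms of the frequency densities `a`, `b`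
of the pairings of the initial position and velocity. -/
def wavePair (a b : E6 → ℝ) (t : ℝ) : ℝ :=
  ∫ ξ, (Real.cos (t * freq ξ) * a ξ + Real.sin (t * freq ξ) / freq ξ * b ξ)

/-- The pairing of the time derivative of a free wave with a fixed function. -/
def wavePairDeriv (a b : E6 → ℝ) (t : ℝ) : ℝ :=
  ∫ ξ, (Real.cos (t * freq ξ) * b ξ - Real.sin (t * freq ξ) * (freq ξ * a ξ))

theorem abs_sin_div_freq_le (t : ℝ) (ξ : E6) : |Real.sin (t * freq ξ) / freq ξ| ≤ |t| := by
  rcases eq_or_ne (freq ξ) 0 with h | h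
  · simp [h]
  · rw [abs_div, div_le_iff₀ (abs_pos.2 h), ← abs_mul]
    exact Real.abs_sin_le_abs

theorem abs_wavePair_density_le (a b : E6 → ℝ) (t : ℝ) (ξ : E6) :
    ‖Real.cos (t * freq ξ) * a ξ + Real.sin (t * freq ξ) / freq ξ * b ξ‖ ≤
      |a ξ| + |t| * |b ξ| := by
  refine (norm_add_le _ _).trans (add_le_add ?_ ?_)
  · rw [norm_mul]
    exact (mul_le_mul_of_nonneg_right (Real.abs_cos_le_one _) (norm_nonneg _)).trans_eq (one_mul _)
  · rw [norm_mul]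
    exact mul_le_mul_of_nonneg_right (abs_sin_div_freq_le t ξ) (norm_nonneg _)

theorem abs_wavePairDeriv_density_le (a b : E6 → ℝ) (t : ℝ) (ξ : E6) :
    ‖Real.cos (t * freq ξ) * b ξ - Real.sin (t * freq ξ) * (freq ξ * a ξ)‖ ≤
      |b ξ| + |freq ξ * a ξ| := by
  refine (norm_sub_le _ _).trans (add_le_add ?_ ?_)
  · rw [norm_mul]
    exact (mul_le_mul_of_nonneg_right (Real.abs_cos_le_one _) (norm_nonneg _)).trans_eq (one_mul _)
  · rw [norm_mul]
    exact (mul_le_mul_of_nonneg_right (Real.abs_sin_le_one _) (norm_nonneg _)).trans_eq (one_mul _)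

section Pairing

variable {a b : E6 → ℝ}

theorem aestronglyMeasurable_wavePair_density (ha : AEStronglyMeasurable a)
    (hb : AEStronglyMeasurable b) (t : ℝ) : AEStronglyMeasurable
      (fun ξ => Real.cos (t * freq ξ) * a ξ + Real.sin (t * freq ξ) / freq ξ * b ξ) := by
  have hm : Measurable freq := continuous_freq.measurable
  refine AEStronglyMeasurable.add (AEStronglyMeasurable.mul ?_ ha)
    (AEStronglyMeasurable.mul ?_ hb)
  · exact (by fun_prop : Measurable fun ξ => Real.cos (t * freq ξ)).aestronglyMeasurable
  · exact (by fun_prop : Measurable fun ξ => Real.sin (t * freq ξ) / freq ξ).aestronglyMeasurable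

theorem aestronglyMeasurable_wavePairDeriv_density (ha : AEStronglyMeasurable a)
    (hb : AEStronglyMeasurable b) (t : ℝ) : AEStronglyMeasurable
      (fun ξ => Real.cos (t * freq ξ) * b ξ - Real.sin (t * freq ξ) * (freq ξ * a ξ)) := by
  have hm : Measurable freq := continuous_freq.measurable
  refine AEStronglyMeasurable.sub (AEStronglyMeasurable.mul ?_ hb)
    (AEStronglyMeasurable.mul ?_ (hm.aestronglyMeasurable.mul ha))
  · exact (by fun_prop : Measurable fun ξ => Real.cos (t * freq ξ)).aestronglyMeasurable
  · exact (by fun_prop : Measurable fun ξ => Real.sin (t * freq ξ)).aestronglyMeasurable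

theorem integrable_wavePair_density (ha : Integrable a) (hb : Integrable b) (t : ℝ) :
    Integrable fun ξ => Real.cos (t * freq ξ) * a ξ + Real.sin (t * freq ξ) / freq ξ * b ξ :=
  (ha.abs.add (hb.abs.const_mul |t|)).mono' (aestronglyMeasurable_wavePair_density ha.1 hb.1 t)
    (Eventually.of_forall fun ξ => abs_wavePair_density_le a b t ξ)

theorem integrable_wavePairDeriv_density (ha : Integrable a) (ha1 : Integrable fun ξ => freq ξ * a ξ)
    (hb : Integrable b) (t : ℝ) :
    Integrable fun ξ => Real.cos (t * freq ξ) * b ξ - Real.sin (t * freq ξ) * (freq ξ * a ξ) :=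
  (hb.abs.add ha1.abs).mono' (aestronglyMeasurable_wavePairDeriv_density ha.1 hb.1 t)
    (Eventually.of_forall fun ξ => abs_wavePairDeriv_density_le a b t ξ)

theorem abs_wavePair_le (ha : Integrable a) (hb : Integrable b) (t : ℝ) :
    |wavePair a b t| ≤ (∫ ξ, |a ξ|) + |t| * ∫ ξ, |b ξ| := by
  rw [← integral_const_mul, ← integral_add ha.abs (hb.abs.const_mul _)]
  exact (norm_integral_le_integral_norm _).trans (integral_mono
    (integrable_wavePair_density ha hb t).norm (ha.abs.add (hb.abs.const_mul _))
    fun ξ => abs_wavePair_density_le a b t ξ)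

theorem abs_wavePairDeriv_le (ha : Integrable a) (ha1 : Integrable fun ξ => freq ξ * a ξ)
    (hb : Integrable b) (t : ℝ) :
    |wavePairDeriv a b t| ≤ (∫ ξ, |b ξ|) + ∫ ξ, |freq ξ * a ξ| := by
  rw [← integral_add hb.abs ha1.abs]
  exact (norm_integral_le_integral_norm _).trans (integral_mono
    (integrable_wavePairDeriv_density ha ha1 hb t).norm (hb.abs.add ha1.abs)
    fun ξ => abs_wavePairDeriv_density_le a b t ξ)

theorem hasDerivAt_wavePair (ha : Integrable a) (ha1 : Integrable fun ξ => freq ξ * a ξ)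
    (hb : Integrable b) (t : ℝ) :
    HasDerivAt (wavePair a b) (wavePairDeriv a b t) t := by
  refine (hasDerivAt_integral_of_dominated_loc_of_deriv_le (s := univ) (μ := volume)
    (F := fun t ξ => Real.cos (t * freq ξ) * a ξ + Real.sin (t * freq ξ) / freq ξ * b ξ)
    (F' := fun t ξ => Real.cos (t * freq ξ) * b ξ - Real.sin (t * freq ξ) * (freq ξ * a ξ))
    (bound := fun ξ => |b ξ| + |freq ξ * a ξ|) univ_mem ?_ ?_ ?_ ?_ (hb.abs.add ha1.abs) ?_).2
  · exact Eventually.of_forall fun s => aestronglyMeasurable_wavePair_density ha.1 hb.1 s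
  · exact integrable_wavePair_density ha hb t
  · exact aestronglyMeasurable_wavePairDeriv_density ha.1 hb.1 t
  · exact Eventually.of_forall fun ξ s _ => abs_wavePairDeriv_density_le a b s ξ
  · filter_upwards [ae_freq_ne_zero] with ξ hξ s _
    have h0 : HasDerivAt (fun s => s * freq ξ) (freq ξ) s := by
      simpa using (hasDerivAt_id s).mul_const (freq ξ)
    refine ((h0.cos.mul_const (a ξ)).add ((h0.sin.div_const (freq ξ)).mul_const (b ξ))).congr_deriv
      ?_
    field_simp
    ring

theorem hasDerivAt_wavePairDeriv (ha : Integrable a) (hb : Integrable b)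
    (ha1 : Integrable fun ξ => freq ξ * a ξ) (hb1 : Integrable fun ξ => freq ξ * b ξ)
    (ha2 : Integrable fun ξ => freq ξ ^ 2 * a ξ) (t : ℝ) :
    HasDerivAt (wavePairDeriv a b)
      (wavePair (fun ξ => -(freq ξ ^ 2 * a ξ)) (fun ξ => -(freq ξ ^ 2 * b ξ)) t) t := by
  have hm : Measurable freq := continuous_freq.measurable
  refine (hasDerivAt_integral_of_dominated_loc_of_deriv_le (s := univ) (μ := volume)
    (F := fun t ξ => Real.cos (t * freq ξ) * b ξ - Real.sin (t * freq ξ) * (freq ξ * a ξ))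
    (F' := fun t ξ => Real.cos (t * freq ξ) * -(freq ξ ^ 2 * a ξ) +
      Real.sin (t * freq ξ) / freq ξ * -(freq ξ ^ 2 * b ξ))
    (bound := fun ξ => |freq ξ ^ 2 * a ξ| + |freq ξ * b ξ|) univ_mem ?_ ?_ ?_ ?_
    (ha2.abs.add hb1.abs) ?_).2
  · exact Eventually.of_forall fun s => aestronglyMeasurable_wavePairDeriv_density ha.1 hb.1 s
  · exact integrable_wavePairDeriv_density ha ha1 hb t
  · refine aestronglyMeasurable_wavePair_density (a := fun ξ => -(freq ξ ^ 2 * a ξ))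
      (b := fun ξ => -(freq ξ ^ 2 * b ξ)) ha2.1.neg ?_ t
    exact ((hm.pow_const 2).aestronglyMeasurable.mul hb.1).neg
  · refine Eventually.of_forall fun ξ s _ => (norm_add_le _ _).trans (add_le_add ?_ ?_)
    · rw [norm_mul, norm_neg]
      exact (mul_le_mul_of_nonneg_right (Real.abs_cos_le_one _) (norm_nonneg _)).trans_eq
        (one_mul _)
    · rcases eq_or_ne (freq ξ) 0 with h | h
      · simp [h]
      · rw [show Real.sin (s * freq ξ) / freq ξ * -(freq ξ ^ 2 * b ξ) =
          -(Real.sin (s * freq ξ) * (freq ξ * b ξ)) by field_simp, norm_neg, norm_mul]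
        exact (mul_le_mul_of_nonneg_right (Real.abs_sin_le_one _) (norm_nonneg _)).trans_eq
          (one_mul _)
  · filter_upwards [ae_freq_ne_zero] with ξ hξ s _
    have h0 : HasDerivAt (fun s => s * freq ξ) (freq ξ) s := by
      simpa using (hasDerivAt_id s).mul_const (freq ξ)
    refine ((h0.cos.mul_const (b ξ)).sub (h0.sin.mul_const (freq ξ * a ξ))).congr_deriv ?_
    field_simp
    ring

theorem wavePair_zero : wavePair a b 0 = ∫ ξ, a ξ := by simp [wavePair]

theorem wavePairDeriv_zero : wavePairDeriv a b 0 = ∫ ξ, b ξ := by simp [wavePairDeriv]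

theorem wavePair_add_mul {a' b' : E6 → ℝ} (ha : Integrable a) (hb : Integrable b)
    (ha' : Integrable a') (hb' : Integrable b') (c t : ℝ) :
    wavePair (fun ξ => a ξ + c * a' ξ) (fun ξ => b ξ + c * b' ξ) t =
      wavePair a b t + c * wavePair a' b' t := by
  rw [wavePair, wavePair, wavePair, ← integral_const_mul, ← integral_add
    (integrable_wavePair_density ha hb t) ((integrable_wavePair_density ha' hb' t).const_mul c)]
  congr 1
  funext ξ
  ring

theorem wavePairDeriv_add_mul {a' b' : E6 → ℝ} (ha : Integrable a)
    (ha1 : Integrable fun ξ => freq ξ * a ξ) (hb : Integrable b)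
    (ha' : Integrable a') (ha1' : Integrable fun ξ => freq ξ * a' ξ) (hb' : Integrable b')
    (c t : ℝ) :
    wavePairDeriv (fun ξ => a ξ + c * a' ξ) (fun ξ => b ξ + c * b' ξ) t =
      wavePairDeriv a b t + c * wavePairDeriv a' b' t := by
  rw [wavePairDeriv, wavePairDeriv, wavePairDeriv, ← integral_const_mul, ← integral_add
    (integrable_wavePairDeriv_density ha ha1 hb t)
    ((integrable_wavePairDeriv_density ha' ha1' hb' t).const_mul c)]
  congr 1
  funext ξ
  ring

end Pairing

theorem integral_mul_le_sqrt {α : Type*} [MeasurableSpace α] {μ : Measure α} {p q : α → ℝ}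
    (hp0 : ∀ x, 0 ≤ p x) (hq0 : ∀ x, 0 ≤ q x) (hp : MemLp p 2 μ) (hq : MemLp q 2 μ) :
    ∫ x, p x * q x ∂μ ≤ √(∫ x, p x ^ 2 ∂μ) * √(∫ x, q x ^ 2 ∂μ) := by
  have := integral_mul_le_Lp_mul_Lq_of_nonneg (μ := μ) Real.HolderConjugate.two_two
    (Eventually.of_forall hp0) (Eventually.of_forall hq0) (by simpa using hp) (by simpa using hq)
  simpa [Real.sqrt_eq_rpow] using this

theorem sqrt_integral_norm_sq (A : L2E6) : √(∫ ξ, ‖A ξ‖ ^ 2) = ‖A‖ := by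
  have h := (Lp.memLp A).eLpNorm_eq_integral_rpow_norm (by norm_num) (by norm_num)
  have h0 : 0 ≤ ∫ ξ, ‖A ξ‖ ^ 2 := integral_nonneg fun _ => by positivity
  simp only [ENNReal.toReal_ofNat, Real.rpow_ofNat] at h
  rw [Lp.norm_def, h, ENNReal.toReal_ofReal (by positivity), Real.sqrt_eq_rpow, one_div]

theorem integral_norm_fourier_sq (f : 𝓢(E6, ℂ)) : ∫ ξ, ‖𝓕 f ξ‖ ^ 2 = ∫ x, ‖f x‖ ^ 2 := by
  have h : ∀ g : 𝓢(E6, ℂ), ∫ x, ‖g x‖ ^ 2 = ‖g.toLp 2 (volume : Measure E6)‖ ^ 2 := fun g => by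
    rw [← sqrt_integral_norm_sq, Real.sq_sqrt (integral_nonneg fun _ => by positivity)]
    refine integral_congr_ae ?_
    filter_upwards [g.coeFn_toLp 2 (volume : Measure E6)] with x hx
    rw [hx]
  rw [h, h, ← SchwartzMap.toLp_fourier_eq, MeasureTheory.Lp.norm_fourier_eq]

theorem memLp_freq_pow_mul (f : 𝓢(E6, ℂ)) (k : ℕ) :
    MemLp (fun ξ => freq ξ ^ k * ‖f ξ‖) 2 (volume : Measure E6) := by
  have hm : Measurable freq := continuous_freq.measurable
  have hmeas : AEStronglyMeasurable (fun ξ => freq ξ ^ k * ‖f ξ‖) (volume : Measure E6) :=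
    ((continuous_freq.pow k).mul f.continuous.norm).aestronglyMeasurable
  rw [memLp_two_iff_integrable_sq hmeas]
  obtain ⟨C, -, hC⟩ := f.decay 0 0
  have hC' : ∀ ξ, ‖f ξ‖ ≤ C := fun ξ => by simpa using hC ξ
  refine ((f.integrable_pow_mul volume (2 * k)).const_mul ((2 * Real.pi) ^ (2 * k) * C)).mono'
    (hmeas.pow 2) (Eventually.of_forall fun ξ => ?_)
  rw [Real.norm_eq_abs, abs_of_nonneg (by positivity)]
  calc (freq ξ ^ k * ‖f ξ‖) ^ 2 = (2 * Real.pi) ^ (2 * k) * ‖ξ‖ ^ (2 * k) * (‖f ξ‖ * ‖f ξ‖) := by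
        rw [freq]
        ring
    _ ≤ (2 * Real.pi) ^ (2 * k) * ‖ξ‖ ^ (2 * k) * (C * ‖f ξ‖) := by
        gcongr
        exact hC' ξ
    _ = _ := by ring

/-- The frequency density of the real part of the pairing of `A` with the radial function of
profile `φ`. -/
def radPair (A : E6 → ℂ) (φ : ℝ → ℝ) (ξ : E6) : ℝ :=
  (starRingEnd ℂ (𝓕 (radSchwartz φ) ξ) * A ξ).re

theorem abs_radPair_le (A : E6 → ℂ) (φ : ℝ → ℝ) (ξ : E6) :
    |radPair A φ ξ| ≤ ‖𝓕 (radSchwartz φ) ξ‖ * ‖A ξ‖ := by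
  refine (Complex.abs_re_le_norm _).trans ?_
  rw [norm_mul, RCLike.norm_conj]

theorem aestronglyMeasurable_radPair {A : E6 → ℂ} (hA : AEStronglyMeasurable A) (φ : ℝ → ℝ) :
    AEStronglyMeasurable (radPair A φ) :=
  Complex.continuous_re.comp_aestronglyMeasurable
    ((Complex.continuous_conj.comp (𝓕 (radSchwartz φ)).continuous).aestronglyMeasurable.mul hA)

theorem integrable_freq_pow_mul_radPair {A : E6 → ℂ} (hA : MemLp A 2) (φ : ℝ → ℝ) (k : ℕ) :
    Integrable fun ξ => freq ξ ^ k * radPair A φ ξ := by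
  refine ((memLp_freq_pow_mul (𝓕 (radSchwartz φ)) k).integrable_mul hA.norm).mono'
    ((continuous_freq.pow k).aestronglyMeasurable.mul (aestronglyMeasurable_radPair hA.1 φ))
    (Eventually.of_forall fun ξ => ?_)
  rw [norm_mul, Real.norm_eq_abs, abs_of_nonneg (pow_nonneg (freq_nonneg ξ) k), Pi.mul_apply,
    mul_assoc]
  exact mul_le_mul_of_nonneg_left (abs_radPair_le A φ ξ) (pow_nonneg (freq_nonneg ξ) k)

theorem integrable_radPair {A : E6 → ℂ} (hA : MemLp A 2) (φ : ℝ → ℝ) :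
    Integrable (radPair A φ) := by
  simpa using integrable_freq_pow_mul_radPair hA φ 0

theorem integrable_freq_mul_radPair {A : E6 → ℂ} (hA : MemLp A 2) (φ : ℝ → ℝ) :
    Integrable fun ξ => freq ξ * radPair A φ ξ := by
  simpa using integrable_freq_pow_mul_radPair hA φ 1

theorem freq_mul_radPair (A : E6 → ℂ) (φ : ℝ → ℝ) (ξ : E6) :
    freq ξ * radPair A φ ξ = radPair (fun ξ => (freq ξ : ℂ) * A ξ) φ ξ := by
  simp only [radPair]
  rw [mul_left_comm, Complex.re_ofReal_mul]

theorem IsTest.integral_abs_radPair_le {a b : ℝ} {φ : ℝ → ℝ} (h : IsTest a b φ) (ha : 0 ≤ a)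
    {A : E6 → ℂ} (hA : MemLp A 2) :
    ∫ ξ, |radPair A φ ξ| ≤
      √(sphereArea * ∫ r in Ioi (0 : ℝ), φ r ^ 2 * r ^ 5) * √(∫ ξ, ‖A ξ‖ ^ 2) := by
  have hΨ : MemLp (fun ξ => ‖𝓕 (radSchwartz φ) ξ‖) 2 (volume : Measure E6) :=
    ((𝓕 (radSchwartz φ)).memLp 2).norm
  rw [← h.integral_radSchwartz_sq ha, ← integral_norm_fourier_sq]
  refine le_trans (integral_mono (integrable_radPair hA φ).abs (hΨ.integrable_mul hA.norm)
    fun ξ => abs_radPair_le A φ ξ) ?_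
  exact integral_mul_le_sqrt (fun _ => norm_nonneg _) (fun _ => norm_nonneg _) hΨ hA.norm

theorem IsTest.radPair_laplacian {a b : ℝ} {φ : ℝ → ℝ} (h : IsTest a b φ) (ha : 0 ≤ a)
    (A : E6 → ℂ) (ξ : E6) :
    radPair A (fun r => deriv (deriv φ) r + 5 * (r⁻¹ * deriv φ r)) ξ =
      -(freq ξ ^ 2 * radPair A φ ξ) := by
  simp only [radPair]
  rw [h.fourier_laplacian ha, map_mul, map_neg, map_pow, Complex.conj_ofReal, mul_assoc, neg_mul,
    Complex.neg_re, ← Complex.ofReal_pow, Complex.re_ofReal_mul, freq]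

theorem IsTest.radPair_add_mul {a b : ℝ} {φ η : ℝ → ℝ} (h : IsTest a b φ) (h' : IsTest a b η)
    (ha : 0 ≤ a) (A : E6 → ℂ) (c : ℝ) (ξ : E6) :
    radPair A (fun r => φ r + c * η r) ξ = radPair A φ ξ + c * radPair A η ξ := by
  have e : radSchwartz (fun r => φ r + c * η r) = radSchwartz φ + (c : ℂ) • radSchwartz η := by
    ext x
    rw [add_apply, smul_apply, (h.add_mul h' c).coe_radSchwartz ha,
      h.coe_radSchwartz ha, h'.coe_radSchwartz ha]
    simp [radLift]
  simp only [radPair]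
  rw [e, FourierTransform.fourier_add, FourierTransform.fourier_smul, add_apply,
    smul_apply, map_add, smul_eq_mul, map_mul, Complex.conj_ofReal, _root_.add_mul, Complex.add_re,
    mul_assoc, Complex.re_ofReal_mul]

/-- The pairing of a velocity with the divergence of a radial vector field is controlled by the
vector field. -/
theorem IsTest.abs_wavePair_div_le {a b : ℝ} {φ : ℝ → ℝ} (h : IsTest a b φ) (ha : 0 ≤ a)
    {B : E6 → ℂ} (hB : MemLp B 2) (t : ℝ) :
    |wavePair (fun _ => 0) (radPair B (fun r => r * deriv φ r + 6 * φ r)) t| ≤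
      √(sphereArea * ∫ r in Ioi (0 : ℝ), (r * φ r) ^ 2 * r ^ 5) * √(∫ ξ, ‖B ξ‖ ^ 2) := by
  set q : E6 → ℝ := fun ξ => √(∑ j, ‖𝓕 (radSchwartzVec φ j) ξ‖ ^ 2) with hq
  have hq2 : ∀ ξ, q ξ ^ 2 = ∑ j, ‖𝓕 (radSchwartzVec φ j) ξ‖ ^ 2 := fun ξ =>
    Real.sq_sqrt (Finset.sum_nonneg fun _ _ => by positivity)
  have hint : ∀ j, Integrable fun ξ => ‖𝓕 (radSchwartzVec φ j) ξ‖ ^ 2 := fun j =>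
    (memLp_two_iff_integrable_sq_norm
      ((𝓕 (radSchwartzVec φ j)).continuous.aestronglyMeasurable)).1
      ((𝓕 (radSchwartzVec φ j)).memLp 2)
  have hqm : MemLp q 2 := by
    have hc : Continuous q := Real.continuous_sqrt.comp
      (continuous_finsetSum _ fun j _ => (𝓕 (radSchwartzVec φ j)).continuous.norm.pow 2)
    rw [memLp_two_iff_integrable_sq hc.aestronglyMeasurable]
    simp only [hq2]
    exact integrable_finsetSum _ fun j _ => hint j
  have hqint : ∫ ξ, q ξ ^ 2 = sphereArea * ∫ r in Ioi (0 : ℝ), (r * φ r) ^ 2 * r ^ 5 := by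
    simp only [hq2]
    rw [integral_finsetSum _ fun j _ => hint j, ← h.sum_integral_radSchwartzVec_sq ha]
    exact Finset.sum_congr rfl fun j _ => integral_norm_fourier_sq _
  have hb : ∀ ξ, ‖𝓕 (radSchwartz (fun r => r * deriv φ r + 6 * φ r)) ξ‖ ≤ freq ξ * q ξ := by
    intro ξ
    have e : freq ξ * q ξ = 2 * Real.pi * (√(∑ j, ‖ξ j‖ ^ 2) * q ξ) := by
      rw [freq, EuclideanSpace.norm_eq]
      ring
    rw [h.fourier_div ha, e]
    refine (norm_sum_le _ _).trans ?_
    have : ∀ j, ‖2 * Real.pi * Complex.I * (ξ j : ℂ) * 𝓕 (radSchwartzVec φ j) ξ‖ =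
        2 * Real.pi * (‖ξ j‖ * ‖𝓕 (radSchwartzVec φ j) ξ‖) := fun j => by
      simp only [norm_mul, Complex.norm_I, Complex.norm_real, RCLike.norm_ofNat, mul_one,
        Real.norm_eq_abs, abs_of_pos Real.pi_pos]
      ring
    simp only [this, ← Finset.mul_sum]
    exact mul_le_mul_of_nonneg_left (Real.sum_mul_le_sqrt_mul_sqrt _ _ _) (by positivity)
  rw [← hqint]
  refine le_trans ?_ (integral_mul_le_sqrt (fun ξ => Real.sqrt_nonneg _)
    (fun _ => norm_nonneg _) hqm hB.norm)
  rw [wavePair, ← Real.norm_eq_abs]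
  refine norm_integral_le_of_norm_le (hqm.integrable_mul hB.norm)
    (Eventually.of_forall fun ξ => ?_)
  simp only [mul_zero, zero_add]
  rcases eq_or_ne (freq ξ) 0 with h0 | h0
  · simp only [h0, div_zero, zero_mul, norm_zero]
    exact mul_nonneg (Real.sqrt_nonneg _) (norm_nonneg _)
  · have hpos : 0 < freq ξ := (freq_nonneg ξ).lt_of_ne' h0
    rw [norm_mul, norm_div, Real.norm_eq_abs, Real.norm_eq_abs, Real.norm_eq_abs, abs_of_pos hpos]
    calc |Real.sin (t * freq ξ)| / freq ξ * |radPair B (fun r => r * deriv φ r + 6 * φ r) ξ|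
        ≤ 1 / freq ξ * ((freq ξ * q ξ) * ‖B ξ‖) := by
          gcongr
          · exact Real.abs_sin_le_one _
          · exact (abs_radPair_le _ _ _).trans
              (mul_le_mul_of_nonneg_right (hb ξ) (norm_nonneg _))
      _ = q ξ * ‖B ξ‖ := by field_simp

namespace IsTest

variable {a b : ℝ} {χ w w' : ℝ → ℝ}

theorem continuous_mul (h : IsTest a b χ) (hw : ContinuousOn w (Ioi a)) :
    Continuous fun r => w r * χ r := by
  refine continuous_iff_continuousAt.2 fun r => ?_
  by_cases hr : r ∈ tsupport χ
  · exact (hw.continuousAt (Ioi_mem_nhds (h.supp hr).1)).mul h.smooth.continuous.continuousAt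
  · have : (fun r => w r * χ r) =ᶠ[𝓝 r] fun _ => 0 := by
      filter_upwards [(isClosed_tsupport χ).isOpen_compl.mem_nhds hr] with x hx
      rw [image_eq_zero_of_notMem_tsupport hx, mul_zero]
    exact continuousAt_const.congr_of_eventuallyEq this

theorem integrable_mul (h : IsTest a b χ) (hw : ContinuousOn w (Ioi a)) :
    Integrable fun r => w r * χ r :=
  (h.continuous_mul hw).integrable_of_hasCompactSupport h.compact.mul_left

theorem integral_deriv_mul (h : IsTest a b χ) (hd : ∀ r, a < r → HasDerivAt w (w' r) r)
    (hc : ContinuousOn w' (Ioi a)) : ∫ r, w' r * χ r = -∫ r, w r * deriv χ r := by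
  have hw : ContinuousOn w (Ioi a) := fun r hr => (hd r hr).continuousAt.continuousWithinAt
  have h1 := h.integrable_mul hc
  have h2 := h.derivative.integrable_mul hw
  have key : ∫ r, (w' r * χ r + w r * deriv χ r) = 0 := by
    refine integral_eq_zero_of_hasDerivAt_of_integrable (f := fun r => w r * χ r) (fun r => ?_)
      (h1.add h2) (h.integrable_mul hw)
    by_cases hr : r ∈ tsupport χ
    · exact (hd r (h.supp hr).1).mul (h.differentiable r).hasDerivAt
    · have h0 := (isClosed_tsupport χ).isOpen_compl.mem_nhds hr
      have : (fun r => w r * χ r) =ᶠ[𝓝 r] fun _ => 0 := by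
        filter_upwards [h0] with x hx
        rw [image_eq_zero_of_notMem_tsupport hx, mul_zero]
      refine ((hasDerivAt_const r (0 : ℝ)).congr_of_eventuallyEq this).congr_deriv ?_
      rw [image_eq_zero_of_notMem_tsupport hr,
        image_eq_zero_of_notMem_tsupport fun h' => hr (tsupport_deriv_subset h')]
      ring
  rw [integral_add h1 h2] at key
  linarith

theorem setIntegral_Ioi_mul (h : IsTest a b χ) {ρ : ℝ} (hρ : ρ ≤ a) (w : ℝ → ℝ) :
    ∫ r in Ioi ρ, w r * χ r = ∫ r, w r * χ r :=
  setIntegral_eq_integral_of_forall_compl_eq_zero fun r hr => by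
    rw [h.eq_zero fun h' => hr (hρ.trans_lt h'.1), mul_zero]

theorem pow_mul (h : IsTest a b χ) (n : ℕ) : IsTest a b (fun r => r ^ n * χ r) :=
  h.mul_left fun _ _ => contDiffAt_id.pow n

/-- Differentiation under the integral sign in the exterior of the light cone. -/
theorem hasDerivAt_integral {w w' : ℝ → ℝ → ℝ} {t : ℝ} (h : IsTest |t| b χ)
    (hd : ∀ τ r, |τ| < r → HasDerivAt (fun τ => w τ r) (w' τ r) τ)
    (hc : ContinuousOn (fun p : ℝ × ℝ => w p.1 p.2) {p | |p.1| < p.2})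
    (hc' : ContinuousOn (fun p : ℝ × ℝ => w' p.1 p.2) {p | |p.1| < p.2}) :
    HasDerivAt (fun τ => ∫ r, w τ r * χ r) (∫ r, w' t r * χ r) t := by
  obtain ⟨δ, hδ, h'⟩ := h.exists_shrink
  obtain ⟨c, d, hcδ, -, h0⟩ := h'.exists_Icc
  have hlt : ∀ τ ∈ Metric.closedBall t δ, |τ| ≤ |t| + δ := fun τ hτ => by
    have h1 : |τ - t| ≤ δ := hτ
    have h2 := abs_add_le (τ - t) t
    rw [sub_add_cancel] at h2
    linarith
  have hsl : ∀ {F : ℝ → ℝ → ℝ}, ContinuousOn (fun p : ℝ × ℝ => F p.1 p.2) {p | |p.1| < p.2} →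
      ∀ τ ∈ Metric.closedBall t δ, ContinuousOn (F τ) (Ioi (|t| + δ)) := fun hF τ hτ =>
    hF.comp (f := fun r => (τ, r)) (by fun_prop) fun r hr => (hlt τ hτ).trans_lt hr
  have hK : IsCompact (Metric.closedBall t δ ×ˢ Icc c d) :=
    (isCompact_closedBall t δ).prod isCompact_Icc
  obtain ⟨M, hM⟩ := hK.exists_bound_of_continuousOn (hc'.mono fun p hp =>
    ((hlt p.1 hp.1).trans_lt hcδ).trans_le hp.2.1)
  have ht : t ∈ Metric.closedBall t δ := Metric.mem_closedBall_self hδ.le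
  refine (hasDerivAt_integral_of_dominated_loc_of_deriv_le (s := Metric.closedBall t δ)
    (F := fun τ r => w τ r * χ r) (F' := fun τ r => w' τ r * χ r)
    (bound := fun r => M * |χ r|) (Metric.closedBall_mem_nhds t hδ) ?_
    (h'.integrable_mul (hsl hc t ht)) (h'.continuous_mul (hsl hc' t ht)).aestronglyMeasurable ?_
    ?_ ?_).2
  · filter_upwards [Metric.closedBall_mem_nhds t hδ] with τ hτ
    exact (h'.continuous_mul (hsl hc τ hτ)).aestronglyMeasurable
  · refine Eventually.of_forall fun r τ hτ => ?_
    rw [norm_mul, Real.norm_eq_abs (χ r)]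
    by_cases hr : r ∈ Icc c d
    · exact mul_le_mul_of_nonneg_right (hM (τ, r) ⟨hτ, hr⟩) (abs_nonneg _)
    · simp [h0 r hr]
  · exact ((h.smooth.continuous.integrable_of_hasCompactSupport h.compact).abs).const_mul M
  · refine Eventually.of_forall fun r τ hτ => ?_
    by_cases hr : r ∈ Icc c d
    · exact (hd τ r ((hlt τ hτ).trans_lt (hcδ.trans_le hr.1))).mul_const _
    · simpa [h0 r hr] using hasDerivAt_const τ (0 : ℝ)

/-- The radial Laplacian of `ℝ⁶` is symmetric. -/
theorem integral_laplacian_mul (h : IsTest a b χ) (ha : 0 ≤ a) {w w1 w2 : ℝ → ℝ}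
    (h1 : ∀ r, a < r → HasDerivAt w (w1 r) r) (h2 : ∀ r, a < r → HasDerivAt w1 (w2 r) r)
    (hc : ContinuousOn w2 (Ioi a)) :
    ∫ r, (w2 r + 5 / r * w1 r) * (r ^ 5 * χ r) =
      ∫ r, w r * (r ^ 5 * (deriv (deriv χ) r + 5 * (r⁻¹ * deriv χ r))) := by
  have hw1 : ContinuousOn w1 (Ioi a) := fun r hr => (h2 r hr).continuousAt.continuousWithinAt
  have e1 := h.integral_deriv_mul (w := fun r => r ^ 5 * w1 r)
    (w' := fun r => 5 * r ^ 4 * w1 r + r ^ 5 * w2 r) (fun r hr => by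
      simpa using (hasDerivAt_pow 5 r).fun_mul (h2 r hr))
    (by fun_prop)
  have e2 := (h.derivative.pow_mul 5).integral_deriv_mul h1 hw1
  have e3 : ∀ r, deriv (fun r => r ^ 5 * deriv χ r) r =
      5 * r ^ 4 * deriv χ r + r ^ 5 * deriv (deriv χ) r := fun r => by
    simpa using ((hasDerivAt_pow 5 r).fun_mul (h.derivative.differentiable r).hasDerivAt).deriv
  simp only [e3] at e2
  have f1 : ∀ r, (w2 r + 5 / r * w1 r) * (r ^ 5 * χ r) =
      (5 * r ^ 4 * w1 r + r ^ 5 * w2 r) * χ r := fun r => by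
    by_cases hr : r ∈ Ioo a b
    · have hr0 : r ≠ 0 := (ha.trans_lt hr.1).ne'
      field_simp
      ring
    · simp [h.eq_zero hr]
  have f2 : ∀ r, w r * (r ^ 5 * (deriv (deriv χ) r + 5 * (r⁻¹ * deriv χ r))) =
      w r * (5 * r ^ 4 * deriv χ r + r ^ 5 * deriv (deriv χ) r) := fun r => by
    by_cases hr : r ∈ Ioo a b
    · have hr0 : r ≠ 0 := (ha.trans_lt hr.1).ne'
      field_simp
      ring
    · simp [h.derivative.eq_zero hr, h.derivative.derivative.eq_zero hr]
  have f3 : ∀ r, (r ^ 5 * w1 r) * deriv χ r = w1 r * (r ^ 5 * deriv χ r) := fun r => by ring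
  simp only [f1, f2, e1, f3, e2, neg_neg]

theorem memLp_radialMeasure (h : IsTest a b χ) (ρ : ℝ) : MemLp χ 2 (radialMeasure ρ) := by
  have hc : Continuous fun r => χ r ^ 2 * |r| ^ 5 := by
    have := h.smooth.continuous
    fun_prop
  have hs : HasCompactSupport fun r => χ r ^ 2 * |r| ^ 5 :=
    (h.compact.comp_left (g := fun x : ℝ => x ^ 2) (by simp)).mul_right
  rw [memLp_two_iff_integrable_sq h.smooth.continuous.aestronglyMeasurable, radialMeasure,
    integrable_withDensity_iff_integrable_smul' (by fun_prop) (by simp)]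
  refine (hc.integrable_of_hasCompactSupport hs).integrableOn.mono'
    (by have := h.smooth.continuous.measurable; fun_prop) (Eventually.of_forall fun r => ?_)
  rw [smul_eq_mul, norm_mul, Real.norm_of_nonneg ENNReal.toReal_nonneg, norm_pow,
    Real.norm_eq_abs, sq_abs, mul_comm]
  gcongr
  rw [ENNReal.toReal_ofReal', ← abs_pow]
  exact max_le (le_abs_self _) (abs_nonneg _)

/-- The Cauchy–Schwarz inequality for the pairing of a radial function with a test function. -/
theorem abs_integral_mul_le (h : IsTest a b χ) {ρ : ℝ} (hρ : 0 ≤ ρ) (hρa : ρ ≤ a)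
    (hw : MemLp w 2 (radialMeasure ρ)) :
    |∫ r, w r * (r ^ 5 * χ r)| ≤ radialNorm ρ w * √(∫ r in Ioi (0 : ℝ), χ r ^ 2 * r ^ 5) := by
  have hχ := h.memLp_radialMeasure ρ
  have e1 : ∫ r, w r * (r ^ 5 * χ r) = ∫ r, w r * χ r ∂radialMeasure ρ := by
    rw [integral_radialMeasure hρ, ← (h.pow_mul 5).setIntegral_Ioi_mul hρa w]
    congr 1
    funext r
    ring
  have e2 : ∫ r in Ioi (0 : ℝ), χ r ^ 2 * r ^ 5 = ∫ r, |χ r| ^ 2 ∂radialMeasure ρ := by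
    have hf : ∀ r, χ r ^ 2 * r ^ 5 = (r ^ 5 * χ r) * χ r := fun r => by ring
    rw [integral_radialMeasure hρ]
    simp only [sq_abs, hf]
    rw [h.setIntegral_Ioi_mul (hρ.trans hρa), h.setIntegral_Ioi_mul hρa]
  have e3 : radialNorm ρ w = √(∫ r, |w r| ^ 2 ∂radialMeasure ρ) := by
    rw [integral_radialMeasure hρ, ← radialNorm_sq hρ hw, Real.sqrt_sq (radialNorm_nonneg _ _)]
  rw [e1, e2, e3, ← Real.norm_eq_abs]
  refine (norm_integral_le_integral_norm _).trans ?_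
  simp only [norm_mul, Real.norm_eq_abs]
  exact integral_mul_le_sqrt (fun _ => abs_nonneg _) (fun _ => abs_nonneg _) hw.abs hχ.abs

end IsTest

section ExtSol

variable (s : Finset ℕ) (a : ℕ → ℝ)

theorem continuousOn_coneTerm (x : ℕ × ℕ) :
    ContinuousOn (fun p : ℝ × ℝ => coneTerm x p.1 p.2) {p | |p.1| < p.2} := by
  unfold coneTerm powDeriv
  refine ContinuousOn.mul (ContinuousOn.mul continuousOn_const ?_)
    (ContinuousOn.mul continuousOn_const ?_)
  · refine ContinuousOn.rpow_const (by fun_prop) fun p hp => Or.inl ?_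
    have : |p.1| < p.2 := hp
    have := (abs_lt.1 this).2
    linarith
  · refine ContinuousOn.rpow_const (by fun_prop) fun p hp => Or.inl ?_
    have : |p.1| < p.2 := hp
    have := (abs_lt.1 this).1
    linarith

theorem continuousOn_extSol (l : ℕ) :
    ContinuousOn (fun p : ℝ × ℝ => extSol s a l p.1 p.2) {p | |p.1| < p.2} := by
  unfold extSol homSol coneSum
  exact continuousOn_finsetSum _ fun k _ => continuousOn_const.mul
    (continuousOn_finsetSum _ fun x _ => continuousOn_const.mul
      (continuousOn_const.mul (continuousOn_coneTerm x)))

/-- The pairing of a time derivative of the explicit exterior solution with a test function. -/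
def extPair (l : ℕ) (t : ℝ) (φ : ℝ → ℝ) : ℝ := ∫ r, extSol s a l t r * (r ^ 5 * φ r)

variable {b t : ℝ} {φ η : ℝ → ℝ}

theorem continuousOn_extSol_slice (l : ℕ) (t : ℝ) : ContinuousOn (extSol s a l t) (Ioi |t|) :=
  (continuousOn_extSol s a l).comp (f := fun r => (t, r)) (by fun_prop) fun _ hr => hr

theorem hasDerivAt_extPair (h : IsTest |t| b φ) (l : ℕ) :
    HasDerivAt (fun τ => extPair s a l τ φ) (extPair s a (l + 1) t φ) t :=
  (h.pow_mul 5).hasDerivAt_integral (fun _ _ hr => hasDerivAt_extSol_time s a l hr)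
    (continuousOn_extSol s a l) (continuousOn_extSol s a (l + 1))

theorem extPair_add_mul (h : IsTest |t| b φ) (h' : IsTest |t| b η) (l : ℕ) (c : ℝ) :
    extPair s a l t (fun r => φ r + c * η r) = extPair s a l t φ + c * extPair s a l t η := by
  have hc := continuousOn_extSol_slice s a l t
  rw [extPair, extPair, extPair, ← integral_const_mul, ← integral_add
    ((h.pow_mul 5).integrable_mul hc) (((h'.pow_mul 5).integrable_mul hc).const_mul c)]
  congr 1
  funext r
  ring

theorem extPair_two (h : IsTest |t| b φ) : extPair s a 2 t φ =
    extPair s a 0 t (fun r => deriv (deriv φ) r + 5 * (r⁻¹ * deriv φ r)) := by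
  have e : ∀ r ∈ Ioi |t|, extSolRR s a t r = extSol s a 2 t r - 5 / r * extSolR s a t r :=
    fun r hr => by rw [extSol_wave s a hr]; ring
  have hcR : ContinuousOn (extSolR s a t) (Ioi |t|) := fun r hr =>
    (hasDerivAt_extSolR_radial s a hr).continuousAt.continuousWithinAt
  have hc : ContinuousOn (extSolRR s a t) (Ioi |t|) := by
    refine ContinuousOn.congr ?_ e
    refine (continuousOn_extSol_slice s a 2 t).sub (ContinuousOn.mul ?_ hcR)
    exact continuousOn_const.div continuousOn_id fun r hr => ((abs_nonneg t).trans_lt hr).ne'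
  rw [extPair, extPair, ← h.integral_laplacian_mul (abs_nonneg t)
    (fun r hr => hasDerivAt_extSol_radial s a hr) (fun r hr => hasDerivAt_extSolR_radial s a hr) hc]
  congr 1
  funext r
  by_cases hr : r ∈ Ioo |t| b
  · rw [extSol_wave s a hr.1]
  · simp [h.eq_zero hr]

end ExtSol

/-- Parseval's identity for the pairing of a function, radial outside of a ball, with a radial
test function supported there. -/
theorem IsTest.integral_radPair_fourier {ρ b : ℝ} {φ : ℝ → ℝ} (h : IsTest ρ b φ) (hρ : 0 ≤ ρ)
    {F : L2E6} {w : ℝ → ℝ} (hF : ∀ᵐ x : E6, ρ < ‖x‖ → F x = ((w ‖x‖ : ℝ) : ℂ)) :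
    ∫ ξ, radPair (𝓕 F : L2E6) φ ξ = sphereArea * ∫ r, w r * (r ^ 5 * φ r) := by
  set ψ := radSchwartz φ with hψ
  have h1 : ∀ (g : 𝓢(E6, ℂ)) (G : L2E6),
      inner ℂ (g.toLp 2 (volume : Measure E6)) G = ∫ x, starRingEnd ℂ (g x) * G x := by
    intro g G
    rw [L2.inner_def]
    refine integral_congr_ae ?_
    filter_upwards [g.coeFn_toLp 2 (volume : Measure E6)] with x hx
    rw [hx, RCLike.inner_apply, mul_comm]
  have hint : Integrable fun ξ => starRingEnd ℂ (𝓕 ψ ξ) * (𝓕 F : L2E6) ξ := by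
    refine (L2.integrable_inner (𝕜 := ℂ) ((𝓕 ψ).toLp 2 (volume : Measure E6)) (𝓕 F)).congr ?_
    filter_upwards [(𝓕 ψ).coeFn_toLp 2 (volume : Measure E6)] with x hx
    rw [hx, RCLike.inner_apply, mul_comm]
  have h2 : ∫ ξ, radPair (𝓕 F : L2E6) φ ξ =
      (∫ ξ, starRingEnd ℂ (𝓕 ψ ξ) * (𝓕 F : L2E6) ξ).re := integral_re hint
  have h3 : ∫ x, starRingEnd ℂ (ψ x) * F x = ((∫ x : E6, φ ‖x‖ * w ‖x‖ : ℝ) : ℂ) := by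
    refine Eq.trans ?_ integral_ofReal
    refine integral_congr_ae ?_
    filter_upwards [hF] with x hx
    rw [hψ, h.coe_radSchwartz hρ, radLift, Complex.conj_ofReal]
    by_cases hr : ρ < ‖x‖
    · simp [hx hr]
    · simp [h.eq_zero fun h' => hr h'.1]
  rw [h2, ← h1, ← SchwartzMap.toLp_fourier_eq, MeasureTheory.Lp.inner_fourier_eq, h1, h3,
    Complex.ofReal_re, integral_radial (fun r => φ r * w r), smul_eq_mul,
    ← (h.pow_mul 5).setIntegral_Ioi_mul hρ]
  congr 2
  funext r
  rw [smul_eq_mul]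
  ring

theorem IsFreeWave.wavePair_eq {U : ℝ → L2E6} {f g : L2E6} (hU : IsFreeWave U f g) {t b : ℝ}
    {ρ : ℝ} {φ w : ℝ → ℝ} (hρ : 0 ≤ ρ) (h : IsTest ρ b φ)
    (hw : ∀ᵐ x : E6, ρ < ‖x‖ → U t x = ((w ‖x‖ : ℝ) : ℂ)) :
    wavePair (radPair (𝓕 f : L2E6) φ) (radPair (𝓕 g : L2E6) φ) t =
      sphereArea * ∫ r, w r * (r ^ 5 * φ r) := by
  rw [← h.integral_radPair_fourier hρ hw]
  refine integral_congr_ae ?_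
  filter_upwards [hU t] with ξ hξ
  simp only [radPair, hξ, freq]
  have e : ∀ (c : ℝ) (z z' : ℂ), (z * (c * z')).re = c * (z * z').re := fun c z z' => by
    rw [mul_left_comm, Complex.re_ofReal_mul]
  rw [mul_add, Complex.add_re, e, e]

/-- The weight `r^(-5/2)`, which turns the radial wave operator of `ℝ⁶` into a one-dimensional
wave operator with an inverse square potential. -/
def halfWeight (χ : ℝ → ℝ) (r : ℝ) : ℝ := r ^ (-(5 / 2 : ℝ)) * χ r

section HalfWeight

variable {a b : ℝ} {χ η : ℝ → ℝ}

theorem IsTest.mul_halfWeight (h : IsTest a b χ) (ha : 0 ≤ a) : IsTest a b (halfWeight χ) :=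
  h.mul_left fun _ hr => Real.contDiffAt_rpow_const_of_ne (ha.trans_lt hr.1).ne'

theorem halfWeight_add_mul (χ η : ℝ → ℝ) (c : ℝ) :
    halfWeight (fun r => χ r + c * η r) = fun r => halfWeight χ r + c * halfWeight η r := by
  funext r
  simp only [halfWeight]
  ring

theorem halfWeight_sq_mul {r : ℝ} (hr : 0 < r) : halfWeight χ r ^ 2 * r ^ 5 = χ r ^ 2 := by
  have h1 : (r ^ (-(5 / 2 : ℝ))) ^ 2 * r ^ 5 = 1 := by
    rw [← Real.rpow_natCast (r ^ (-(5 / 2 : ℝ))), ← Real.rpow_mul hr.le, ← Real.rpow_natCast r 5,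
      ← Real.rpow_add hr]
    norm_num
  rw [halfWeight, mul_pow, mul_right_comm, h1, one_mul]

theorem IsTest.sqrt_integral_halfWeight_le (h : IsTest a b χ) {N : ℝ}
    (hN : ∀ r, |χ r| ≤ N) :
    √(∫ r in Ioi (0 : ℝ), halfWeight χ r ^ 2 * r ^ 5) ≤ √(max b 0) * N := by
  have hN0 : 0 ≤ N := (abs_nonneg _).trans (hN 0)
  refine Real.sqrt_le_iff.2 ⟨by positivity, ?_⟩
  rw [mul_pow, Real.sq_sqrt (le_max_right _ _)]
  have h1 : ∫ r in Ioi (0 : ℝ), halfWeight χ r ^ 2 * r ^ 5 = ∫ r in Ioo 0 (max b 0), χ r ^ 2 := by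
    rw [setIntegral_congr_fun measurableSet_Ioi fun r hr => halfWeight_sq_mul hr]
    refine setIntegral_eq_of_subset_of_forall_sdiff_eq_zero measurableSet_Ioi
      Ioo_subset_Ioi_self fun r hr => ?_
    rw [h.eq_zero fun h' => hr.2 ⟨hr.1, h'.2.trans_le (le_max_left _ _)⟩, zero_pow two_ne_zero]
  rw [h1]
  have h2 : ∀ r ∈ Ioo 0 (max b 0), ‖χ r ^ 2‖ ≤ N ^ 2 := fun r _ => by
    rw [norm_pow, Real.norm_eq_abs]
    exact pow_le_pow_left₀ (abs_nonneg _) (hN r) 2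
  refine (le_abs_self _).trans ((norm_setIntegral_le_of_norm_le_const (by simp) h2).trans ?_)
  rw [measureReal_def, Real.volume_Ioo, ENNReal.toReal_ofReal (by simp), sub_zero, mul_comm]

/-- Conjugation of the radial Laplacian of `ℝ⁶` by the weight `r^(-5/2)`. -/
theorem IsTest.laplacian_halfWeight (h : IsTest a b χ) (ha : 0 ≤ a) :
    (fun r => deriv (deriv (halfWeight χ)) r + 5 * (r⁻¹ * deriv (halfWeight χ) r)) =
      halfWeight (fun r => deriv (deriv χ) r + -(15 / 4) * ((r ^ 2)⁻¹ * χ r)) := by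
  have hp : ∀ p r : ℝ, 0 < r → HasDerivAt (fun r : ℝ => r ^ p) (p * r ^ (p - 1)) r :=
    fun p r hr => Real.hasDerivAt_rpow_const (Or.inl hr.ne')
  have hd1 : ∀ r, 0 < r → HasDerivAt (halfWeight χ)
      (-(5 / 2) * r ^ (-(5 / 2 : ℝ) - 1) * χ r + r ^ (-(5 / 2 : ℝ)) * deriv χ r) r := fun r hr =>
    (hp _ r hr).fun_mul (h.differentiable r).hasDerivAt
  funext r
  by_cases hr : r ∈ Ioo a b
  · have hr0 : 0 < r := ha.trans_lt hr.1
    have e1 : deriv (halfWeight χ) =ᶠ[𝓝 r] fun r =>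
        -(5 / 2) * r ^ (-(5 / 2 : ℝ) - 1) * χ r + r ^ (-(5 / 2 : ℝ)) * deriv χ r := by
      filter_upwards [Ioi_mem_nhds hr0] with x hx
      exact (hd1 x hx).deriv
    have hd2 := ((((hp (-(5 / 2 : ℝ) - 1) r hr0).const_mul (-(5 / 2))).fun_mul
      (h.differentiable r).hasDerivAt).fun_add ((hp (-(5 / 2)) r hr0).fun_mul
      (h.derivative.differentiable r).hasDerivAt)).congr_of_eventuallyEq e1
    rw [hd2.deriv, (hd1 r hr0).deriv, halfWeight]
    have e2 : r ^ (-(5 / 2 : ℝ) - 1) = r ^ (-(5 / 2 : ℝ)) * r⁻¹ := by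
      rw [Real.rpow_sub hr0, Real.rpow_one, div_eq_mul_inv]
    have e3 : r ^ (-(5 / 2 : ℝ) - 1 - 1) = r ^ (-(5 / 2 : ℝ)) * r⁻¹ * r⁻¹ := by
      rw [Real.rpow_sub hr0, e2, Real.rpow_one, div_eq_mul_inv]
    rw [e2, e3]
    field_simp
    ring
  · have h' := h.mul_halfWeight ha
    rw [h'.derivative.derivative.eq_zero hr, h'.derivative.eq_zero hr, halfWeight,
      h.derivative.derivative.eq_zero hr, h.eq_zero hr]
    ring

end HalfWeight

/-- The free wave with data `(f, g)` minus a fixed multiple of the explicit exterior solution, as a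
functional of the test function `r^(-5/2) χ`. -/
def diffPair (s : Finset ℕ) (a : ℕ → ℝ) (A B : E6 → ℂ) (t : ℝ) (χ : ℝ → ℝ) : ℝ :=
  wavePair (radPair A (halfWeight χ)) (radPair B (halfWeight χ)) t -
    sphereArea * extPair s a 0 t (halfWeight χ)

/-- The time derivative of `diffPair`. -/
def diffPairDeriv (s : Finset ℕ) (a : ℕ → ℝ) (A B : E6 → ℂ) (t : ℝ) (χ : ℝ → ℝ) : ℝ :=
  wavePairDeriv (radPair A (halfWeight χ)) (radPair B (halfWeight χ)) t -
    sphereArea * extPair s a 1 t (halfWeight χ)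

section Uniqueness

variable {R : ℝ} (s : Finset ℕ) (a : ℕ → ℝ)

theorem exists_abs_extPair_halfWeight_le (hR : 0 < R) (B : ℝ) (l : ℕ) :
    ∃ C, 0 ≤ C ∧ ∀ t, 0 ≤ t → ∀ χ : ℝ → ℝ, IsTest (R + t) B χ → ∀ N, (∀ r, |χ r| ≤ N) →
      |extPair s a l t (halfWeight χ)| ≤ C * N := by
  have hrad := hasRadiation_extSol s a hR l
  obtain ⟨K, hK⟩ := hrad.exists_radialNorm_le hR
  have hK0 : 0 ≤ K := (radialNorm_nonneg _ _).trans (hK 0 le_rfl)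
  refine ⟨K * √(max B 0), by positivity, fun t ht χ hχ N hN => ?_⟩
  have hRt : 0 ≤ R + t := by positivity
  refine ((hχ.mul_halfWeight hRt).abs_integral_mul_le (ρ := t + R) (by positivity) (add_comm t R).le
    (hrad.memLp hR ht)).trans ?_
  rw [mul_assoc]
  exact mul_le_mul (hK t ht) (hχ.sqrt_integral_halfWeight_le hN) (Real.sqrt_nonneg _) hK0

theorem isWeakWave_diffPair (hR : 0 < R) {f g : L2E6} (hf : HasFiniteDirichletEnergy f)
    (hf0 : ∀ᵐ x : E6, R < ‖x‖ → f x = 0)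
    (hg0 : ∀ᵐ x : E6, R < ‖x‖ → g x = ((extData s a ‖x‖ : ℝ) : ℂ)) (T B : ℝ) :
    IsWeakWave R T B (diffPair s a (𝓕 f : L2E6) (𝓕 g : L2E6))
      (diffPairDeriv s a (𝓕 f : L2E6) (𝓕 g : L2E6)) := by
  have hA : MemLp (𝓕 f : L2E6) 2 volume := Lp.memLp _
  have hB : MemLp (𝓕 g : L2E6) 2 volume := Lp.memLp _
  have hfA : MemLp (fun ξ : E6 => (freq ξ : ℂ) * (𝓕 f : L2E6) ξ) 2 volume := by
    have := hf.const_mul ((2 * Real.pi : ℝ) : ℂ)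
    refine (memLp_congr_ae (Eventually.of_forall fun ξ => ?_)).1 this
    simp only [freq]
    push_cast
    ring
  set A := ((𝓕 f : L2E6) : E6 → ℂ) with hAdef
  set B' := ((𝓕 g : L2E6) : E6 → ℂ) with hBdef
  have hlt : ∀ {τ b : ℝ} {χ : ℝ → ℝ}, 0 ≤ τ → IsTest (R + τ) b χ → IsTest |τ| b χ :=
    fun hτ h => h.mono (by rw [abs_of_nonneg hτ]; linarith) le_rfl
  have h0R : ∀ {τ : ℝ}, 0 ≤ τ → 0 ≤ R + τ := fun hτ => by positivity
  have hbound : ∀ {τ : ℝ} {χ : ℝ → ℝ} {N : ℝ} {D : E6 → ℂ}, 0 ≤ τ → IsTest (R + τ) B χ →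
      (∀ r, |χ r| ≤ N) → MemLp D 2 volume → ∫ ξ, |radPair D (halfWeight χ) ξ| ≤
        √sphereArea * √(max B 0) * N * √(∫ ξ, ‖D ξ‖ ^ 2) := by
    intro τ χ N D hτ hχ hN hD
    refine ((hχ.mul_halfWeight (h0R hτ)).integral_abs_radPair_le (h0R hτ) hD).trans ?_
    rw [Real.sqrt_mul sphereArea_pos.le, mul_assoc (√sphereArea) (√(max B 0))]
    gcongr
    exact hχ.sqrt_integral_halfWeight_le hN
  have hlin : ∀ τ ∈ Icc 0 T, ∀ χ η : ℝ → ℝ, IsTest (R + τ) B χ → IsTest (R + τ) B η → ∀ c : ℝ,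
      diffPair s a A B' τ (fun r => χ r + c * η r) =
        diffPair s a A B' τ χ + c * diffPair s a A B' τ η := by
    intro τ hτ χ η hχ hη c
    have h1 := hχ.mul_halfWeight (h0R hτ.1)
    have h2 := hη.mul_halfWeight (h0R hτ.1)
    have e : ∀ A : E6 → ℂ, radPair A (fun r => halfWeight χ r + c * halfWeight η r) =
        fun ξ => radPair A (halfWeight χ) ξ + c * radPair A (halfWeight η) ξ := fun A =>
      funext fun ξ => h1.radPair_add_mul h2 (h0R hτ.1) A c ξ
    rw [diffPair, diffPair, diffPair, halfWeight_add_mul, e, e,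
      wavePair_add_mul (integrable_radPair hA _) (integrable_radPair hB _)
        (integrable_radPair hA _) (integrable_radPair hB _),
      extPair_add_mul s a (hlt hτ.1 h1) (hlt hτ.1 h2)]
    ring
  refine ⟨hlin, ?_, ?_, ?_, ?_, ?_, ?_, ?_⟩
  · intro τ hτ χ η hχ hη c
    have h1 := hχ.mul_halfWeight (h0R hτ.1)
    have h2 := hη.mul_halfWeight (h0R hτ.1)
    have e : ∀ A : E6 → ℂ, radPair A (fun r => halfWeight χ r + c * halfWeight η r) =
        fun ξ => radPair A (halfWeight χ) ξ + c * radPair A (halfWeight η) ξ := fun A =>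
      funext fun ξ => h1.radPair_add_mul h2 (h0R hτ.1) A c ξ
    rw [diffPairDeriv, diffPairDeriv, diffPairDeriv, halfWeight_add_mul, e, e,
      wavePairDeriv_add_mul (integrable_radPair hA _) (integrable_freq_mul_radPair hA _)
        (integrable_radPair hB _) (integrable_radPair hA _) (integrable_freq_mul_radPair hA _)
        (integrable_radPair hB _),
      extPair_add_mul s a (hlt hτ.1 h1) (hlt hτ.1 h2)]
    ring
  · obtain ⟨C, hC0, hC⟩ := exists_abs_extPair_halfWeight_le s a hR B 0
    set L := √sphereArea * √(max B 0)
    refine ⟨L * √(∫ ξ, ‖A ξ‖ ^ 2) + T * (L * √(∫ ξ, ‖B' ξ‖ ^ 2)) + sphereArea * C,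
      fun τ hτ χ hχ N hN => ?_⟩
    have h1 := hχ.mul_halfWeight (h0R hτ.1)
    have h2 := hbound hτ.1 hχ hN hA
    have h3 := hbound hτ.1 hχ hN hB
    have h4 := abs_wavePair_le (integrable_radPair hA (halfWeight χ))
      (integrable_radPair hB (halfWeight χ)) τ
    have h5 : |τ| * ∫ ξ, |radPair B' (halfWeight χ) ξ| ≤ T * (L * N * √(∫ ξ, ‖B' ξ‖ ^ 2)) := by
      rw [abs_of_nonneg hτ.1]
      exact mul_le_mul hτ.2 h3 (integral_nonneg fun _ => abs_nonneg _) (hτ.1.trans hτ.2)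
    have h6 := mul_le_mul_of_nonneg_left (hC τ hτ.1 χ hχ N hN) sphereArea_pos.le
    have h7 := abs_sub (wavePair (radPair A (halfWeight χ)) (radPair B' (halfWeight χ)) τ)
      (sphereArea * extPair s a 0 τ (halfWeight χ))
    rw [abs_mul, abs_of_pos sphereArea_pos] at h7
    rw [diffPair]
    linarith
  · obtain ⟨C, hC0, hC⟩ := exists_abs_extPair_halfWeight_le s a hR B 1
    set L := √sphereArea * √(max B 0)
    refine ⟨L * √(∫ ξ, ‖B' ξ‖ ^ 2) + L * √(∫ ξ, ‖(freq ξ : ℂ) * A ξ‖ ^ 2) + sphereArea * C,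
      fun τ hτ χ hχ N hN => ?_⟩
    have h1 := hχ.mul_halfWeight (h0R hτ.1)
    have h2 := hbound hτ.1 hχ hN hfA
    have h3 := hbound hτ.1 hχ hN hB
    have h4 := abs_wavePairDeriv_le (integrable_radPair hA (halfWeight χ))
      (integrable_freq_mul_radPair hA (halfWeight χ)) (integrable_radPair hB (halfWeight χ)) τ
    simp only [freq_mul_radPair] at h4
    have h6 := mul_le_mul_of_nonneg_left (hC τ hτ.1 χ hχ N hN) sphereArea_pos.le
    have h7 := abs_sub (wavePairDeriv (radPair A (halfWeight χ)) (radPair B' (halfWeight χ)) τ)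
      (sphereArea * extPair s a 1 τ (halfWeight χ))
    rw [abs_mul, abs_of_pos sphereArea_pos] at h7
    rw [diffPairDeriv]
    linarith
  · intro t ht χ hχ
    have h1 := hχ.mul_halfWeight (h0R ht.1)
    exact ((hasDerivAt_wavePair (integrable_radPair hA _) (integrable_freq_mul_radPair hA _)
      (integrable_radPair hB _) t).sub
      ((hasDerivAt_extPair s a (hlt ht.1 h1) 0).const_mul sphereArea)).hasDerivWithinAt
  · intro t ht χ hχ
    have h1 := hχ.mul_halfWeight (h0R ht.1)
    have hq : IsTest (R + t) B (fun r => (r ^ 2)⁻¹ * χ r) := hχ.mul_left fun r hr =>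
      (contDiffAt_id.pow 2).inv (pow_ne_zero 2 ((h0R ht.1).trans_lt hr.1).ne')
    have e : ∀ A : E6 → ℂ, (fun ξ => -(freq ξ ^ 2 * radPair A (halfWeight χ) ξ)) =
        radPair A (halfWeight (fun r => deriv (deriv χ) r + -(15 / 4) * ((r ^ 2)⁻¹ * χ r))) := by
      intro A
      funext ξ
      rw [← hχ.laplacian_halfWeight (h0R ht.1), h1.radPair_laplacian (h0R ht.1)]
    have h2 := (hasDerivAt_wavePairDeriv (integrable_radPair hA (halfWeight χ))
      (integrable_radPair hB (halfWeight χ)) (integrable_freq_mul_radPair hA _)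
      (integrable_freq_mul_radPair hB _) (integrable_freq_pow_mul_radPair hA _ 2) t).sub
      ((hasDerivAt_extPair s a (hlt ht.1 h1) 1).const_mul sphereArea)
    rw [e, e, one_add_one_eq_two, extPair_two s a (hlt ht.1 h1),
      hχ.laplacian_halfWeight (h0R ht.1)] at h2
    refine h2.hasDerivWithinAt.congr_deriv ?_
    have h3 := hlin t ht _ _ hχ.derivative.derivative hq (-(15 / 4))
    rw [neg_mul, ← sub_eq_add_neg] at h3
    exact h3
  · intro χ hχ
    have h1 := hχ.mul_halfWeight hR.le
    rw [diffPair, wavePair_zero, h1.integral_radPair_fourier hR.le (w := fun _ => 0)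
      (by simpa using hf0), extPair]
    have : ∀ r, extSol s a 0 0 r * (r ^ 5 * halfWeight χ r) = 0 := fun r => by
      by_cases hr : r ∈ Ioo R B
      · rw [extSol_zero s a (hR.trans hr.1), zero_mul]
      · rw [h1.eq_zero hr, mul_zero, mul_zero]
    simp [this]
  · intro χ hχ
    have h1 := hχ.mul_halfWeight hR.le
    rw [diffPairDeriv, wavePairDeriv_zero, h1.integral_radPair_fourier hR.le hg0, extPair]
    have : ∀ r, extSol s a 1 0 r * (r ^ 5 * halfWeight χ r) =
        extData s a r * (r ^ 5 * halfWeight χ r) := fun r => by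
      by_cases hr : r ∈ Ioo R B
      · rw [extSol_one_zero s a (hR.trans hr.1)]
      · rw [h1.eq_zero hr, mul_zero, mul_zero, mul_zero]
    simp [this]

/-- Finite speed of propagation: in the exterior of the light cone, a free wave with the same
initial data as the explicit solution coincides with it. -/
theorem wavePair_eq_extPair (hR : 0 < R) {f g : L2E6} (hf : HasFiniteDirichletEnergy f)
    (hf0 : ∀ᵐ x : E6, R < ‖x‖ → f x = 0)
    (hg0 : ∀ᵐ x : E6, R < ‖x‖ → g x = ((extData s a ‖x‖ : ℝ) : ℂ)) {t b : ℝ} (ht : 0 ≤ t)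
    {φ : ℝ → ℝ} (h : IsTest (R + t) b φ) :
    wavePair (radPair (𝓕 f : L2E6) φ) (radPair (𝓕 g : L2E6) φ) t =
      sphereArea * extPair s a 0 t φ := by
  have hRt : 0 ≤ R + t := by positivity
  have h1 : IsTest (R + t) (b + t - t) (fun r => r ^ (5 / 2 : ℝ) * φ r) := by
    rw [add_sub_cancel_right]
    exact h.mul_left fun _ hr => Real.contDiffAt_rpow_const_of_ne (hRt.trans_lt hr.1).ne'
  have e : halfWeight (fun r => r ^ (5 / 2 : ℝ) * φ r) = φ := by
    funext r
    by_cases hr : r ∈ Ioo (R + t) b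
    · have hr0 : 0 < r := hRt.trans_lt hr.1
      rw [halfWeight, ← mul_assoc, ← Real.rpow_add hr0, neg_add_cancel, Real.rpow_zero, one_mul]
    · rw [halfWeight, h.eq_zero hr, mul_zero, mul_zero]
  have h2 := (isWeakWave_diffPair s a hR hf hf0 hg0 t (b + t)).eq_zero hR ht h1
  rw [diffPair, e] at h2
  linarith

end Uniqueness

theorem IsTest.integrable_mul_of_locallyIntegrableOn {a b : ℝ} {χ e : ℝ → ℝ} (h : IsTest a b χ)
    (he : LocallyIntegrableOn e (Ioi a)) : Integrable fun r => e r * χ r := by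
  obtain ⟨c, d, hc, -, h0⟩ := h.exists_Icc
  have h1 : IntegrableOn e (Icc c d) := he.integrableOn_compact_subset
    (fun r hr => hc.trans_le hr.1) isCompact_Icc
  refine (integrableOn_iff_integrable_of_support_subset (s := Icc c d) fun r hr => ?_).1
    (h1.mul_continuousOn h.smooth.continuous.continuousOn isCompact_Icc)
  by_contra hr'
  exact hr (by simp [h0 r hr'])

section Radial

variable {ρ : ℝ} {w e : ℝ → ℝ}

theorem radialMeasure_lt_top_of_isCompact (ρ : ℝ) {K : Set ℝ} (hK : IsCompact K) :
    radialMeasure ρ K < ⊤ := by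
  have h1 : IntegrableOn (fun r : ℝ => |r| ^ 5) K :=
    (by fun_prop : Continuous fun r : ℝ => |r| ^ 5).continuousOn.integrableOn_compact hK
  have h2 := h1.2
  rw [radialMeasure, withDensity_apply _ hK.measurableSet]
  refine lt_of_le_of_lt ?_ h2
  rw [Measure.restrict_restrict hK.measurableSet]
  refine (lintegral_mono' (Measure.restrict_mono inter_subset_left le_rfl) le_rfl).trans ?_
  refine lintegral_mono fun r => ?_
  rw [← ofReal_norm, norm_pow, Real.norm_eq_abs, abs_abs]
  refine ENNReal.ofReal_le_ofReal ?_
  rw [← abs_pow]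
  exact le_abs_self _

theorem MeasureTheory.MemLp.locallyIntegrableOn_radial (hρ : 0 ≤ ρ)
    (hw : MemLp w 2 (radialMeasure ρ)) : LocallyIntegrableOn w (Ioi ρ) := by
  rw [locallyIntegrableOn_iff isOpen_Ioi.isLocallyClosed]
  intro K hK hKc
  have : IsFiniteMeasure ((radialMeasure ρ).restrict K) :=
    ⟨by rw [Measure.restrict_apply_univ]; exact radialMeasure_lt_top_of_isCompact ρ hKc⟩
  have h1 : IntegrableOn w K (radialMeasure ρ) := (hw.restrict K).integrable one_le_two
  have h2 : IntegrableOn (fun r => K.indicator w r * r ^ 5) (Ioi ρ) :=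
    (integrable_radialMeasure_iff hρ).1 (h1.integrable_indicator hKc.measurableSet)
  have h3 : IntegrableOn (fun r => w r * r ^ 5) K :=
    (h2.mono_set hK).congr_fun (fun r hr => by simp [hr]) hKc.measurableSet
  refine (h3.mul_continuousOn (g' := fun r => (r ^ 5)⁻¹) ?_ hKc).congr_fun (fun r hr => ?_)
    hKc.measurableSet
  · exact (by fun_prop : ContinuousOn (fun r : ℝ => r ^ 5) K).inv₀ fun r hr =>
      pow_ne_zero 5 (hρ.trans_lt (hK hr)).ne'
  · have : r ≠ 0 := (hρ.trans_lt (hK hr)).ne'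
    simp only
    field_simp

/-- A locally integrable function whose pairings with test functions are bounded by their `L²`
norms is square integrable. -/
theorem memLp_radialMeasure_of_forall_test (hρ : 0 ≤ ρ) (he : LocallyIntegrableOn e (Ioi ρ))
    {N : ℝ} (hN : 0 ≤ N) (h : ∀ b φ, IsTest ρ b φ →
      |∫ r, e r * (r ^ 5 * φ r)| ≤ N * √(∫ r in Ioi (0 : ℝ), φ r ^ 2 * r ^ 5)) :
    MemLp e 2 (radialMeasure ρ) ∧ radialNorm ρ e ≤ N := by
  let p : Submodule ℝ (Lp ℝ 2 (radialMeasure ρ)) :=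
    { carrier := {f | ∃ b φ, IsTest ρ b φ ∧ f =ᵐ[radialMeasure ρ] φ}
      add_mem' := by
        rintro f g ⟨b, φ, hφ, hf⟩ ⟨b', η, hη, hg⟩
        refine ⟨max b b', fun r => φ r + 1 * η r,
          (hφ.mono le_rfl (le_max_left _ _)).add_mul (hη.mono le_rfl (le_max_right _ _)) 1, ?_⟩
        filter_upwards [Lp.coeFn_add f g, hf, hg] with r h1 h2 h3
        rw [h1, Pi.add_apply, h2, h3, one_mul]
      zero_mem' := ⟨ρ + 2, fun _ => 0, IsTest.of_eq_zero contDiff_const (c := ρ + 1) (d := ρ + 1)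
        (by linarith) (by linarith) (fun _ _ => rfl), Lp.coeFn_zero _ _ _⟩
      smul_mem' := by
        rintro c f ⟨b, φ, hφ, hf⟩
        refine ⟨b, fun r => c * φ r, hφ.const_mul c, ?_⟩
        filter_upwards [Lp.coeFn_smul c f, hf] with r h1 h2
        rw [h1, Pi.smul_apply, h2, smul_eq_mul] }
  have hval : ∀ (f : Lp ℝ 2 (radialMeasure ρ)) (b : ℝ) (φ : ℝ → ℝ), IsTest ρ b φ →
      f =ᵐ[radialMeasure ρ] φ → ((fun r => e r * (r ^ 5 * f r)) =ᵐ[volume.restrict (Ioi ρ)]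
        fun r => e r * (r ^ 5 * φ r)) := fun f b φ hφ hf => by
    filter_upwards [(ae_radialMeasure_iff hρ).1 hf] with r hr
    rw [hr]
  have hint : ∀ f ∈ p, IntegrableOn (fun r => e r * (r ^ 5 * f r)) (Ioi ρ) := by
    rintro f ⟨b, φ, hφ, hf⟩
    exact (((hφ.pow_mul 5).integrable_mul_of_locallyIntegrableOn he).integrableOn).congr
      (hval f b φ hφ hf).symm
  let L : p →ₗ[ℝ] ℝ :=
    { toFun := fun f => ∫ r in Ioi ρ, e r * (r ^ 5 * (f : Lp ℝ 2 (radialMeasure ρ)) r)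
      map_add' := fun f g => by
        rw [← integral_add (hint f f.2) (hint g g.2)]
        refine integral_congr_ae ?_
        filter_upwards [(ae_radialMeasure_iff hρ).1 (Lp.coeFn_add (f : Lp ℝ 2 (radialMeasure ρ)) g)]
          with r hr
        rw [Submodule.coe_add, hr, Pi.add_apply]
        ring
      map_smul' := fun c f => by
        rw [RingHom.id_apply, smul_eq_mul, ← integral_const_mul]
        refine integral_congr_ae ?_
        filter_upwards [(ae_radialMeasure_iff hρ).1
          (Lp.coeFn_smul c (f : Lp ℝ 2 (radialMeasure ρ)))] with r hr
        rw [Submodule.coe_smul, hr, Pi.smul_apply, smul_eq_mul]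
        ring }
  have hLφ : ∀ (f : p) (b : ℝ) (φ : ℝ → ℝ), IsTest ρ b φ →
      (f : Lp ℝ 2 (radialMeasure ρ)) =ᵐ[radialMeasure ρ] φ →
      L f = ∫ r, e r * (r ^ 5 * φ r) := fun f b φ hφ hf => by
    rw [← (hφ.pow_mul 5).setIntegral_Ioi_mul le_rfl]
    exact integral_congr_ae (hval f b φ hφ hf)
  have hL : ∀ f : p, ‖L f‖ ≤ N * ‖f‖ := by
    intro f
    obtain ⟨b, φ, hφ, hf⟩ := f.2
    rw [hLφ f b φ hφ hf]
    refine (h b φ hφ).trans (mul_le_mul_of_nonneg_left (le_of_eq ?_) hN)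
    have h1 : ‖f‖ = radialNorm ρ φ := by
      rw [Submodule.coe_norm, Lp.norm_def, radialNorm, eLpNorm_congr_ae hf]
    have h2 : ∀ r, |φ r| ^ 2 * r ^ 5 = (r ^ 5 * φ r) * φ r := fun r => by rw [sq_abs]; ring
    have h3 : ∀ r, φ r ^ 2 * r ^ 5 = (r ^ 5 * φ r) * φ r := fun r => by ring
    rw [h1, ← Real.sqrt_sq (radialNorm_nonneg ρ φ), radialNorm_sq hρ (hφ.memLp_radialMeasure ρ)]
    simp only [h2, h3]
    rw [hφ.setIntegral_Ioi_mul hρ, hφ.setIntegral_Ioi_mul le_rfl]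
  obtain ⟨G, hG, hGn⟩ := exists_extension_norm_eq p (L.mkContinuous N hL)
  set g := (InnerProductSpace.toDual ℝ (Lp ℝ 2 (radialMeasure ρ))).symm G with hg
  have hgn : ‖g‖ ≤ N := by
    rw [hg, LinearIsometryEquiv.norm_map, hGn]
    exact L.mkContinuous_norm_le hN hL
  have hgmem : MemLp g 2 (radialMeasure ρ) := Lp.memLp g
  have hgloc := hgmem.locallyIntegrableOn_radial hρ
  have hpair : ∀ b φ, IsTest ρ b φ →
      ∫ r, e r * (r ^ 5 * φ r) = ∫ r, g r * (r ^ 5 * φ r) := by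
    intro b φ hφ
    have hm := hφ.memLp_radialMeasure ρ
    let f : p := ⟨hm.toLp φ, b, φ, hφ, hm.coeFn_toLp⟩
    rw [← hLφ f b φ hφ hm.coeFn_toLp]
    have h1 : L f = inner ℝ g (hm.toLp φ) := by
      rw [hg, InnerProductSpace.toDual_symm_apply]
      exact (hG f).symm
    rw [h1, L2.inner_def, ← (hφ.pow_mul 5).setIntegral_Ioi_mul le_rfl g,
      ← setIntegral_congr_fun (f := fun r => g r * φ r * r ^ 5) measurableSet_Ioi
        (fun r _ => by simp only; ring), ← integral_radialMeasure hρ fun r => g r * φ r]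
    refine integral_congr_ae ?_
    filter_upwards [hm.coeFn_toLp] with r hr
    rw [hr, RCLike.inner_apply, mul_comm]
    rfl
  have hcont : ContinuousOn (fun r : ℝ => r ^ 5) (Ioi ρ) := by fun_prop
  have hloc : LocallyIntegrableOn (fun r => r ^ 5 * (e r - g r)) (Ioi ρ) :=
    (he.sub hgloc).continuousOn_mul hcont isOpen_Ioi.isLocallyClosed
  have hae := isOpen_Ioi.ae_eq_zero_of_integral_contDiff_smul_eq_zero hloc fun ζ hζ hζc hζs => by
    obtain ⟨b, hb⟩ := hζc.isCompact.bddAbove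
    have ht : IsTest ρ (b + 1) ζ := ⟨hζ, hζc, fun r hr => ⟨hζs hr, by linarith [hb hr]⟩⟩
    have h1 := hpair _ ζ ht
    have h2 : ∀ r, ζ r • (r ^ 5 * (e r - g r)) =
        e r * (r ^ 5 * ζ r) - g r * (r ^ 5 * ζ r) := fun r => by rw [smul_eq_mul]; ring
    simp only [h2]
    rw [integral_sub ((ht.pow_mul 5).integrable_mul_of_locallyIntegrableOn he)
      ((ht.pow_mul 5).integrable_mul_of_locallyIntegrableOn hgloc), h1, sub_self]
  have heg : g =ᵐ[radialMeasure ρ] e := by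
    refine (ae_radialMeasure_iff hρ).2 ?_
    filter_upwards [ae_restrict_of_ae hae, ae_restrict_mem measurableSet_Ioi] with r hr hr'
    have h5 : r ^ 5 ≠ 0 := pow_ne_zero 5 (hρ.trans_lt hr').ne'
    have := (mul_eq_zero.1 (hr hr')).resolve_left h5
    linarith
  refine ⟨(memLp_congr_ae heg).1 hgmem, ?_⟩
  rw [radialNorm, ← eLpNorm_congr_ae heg, ← Lp.norm_def]
  exact hgn

/-- The restriction of a square integrable function on `ℝ⁶` to the exterior of a ball where it is
radial is square integrable as a function of the radius. -/
theorem memLp_radialMeasure_of_ae (hρ : 0 ≤ ρ) {F : L2E6}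
    (hF : ∀ᵐ x : E6, ρ < ‖x‖ → F x = ((w ‖x‖ : ℝ) : ℂ)) : MemLp w 2 (radialMeasure ρ) := by
  have hset : MeasurableSet {x : E6 | ρ < ‖x‖} := measurableSet_lt measurable_const measurable_norm
  have hae : ∀ᵐ x : E6, {x : E6 | ρ < ‖x‖}.indicator (fun x => (F x).re) x =
      (Ioi ρ).indicator w ‖x‖ := by
    filter_upwards [hF] with x hx
    by_cases h : ρ < ‖x‖
    · simp [indicator, h, hx h]
    · simp [indicator, h]
  have hmem : MemLp ({x : E6 | ρ < ‖x‖}.indicator fun x => (F x).re) 2 volume :=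
    (Lp.memLp F).re.indicator hset
  have hmem' : MemLp (fun x : E6 => (Ioi ρ).indicator w ‖x‖) 2 volume :=
    (memLp_congr_ae hae).1 hmem
  have hweight : MemLp (fun x : E6 => ((1 + ‖x‖) ^ 4)⁻¹) 2 volume := by
    have hc : Continuous fun x : E6 => ((1 + ‖x‖) ^ 4)⁻¹ :=
      Continuous.inv₀ (by fun_prop) fun x => by positivity
    rw [memLp_two_iff_integrable_sq hc.aestronglyMeasurable]
    refine (integrable_one_add_norm (E := E6) (μ := volume) (r := 8) (by simp; norm_num)).congr
      (Eventually.of_forall fun x => ?_)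
    have : 0 ≤ 1 + ‖x‖ := by positivity
    simp only
    rw [Real.rpow_neg this, ← inv_pow, ← pow_mul, inv_pow]
    norm_cast
  have h1 : IntegrableOn (fun r => r ^ 5 * ((Ioi ρ).indicator w r * ((1 + r) ^ 4)⁻¹)) (Ioi 0) :=
    integrable_radial_iff.1 (hmem'.integrable_mul hweight)
  have hmeas : AEStronglyMeasurable w (volume.restrict (Ioi ρ)) := by
    have h2 := (h1.mono_set (Ioi_subset_Ioi hρ)).1.mul
      (by fun_prop : Measurable fun r : ℝ => (r ^ 5)⁻¹ * (1 + r) ^ 4).aestronglyMeasurable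
    refine h2.congr ?_
    filter_upwards [ae_restrict_mem measurableSet_Ioi] with r hr
    have h3 : 0 < r := hρ.trans_lt hr
    have h4 : 0 < 1 + r := by positivity
    simp only [Pi.mul_apply, indicator_of_mem hr]
    field_simp
  rw [memLp_radialMeasure_iff hρ (hmeas.mono_ac (radialMeasure_absolutelyContinuous ρ))]
  have h2 : IntegrableOn (fun r => r ^ 5 * (Ioi ρ).indicator w r ^ 2) (Ioi 0) :=
    integrable_radial_iff.1 hmem'.integrable_sq
  refine (h2.mono_set (Ioi_subset_Ioi hρ)).congr_fun (fun r hr => ?_) measurableSet_Ioi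
  simp only [indicator_of_mem hr, sq_abs]
  ring

end Radial

/-- The radial function on `ℝ⁶` with profile `e` outside of the ball of radius `R`, and zero
inside. -/
theorem exists_radial_extension {R : ℝ} (hR : 0 ≤ R) {e : ℝ → ℝ} (hm : Measurable e)
    (he : MemLp e 2 (radialMeasure R)) : ∃ F : L2E6,
      (∀ᵐ x : E6, R < ‖x‖ → F x = ((e ‖x‖ : ℝ) : ℂ)) ∧ ‖F‖ = √sphereArea * radialNorm R e := by
  set q : ℝ → ℝ := (Ioi R).indicator e with hq
  have hqm : Measurable q := hm.indicator measurableSet_Ioi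
  have e1 : (fun r => r ^ 5 • ‖((q r : ℝ) : ℂ)‖ ^ 2) =
      (Ioi R).indicator fun r => |e r| ^ 2 * r ^ 5 := by
    funext r
    by_cases hr : r ∈ Ioi R
    · simp only [hq, indicator_of_mem hr, Complex.norm_real, Real.norm_eq_abs, smul_eq_mul]
      ring
    · simp [hq, indicator_of_notMem hr]
  have hF : MemLp (fun x : E6 => ((q ‖x‖ : ℝ) : ℂ)) 2 volume := by
    have hm' : Measurable fun x : E6 => ((q ‖x‖ : ℝ) : ℂ) :=
      Complex.measurable_ofReal.comp (hqm.comp measurable_norm)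
    rw [memLp_two_iff_integrable_sq_norm hm'.aestronglyMeasurable]
    refine (integrable_radial_iff (f := fun r => ‖((q r : ℝ) : ℂ)‖ ^ 2)).2 ?_
    rw [e1]
    exact ((integrable_indicator_iff measurableSet_Ioi).2
      ((memLp_radialMeasure_iff hR he.1).1 he)).integrableOn
  refine ⟨hF.toLp _, ?_, ?_⟩
  · filter_upwards [hF.coeFn_toLp] with x hx hxR
    rw [hx, hq, indicator_of_mem (show ‖x‖ ∈ Ioi R from hxR)]
  · have h2 : ∫ x, ‖hF.toLp _ x‖ ^ 2 = sphereArea * radialNorm R e ^ 2 := by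
      rw [radialNorm_sq hR he]
      have := integral_radial (fun r => ‖((q r : ℝ) : ℂ)‖ ^ 2)
      rw [e1, smul_eq_mul, integral_indicator measurableSet_Ioi, Measure.restrict_restrict
        measurableSet_Ioi, inter_eq_self_of_subset_left (Ioi_subset_Ioi hR)] at this
      rw [← this]
      refine integral_congr_ae ?_
      filter_upwards [hF.coeFn_toLp] with x hx
      rw [hx]
    rw [← sqrt_integral_norm_sq, h2, Real.sqrt_mul sphereArea_pos.le,
      Real.sqrt_sq (radialNorm_nonneg _ _)]

section Comparison

variable {R : ℝ} {u₁ : RadialL2 R} {u ut ur : ℝ → ℝ → ℝ} (s : Finset ℕ) (a : ℕ → ℝ)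

theorem memLp_extSol_zero (hR : 0 < R) (l : ℕ) : MemLp (extSol s a l 0) 2 (radialMeasure R) := by
  simpa using (hasRadiation_extSol s a hR l).memLp hR le_rfl

/-- The difference of the initial velocity and of that of the explicit exterior solution. -/
def dataDiff (u₁ : RadialL2 R) (r : ℝ) : ℝ := u₁ r - extSol s a 1 0 r

theorem memLp_dataDiff (hR : 0 < R) (u₁ : RadialL2 R) :
    MemLp (dataDiff s a u₁) 2 (radialMeasure R) :=
  (Lp.memLp u₁).sub (memLp_extSol_zero s a hR 1)

theorem IsExteriorSolution.memLp (hR : 0 < R) (hu : IsExteriorSolution R u₁ u) (t : ℝ) :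
    MemLp (u t) 2 (radialMeasure (R + |t|)) := by
  obtain ⟨f, g, U, -, -, -, -, -, -, hU⟩ := hu
  exact memLp_radialMeasure_of_ae (by positivity) (hU t)

/-- In the exterior of the light cone, the difference of an exterior solution and of the explicit
one is the restriction of a free wave with zero initial position, and with an initial velocity
which vanishes inside the ball. -/
theorem IsExteriorSolution.exists_pairing (hR : 0 < R) (hu : IsExteriorSolution R u₁ u) :
    ∃ D : L2E6, ‖D‖ = √sphereArea * radialNorm R (dataDiff s a u₁) ∧
      ∀ t, 0 ≤ t → ∀ b φ, IsTest (R + t) b φ → ∫ r, u t r * (r ^ 5 * φ r) =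
        extPair s a 0 t φ + sphereArea⁻¹ * wavePair (fun _ => 0) (radPair D φ) t := by
  obtain ⟨f, g, U, -, -, hf, hf0, hg, hU, hUu⟩ := hu
  have hm : Measurable (dataDiff s a u₁) :=
    (Lp.stronglyMeasurable u₁).measurable.sub ((hasRadiation_extSol s a hR 1).meas 0)
  obtain ⟨F, hF, hFn⟩ := exists_radial_extension hR.le hm (memLp_dataDiff s a hR u₁)
  refine ⟨𝓕 F, by rw [MeasureTheory.Lp.norm_fourier_eq, hFn], fun t ht b φ hφ => ?_⟩
  have hRt : 0 ≤ R + t := by positivity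
  set k : L2E6 := g - F with hk
  have hk0 : ∀ᵐ x : E6, R < ‖x‖ → k x = ((extData s a ‖x‖ : ℝ) : ℂ) := by
    filter_upwards [Lp.coeFn_sub g F, hg, hF] with x h1 h2 h3 hx
    rw [hk, h1, Pi.sub_apply, h2 hx, h3 hx, dataDiff, extSol_one_zero s a (hR.trans hx)]
    push_cast
    ring
  have hsum : (𝓕 g : L2E6) =ᵐ[volume] fun ξ => (𝓕 k : L2E6) ξ + (𝓕 F : L2E6) ξ := by
    have : (𝓕 g : L2E6) = 𝓕 k + 𝓕 F := by
      rw [← FourierTransform.fourier_add, hk, sub_add_cancel]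
    rw [this]
    exact Lp.coeFn_add _ _
  have hA : MemLp (𝓕 f : L2E6) 2 volume := Lp.memLp _
  have hK : MemLp (𝓕 k : L2E6) 2 volume := Lp.memLp _
  have hD : MemLp (𝓕 F : L2E6) 2 volume := Lp.memLp _
  have h1 := hU.wavePair_eq hRt hφ (t := t) (w := u t) (by simpa [abs_of_nonneg ht] using hUu t)
  have h2 := wavePair_eq_extPair s a hR hf hf0 hk0 ht hφ
  have h3 := wavePair_add_mul (a' := fun _ => 0) (integrable_radPair hA φ) (integrable_radPair hK φ)
    (integrable_zero E6 ℝ volume) (integrable_radPair hD φ) 1 t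
  have h4 : wavePair (radPair (𝓕 f : L2E6) φ) (radPair (𝓕 g : L2E6) φ) t =
      wavePair (fun ξ => radPair (𝓕 f : L2E6) φ ξ + 1 * 0)
        (fun ξ => radPair (𝓕 k : L2E6) φ ξ + 1 * radPair (𝓕 F : L2E6) φ ξ) t := by
    refine integral_congr_ae ?_
    filter_upwards [hsum] with ξ hξ
    simp only [radPair, hξ, _root_.mul_add, Complex.add_re, one_mul, mul_zero, add_zero]
  rw [h4, h3, h2, one_mul] at h1
  rw [eq_div_of_mul_eq sphereArea_pos.ne' ((mul_comm _ _).trans h1.symm), add_div,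
    mul_div_cancel_left₀ _ sphereArea_pos.ne', div_eq_inv_mul]

theorem abs_sphereArea_inv_mul_le {φ : ℝ → ℝ} {x N : ℝ} {D : L2E6}
    (hD : ‖D‖ = √sphereArea * N)
    (hx : |x| ≤ √(sphereArea * ∫ r in Ioi (0 : ℝ), φ r ^ 2 * r ^ 5) * √(∫ ξ, ‖D ξ‖ ^ 2)) :
    |sphereArea⁻¹ * x| ≤ N * √(∫ r in Ioi (0 : ℝ), φ r ^ 2 * r ^ 5) := by
  rw [sqrt_integral_norm_sq, hD, Real.sqrt_mul sphereArea_pos.le] at hx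
  rw [abs_mul, abs_inv, abs_of_pos sphereArea_pos]
  have h := mul_le_mul_of_nonneg_left hx (inv_nonneg.2 sphereArea_pos.le)
  refine h.trans_eq ?_
  have h2 : √sphereArea * √sphereArea = sphereArea := Real.mul_self_sqrt sphereArea_pos.le
  have h3 := sphereArea_pos.ne'
  field_simp
  rw [sq, h2]

/-- The radial derivative of an exterior solution is as close to that of the explicit one as
the initial data are. -/
theorem radialNorm_radialDeriv_sub_le (hR : 0 < R) (hu : IsExteriorSolution R u₁ u)
    (hur : IsRadialDeriv R u ur) {t : ℝ} (ht : 0 ≤ t) :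
    MemLp (fun r => ur t r - extSolR s a t r) 2 (radialMeasure (R + t)) ∧
      radialNorm (R + t) (fun r => ur t r - extSolR s a t r) ≤
        radialNorm R (dataDiff s a u₁) := by
  obtain ⟨D, hD, hpair⟩ := hu.exists_pairing s a hR
  have hRt : 0 ≤ R + t := by positivity
  obtain ⟨hloc, hweak⟩ := hur t
  rw [abs_of_nonneg ht] at hloc hweak
  have hlt : ∀ r, R + t < r → |t| < r := fun r hr => by
    rw [abs_of_nonneg ht]
    linarith
  have hvc : ContinuousOn (extSolR s a t) (Ioi (R + t)) := fun r hr =>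
    (hasDerivAt_extSolR_radial s a (hlt r hr)).continuousAt.continuousWithinAt
  have hvloc : LocallyIntegrableOn (extSolR s a t) (Ioi (R + t)) :=
    hvc.locallyIntegrableOn measurableSet_Ioi
  refine memLp_radialMeasure_of_forall_test hRt (hloc.sub hvloc) (radialNorm_nonneg _ _)
    fun b φ hφ => ?_
  have hφ5 := hφ.pow_mul 5
  set η : ℝ → ℝ := fun r => r⁻¹ * φ r with hη
  have hηt : IsTest (R + t) b η := hφ.mul_left fun r hr => contDiffAt_id.inv (hRt.trans_lt hr.1).ne'
  have hdiv : IsTest (R + t) b (fun r => r * deriv η r + 6 * η r) :=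
    (hηt.derivative.mul_left fun r _ => contDiffAt_id).add_mul hηt 6
  have hd5 : deriv (fun r => r ^ 5 * φ r) = fun r => r ^ 5 * (r * deriv η r + 6 * η r) := by
    funext r
    by_cases hr : r ∈ Ioo (R + t) b
    · have hr0 : r ≠ 0 := (hRt.trans_lt hr.1).ne'
      rw [((hasDerivAt_pow 5 r).fun_mul (hφ.differentiable r).hasDerivAt).deriv,
        ((hasDerivAt_inv hr0).fun_mul (hφ.differentiable r).hasDerivAt).deriv, hη]
      field_simp
      norm_num
      ring
    · rw [hφ5.derivative.eq_zero hr, hηt.derivative.eq_zero hr, hηt.eq_zero hr]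
      ring
  have h1 : ∫ r, ur t r * (r ^ 5 * φ r) = -∫ r, u t r * (r ^ 5 * (r * deriv η r + 6 * η r)) := by
    rw [← neg_eq_iff_eq_neg, ← hweak _ hφ5.smooth hφ5.compact
      (hφ5.supp.trans Ioo_subset_Ioi_self), hd5]
  have h2 := hφ5.integral_deriv_mul (fun r hr => hasDerivAt_extSol_radial s a (hlt r hr)) hvc
  rw [hd5] at h2
  have h3 := hpair t ht b _ hdiv
  rw [extPair] at h3
  have e1 : ∫ r, (ur t r - extSolR s a t r) * (r ^ 5 * φ r) =
      -(sphereArea⁻¹ * wavePair (fun _ => 0) (radPair D fun r => r * deriv η r + 6 * η r) t) := by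
    simp only [sub_mul]
    rw [integral_sub (hφ5.integrable_mul_of_locallyIntegrableOn hloc)
      (hφ5.integrable_mul_of_locallyIntegrableOn hvloc), h1, h2, h3]
    ring
  have e2 : ∀ r ∈ Ioi (0 : ℝ), (r * η r) ^ 2 * r ^ 5 = φ r ^ 2 * r ^ 5 := fun r hr => by
    rw [hη, mul_inv_cancel_left₀ (ne_of_gt hr)]
  have h4 := hηt.abs_wavePair_div_le hRt (Lp.memLp D) t
  rw [setIntegral_congr_fun measurableSet_Ioi e2] at h4
  simp only [Pi.sub_apply]
  rw [e1, abs_neg]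
  exact abs_sphereArea_inv_mul_le hD h4

/-- The time derivative of an exterior solution is as close to that of the explicit one as
the initial data are. -/
theorem radialNorm_timeDeriv_sub_le (hR : 0 < R) (hu : IsExteriorSolution R u₁ u)
    (hut : IsTimeDeriv R u ut) {t : ℝ} (ht : 0 ≤ t) :
    MemLp (fun r => ut t r - extSol s a 1 t r) 2 (radialMeasure (R + t)) ∧
      radialNorm (R + t) (fun r => ut t r - extSol s a 1 t r) ≤
        radialNorm R (dataDiff s a u₁) := by
  obtain ⟨D, hD, hpair⟩ := hu.exists_pairing s a hR
  have hDm : MemLp D 2 volume := Lp.memLp D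
  have hRt : 0 ≤ R + t := by positivity
  obtain ⟨hmeas, hlim⟩ := hut t
  simp only [abs_of_nonneg ht] at hmeas hlim
  have hlim' := (hlim.mono_left (nhdsWithin_mono 0 (fun x (hx : 0 < x) => ne_of_gt hx) :
    𝓝[>] (0 : ℝ) ≤ 𝓝[≠] 0))
  have hu0 : ∀ h, 0 < h → MemLp (u t) 2 (radialMeasure (R + t + h)) := fun h hh => by
    have := hu.memLp hR t
    rw [abs_of_nonneg ht] at this
    exact this.mono_measure (radialMeasure_mono (by linarith))
  have hu1 : ∀ h, 0 < h → MemLp (u (t + h)) 2 (radialMeasure (R + t + h)) := fun h hh => by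
    have := hu.memLp hR (t + h)
    rwa [abs_of_nonneg (by positivity), ← add_assoc] at this
  have hq : ∀ h, 0 < h → MemLp (fun r => (u (t + h) r - u t r) / h) 2
      (radialMeasure (R + t + h)) := fun h hh => by
    simpa only [div_eq_inv_mul, Pi.sub_apply] using ((hu1 h hh).sub (hu0 h hh)).const_mul h⁻¹
  have hutm : ∀ h, 0 < h → AEStronglyMeasurable (ut t) (radialMeasure (R + t + h)) := fun h hh =>
    (hmeas.mono_ac (radialMeasure_absolutelyContinuous _)).mono_measure
      (radialMeasure_mono (by linarith))
  have hmemq : ∀ᶠ h in 𝓝[>] (0 : ℝ), MemLp (fun r => (u (t + h) r - u t r) / h - ut t r) 2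
      (radialMeasure (R + t + h)) := by
    filter_upwards [hlim'.eventually (gt_mem_nhds ENNReal.zero_lt_top), self_mem_nhdsWithin]
      with h h1 (h2 : 0 < h)
    rw [abs_of_pos h2] at h1
    exact ⟨(hq h h2).1.sub (hutm h h2), h1⟩
  have hmemt : ∀ᶠ h in 𝓝[>] (0 : ℝ), MemLp (ut t) 2 (radialMeasure (R + t + h)) := by
    filter_upwards [hmemq, self_mem_nhdsWithin] with h h1 (h2 : 0 < h)
    have := (hq h h2).sub h1
    refine (memLp_congr_ae (Eventually.of_forall fun r => ?_)).1 this
    simp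
  have hloc : LocallyIntegrableOn (ut t) (Ioi (R + t)) := by
    rw [locallyIntegrableOn_iff isOpen_Ioi.isLocallyClosed]
    intro K hK hKc
    rcases K.eq_empty_or_nonempty with rfl | hne
    · exact integrableOn_empty
    obtain ⟨m, hm, hmin⟩ := hKc.exists_isLeast hne
    have hpos : 0 < m - (R + t) := sub_pos.2 (hK hm)
    obtain ⟨h, ⟨h1, h2⟩, h3⟩ := ((hmemt.and (Ioo_mem_nhdsGT hpos)).and
      self_mem_nhdsWithin).exists
    exact (h1.locallyIntegrableOn_radial (by linarith [h2.1])).integrableOn_compact_subset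
      (fun r hr => show R + t + h < r by linarith [h2.2, hmin hr]) hKc
  have hvc : ContinuousOn (extSol s a 1 t) (Ioi (R + t)) :=
    (continuousOn_extSol_slice s a 1 t).mono (Ioi_subset_Ioi (by rw [abs_of_nonneg ht]; linarith))
  have hvloc : LocallyIntegrableOn (extSol s a 1 t) (Ioi (R + t)) :=
    hvc.locallyIntegrableOn measurableSet_Ioi
  refine memLp_radialMeasure_of_forall_test hRt (hloc.sub hvloc) (radialNorm_nonneg _ _)
    fun b φ hφ => ?_
  have hφ5 := hφ.pow_mul 5
  have hφt : IsTest |t| b φ := hφ.mono (by rw [abs_of_nonneg ht]; linarith) le_rfl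
  obtain ⟨δ, hδ, hφδ⟩ := hφ.exists_shrink
  set I := √(∫ r in Ioi (0 : ℝ), φ r ^ 2 * r ^ 5) with hI
  set P : ℝ → ℝ := fun τ =>
    extPair s a 0 τ φ + sphereArea⁻¹ * wavePair (fun _ => 0) (radPair D φ) τ with hP
  have hPd : HasDerivAt P (extPair s a 1 t φ +
      sphereArea⁻¹ * wavePairDeriv (fun _ => 0) (radPair D φ) t) t :=
    (hasDerivAt_extPair s a hφt 0).add ((hasDerivAt_wavePair (integrable_zero E6 ℝ volume)
      (by simp) (integrable_radPair hDm φ) t).const_mul _)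
  have hslope : Tendsto (fun h => (P (t + h) - P t) / h) (𝓝[>] 0) (𝓝 (extPair s a 1 t φ +
      sphereArea⁻¹ * wavePairDeriv (fun _ => 0) (radPair D φ) t)) := by
    refine (hPd.tendsto_slope_zero_right).congr fun h => ?_
    rw [smul_eq_mul, div_eq_inv_mul]
  have hlim2 : Tendsto (fun h => (P (t + h) - P t) / h) (𝓝[>] 0)
      (𝓝 (∫ r, ut t r * (r ^ 5 * φ r))) := by
    rw [tendsto_iff_norm_sub_tendsto_zero]
    have hzero : Tendsto (fun h => radialNorm (R + t + h)
        (fun r => (u (t + h) r - u t r) / h - ut t r) * I) (𝓝[>] 0) (𝓝 0) := by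
      have h1 := ((ENNReal.tendsto_toReal ENNReal.zero_ne_top).comp hlim').mul_const I
      rw [ENNReal.toReal_zero, zero_mul] at h1
      refine h1.congr' ?_
      filter_upwards [self_mem_nhdsWithin] with h (h2 : 0 < h)
      simp only [Function.comp_apply, abs_of_pos h2, radialNorm]
    refine squeeze_zero' (Eventually.of_forall fun _ => norm_nonneg _) ?_ hzero
    filter_upwards [hmemq, Ioo_mem_nhdsGT hδ] with h h1 h2
    have hφh : IsTest (R + t + h) b φ := hφδ.mono (by linarith [h2.2]) (by linarith)
    have hh0 : 0 ≤ R + t + h := by linarith [h2.1]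
    have h5 := hφh.pow_mul 5
    have hi1 := h5.integrable_mul_of_locallyIntegrableOn
      ((hu1 h h2.1).locallyIntegrableOn_radial hh0)
    have hi0 := h5.integrable_mul_of_locallyIntegrableOn
      ((hu0 h h2.1).locallyIntegrableOn_radial hh0)
    have hit := hφ5.integrable_mul_of_locallyIntegrableOn hloc
    have e1 : (P (t + h) - P t) / h - ∫ r, ut t r * (r ^ 5 * φ r) =
        ∫ r, ((u (t + h) r - u t r) / h - ut t r) * (r ^ 5 * φ r) := by
      have e2 : ∀ r, ((u (t + h) r - u t r) / h - ut t r) * (r ^ 5 * φ r) =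
          h⁻¹ * (u (t + h) r * (r ^ 5 * φ r) - u t r * (r ^ 5 * φ r)) -
            ut t r * (r ^ 5 * φ r) := fun r => by ring
      simp only [e2]
      have hi : Integrable fun r => h⁻¹ * (u (t + h) r * (r ^ 5 * φ r) - u t r * (r ^ 5 * φ r)) :=
        (hi1.sub hi0).const_mul _
      rw [integral_sub hi hit, integral_const_mul,
        integral_sub hi1 hi0, hpair t ht b φ hφ,
        hpair (t + h) (by linarith [h2.1]) b φ (by rwa [← add_assoc]), div_eq_inv_mul]
    rw [e1, Real.norm_eq_abs]
    exact hφh.abs_integral_mul_le hh0 le_rfl h1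
  have hut_eq := tendsto_nhds_unique hlim2 hslope
  have e1 : ∫ r, (ut t r - extSol s a 1 t r) * (r ^ 5 * φ r) =
      sphereArea⁻¹ * wavePairDeriv (fun _ => 0) (radPair D φ) t := by
    simp only [sub_mul]
    rw [integral_sub (hφ5.integrable_mul_of_locallyIntegrableOn hloc)
      (hφ5.integrable_mul_of_locallyIntegrableOn hvloc), hut_eq, extPair]
    ring
  simp only [Pi.sub_apply]
  rw [e1]
  refine abs_sphereArea_inv_mul_le hD ?_
  refine (abs_wavePairDeriv_le (integrable_zero E6 ℝ volume) (by simp)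
    (integrable_radPair hDm φ) t).trans ?_
  simpa using hφ.integral_abs_radPair_le hRt hDm

end Comparison

theorem isLocallyFiniteMeasure_radialMeasure (ρ : ℝ) : IsLocallyFiniteMeasure (radialMeasure ρ) :=
  have : IsFiniteMeasureOnCompacts (radialMeasure ρ) :=
    ⟨fun _ hK => radialMeasure_lt_top_of_isCompact ρ hK⟩
  inferInstance

theorem memLp_inv_pow_seven {R : ℝ} (hR : 0 < R) :
    MemLp (fun r : ℝ => (r ^ 7)⁻¹) 2 (radialMeasure R) := by
  have hm : Measurable (fun r : ℝ => (r ^ 7)⁻¹) := by fun_prop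
  rw [memLp_radialMeasure_iff hR.le hm.aestronglyMeasurable]
  refine (integral_inv_pow hR 7).1.congr_fun (fun r hr => ?_) measurableSet_Ioi
  have hr0 : (0 : ℝ) < r := hR.trans hr
  simp only [sq_abs]
  field_simp

theorem extData_eq_polynomial_eval (p : Polynomial ℝ) (r : ℝ) :
    extData p.support p.coeff r = (r ^ 7)⁻¹ * p.eval ((r ^ 2)⁻¹) := by
  rw [extData, Polynomial.eval_eq_sum, Polynomial.sum, Finset.mul_sum]
  refine Finset.sum_congr rfl fun k _ => ?_
  rw [pow_add, mul_inv, pow_mul, inv_pow]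
  ring

/-- Odd powers of `1 / r`, starting with the seventh, span a dense subspace. -/
theorem exists_radialNorm_sub_extData_le {R : ℝ} (hR : 0 < R) {f : ℝ → ℝ}
    (hf : MemLp f 2 (radialMeasure R)) {ε : ℝ} (hε : 0 < ε) :
    ∃ (s : Finset ℕ) (a : ℕ → ℝ), radialNorm R (fun r => f r - extData s a r) ≤ ε := by
  have := isLocallyFiniteMeasure_radialMeasure R
  obtain ⟨g, hgc, hfg, hg, hgm⟩ := hf.exists_hasCompactSupport_eLpNorm_sub_le (by norm_num)
    (ε := ENNReal.ofReal (ε / 2)) (by simpa using hε)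
  obtain ⟨M, hM⟩ := hgc.isCompact.bddAbove
  set M' := max M 1 with hM'
  have hg0 : ∀ r, M' < r → g r = 0 := fun r hr => image_eq_zero_of_notMem_tsupport fun h =>
    absurd (hM h) (not_le.2 ((le_max_left _ _).trans_lt hr))
  set G : ℝ → ℝ := fun y => g (√y)⁻¹ * (√y)⁻¹ ^ 7 with hG
  have hGc : ContinuousOn G (Icc 0 (R ^ 2)⁻¹) := by
    intro y hy
    rcases eq_or_lt_of_le hy.1 with h0 | h0
    · have hM0 : 0 < M' := lt_of_lt_of_le one_pos (le_max_right _ _)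
      have hz : G =ᶠ[𝓝 y] fun _ => 0 := by
        rw [← h0]
        filter_upwards [Iio_mem_nhds (inv_pos.2 (pow_pos hM0 2))] with x hx
        rcases le_or_gt x 0 with hx0 | hx0
        · simp [hG, Real.sqrt_eq_zero_of_nonpos hx0]
        · have h1 : √x < M'⁻¹ := by
            rw [Real.sqrt_lt' (inv_pos.2 hM0), inv_pow]
            exact hx
          simp only [hG]
          rw [hg0 _ ((lt_inv_comm₀ (Real.sqrt_pos.2 hx0) hM0).1 h1), zero_mul]
      exact (continuousAt_const.congr_of_eventuallyEq hz).continuousWithinAt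
    · have h1 : ContinuousAt (fun y => (√y)⁻¹) y :=
        Real.continuous_sqrt.continuousAt.inv₀ (Real.sqrt_pos.2 h0).ne'
      exact ((hg.continuousAt.comp h1).mul (h1.pow 7)).continuousWithinAt
  set K := radialNorm R (fun r => (r ^ 7)⁻¹) with hK
  have hK0 : 0 ≤ K := radialNorm_nonneg _ _
  have hδ : 0 < ε / 2 / (K + 1) := by positivity
  obtain ⟨p, hp⟩ := exists_polynomial_near_of_continuousOn 0 (R ^ 2)⁻¹ G hGc _ hδ
  refine ⟨p.support, p.coeff, ?_⟩
  have hle : ∀ r ∈ Ioi R, ‖g r - extData p.support p.coeff r‖ ≤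
      (ε / 2 / (K + 1)) * ‖(r ^ 7)⁻¹‖ := by
    intro r hr
    have hr0 : 0 < r := hR.trans hr
    have hy : (r ^ 2)⁻¹ ∈ Icc 0 (R ^ 2)⁻¹ := by
      refine ⟨by positivity, inv_anti₀ (by positivity) ?_⟩
      exact pow_le_pow_left₀ hR.le (le_of_lt hr) 2
    have hGr : G (r ^ 2)⁻¹ = g r * r ^ 7 := by
      simp only [hG, Real.sqrt_inv, Real.sqrt_sq hr0.le, inv_inv]
    have h1 := (hp _ hy).le
    rw [hGr] at h1
    have h2 : g r - extData p.support p.coeff r =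
        -((p.eval (r ^ 2)⁻¹ - g r * r ^ 7) * (r ^ 7)⁻¹) := by
      rw [extData_eq_polynomial_eval]
      field_simp
      ring
    rw [h2, norm_neg, norm_mul]
    exact mul_le_mul_of_nonneg_right h1 (norm_nonneg _)
  have h7 := memLp_inv_pow_seven hR
  have hext : Measurable (extData p.support p.coeff) := by
    unfold extData
    fun_prop
  have haele : ∀ᵐ r ∂radialMeasure R, ‖g r - extData p.support p.coeff r‖ ≤
      (ε / 2 / (K + 1)) * ‖(r ^ 7)⁻¹‖ :=
    (ae_radialMeasure_iff hR.le).2 ((ae_restrict_mem measurableSet_Ioi).mono hle)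
  have h3 := eLpNorm_le_mul_eLpNorm_of_ae_le_mul haele 2
  have h4 : eLpNorm (fun r => f r - extData p.support p.coeff r) 2 (radialMeasure R) ≤
      ENNReal.ofReal ε := by
    have e : (fun r => f r - extData p.support p.coeff r) =
        (f - g) + fun r => g r - extData p.support p.coeff r := by
      funext r
      simp
    have h5 : eLpNorm (fun r : ℝ => (r ^ 7)⁻¹) 2 (radialMeasure R) = ENNReal.ofReal K :=
      (ENNReal.ofReal_toReal h7.2.ne).symm
    rw [e]
    refine (eLpNorm_add_le (hf.1.sub hgm.1) (hgm.1.sub hext.aestronglyMeasurable)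
      one_le_two).trans ((add_le_add hfg h3).trans ?_)
    rw [h5, ← ENNReal.ofReal_mul hδ.le, ← ENNReal.ofReal_add (by positivity) (by positivity)]
    refine ENNReal.ofReal_le_ofReal ?_
    have : ε / 2 / (K + 1) * K ≤ ε / 2 := by
      rw [div_mul_eq_mul_div, div_le_iff₀ (by positivity)]
      nlinarith
    linarith
  exact ENNReal.toReal_le_of_le_ofReal hε.le h4

theorem norm_radialProjPerp_le {R : ℝ} (hR : 0 < R) (f : RadialL2 R) (c : ℝ) :
    ‖radialProjPerp hR f‖ ≤ ‖f - c • invPowFour hR‖ := by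
  have h1 : radialProjPerp hR f = f - (Submodule.span ℝ {invPowFour hR}).starProjection f := rfl
  rw [h1, Submodule.starProjection_minimal]
  have h2 : c • invPowFour hR ∈ Submodule.span ℝ {invPowFour hR} :=
    Submodule.smul_mem _ _ (Submodule.mem_span_singleton_self _)
  exact ciInf_le ⟨0, by rintro _ ⟨x, rfl⟩; exact norm_nonneg _⟩
    (⟨_, h2⟩ : Submodule.span ℝ {invPowFour hR})

/-- Two functions which are asymptotically uniformly close to a common constant, up to arbitrarily
small errors, converge to the same limit. -/
theorem exists_tendsto_of_forall_eventually_close {A B : ℝ → ℝ} {m : ℝ}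
    (h : ∀ ε > 0, ∃ ℓ, (∀ᶠ t in atTop, |A t - ℓ| ≤ ε) ∧ (∀ᶠ t in atTop, |B t - ℓ| ≤ ε) ∧
      m ≤ ℓ + ε) :
    ∃ ℓ, Tendsto A atTop (𝓝 ℓ) ∧ Tendsto B atTop (𝓝 ℓ) ∧ m ≤ ℓ := by
  have hA : Cauchy (map A atTop) := by
    refine Metric.cauchy_iff.2 ⟨inferInstance, fun ε hε => ?_⟩
    obtain ⟨ℓ, h1, -, -⟩ := h (ε / 3) (by positivity)
    refine ⟨{x | |x - ℓ| ≤ ε / 3}, h1, fun x hx y hy => ?_⟩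
    have hx' : |x - ℓ| ≤ ε / 3 := hx
    have hy' : |y - ℓ| ≤ ε / 3 := hy
    rw [Real.dist_eq]
    have := abs_sub_le x ℓ y
    rw [abs_sub_comm ℓ y] at this
    linarith
  obtain ⟨ℓ, hℓ⟩ := cauchy_map_iff_exists_tendsto.1 hA
  have hclose : ∀ ε > 0, ∃ ℓ', |ℓ - ℓ'| ≤ ε ∧ (∀ᶠ t in atTop, |B t - ℓ'| ≤ ε) ∧ m ≤ ℓ' + ε := by
    intro ε hε
    obtain ⟨ℓ', h1, h2, h3⟩ := h ε hε
    exact ⟨ℓ', le_of_tendsto ((hℓ.sub_const ℓ').abs) h1, h2, h3⟩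
  refine ⟨ℓ, hℓ, Metric.tendsto_nhds.2 fun ε hε => ?_, le_of_forall_pos_le_add fun ε hε => ?_⟩
  · obtain ⟨ℓ', h1, h2, -⟩ := hclose (ε / 3) (by positivity)
    filter_upwards [h2] with t ht
    rw [Real.dist_eq]
    have := abs_sub_le (B t) ℓ' ℓ
    rw [abs_sub_comm ℓ' ℓ] at this
    linarith
  · obtain ⟨ℓ', h1, -, h3⟩ := hclose (ε / 2) (by positivity)
    have := (abs_le.1 h1).1
    linarith

/-- A function of time which is close to one with a radiation field is asymptotically close to
the norm of the radiation field. -/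
theorem HasRadiation.eventually_abs_radialNorm_sub_le {R : ℝ} (hR : 0 < R) {w v : ℝ → ℝ → ℝ}
    {G : ℝ → ℝ} (h : HasRadiation R v G) {N ε : ℝ} (hε : 0 < ε)
    (hw : ∀ t, 0 ≤ t → MemLp (fun r => w t r - v t r) 2 (radialMeasure (R + t)) ∧
      radialNorm (R + t) (fun r => w t r - v t r) ≤ N) :
    ∀ᶠ t in atTop, |radialNorm (t + R) (w t) - √(∫ s in Ioi R, G s ^ 2)| ≤ N + ε := by
  have h1 : Tendsto (fun t => radialNorm (t + R) (v t)) atTop (𝓝 √(∫ s in Ioi R, G s ^ 2)) := by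
    refine ((h.tendsto_radialNorm_sq hR).sqrt).congr fun t => ?_
    rw [Real.sqrt_sq (radialNorm_nonneg _ _)]
  filter_upwards [Metric.tendsto_nhds.1 h1 ε hε, eventually_ge_atTop 0] with t ht ht0
  rw [Real.dist_eq] at ht
  obtain ⟨h2, h3⟩ := hw t ht0
  rw [add_comm R t] at h2 h3
  have hv := h.memLp hR ht0
  have h4 : MemLp (w t) 2 (radialMeasure (t + R)) := by
    refine (memLp_congr_ae (Eventually.of_forall fun r => ?_)).1 (h2.add hv)
    simp
  have h5 := (abs_radialNorm_sub_le h4 hv).trans h3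
  have h6 := abs_sub_le (radialNorm (t + R) (w t)) (radialNorm (t + R) (v t))
    √(∫ s in Ioi R, G s ^ 2)
  linarith

end

theorem proposition3p4 (R : ℝ) (hR : 0 < R) (u₁ : RadialL2 R) (u ut ur : ℝ → ℝ → ℝ)
    (hu : IsExteriorSolution R u₁ u) (hut : IsTimeDeriv R u ut) (hur : IsRadialDeriv R u ur) :
    (∀ t : ℝ, 0 ≤ t → IntegrableOn (fun r => |ur t r| ^ 2 * r ^ 5) (Ioi (t + R)) ∧
      IntegrableOn (fun r => |ut t r| ^ 2 * r ^ 5) (Ioi (t + R))) ∧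
    ∃ ℓ : ℝ,
      Tendsto (fun t : ℝ => ∫ r in Ioi (t + R), |ur t r| ^ 2 * r ^ 5) atTop (𝓝 ℓ) ∧
      Tendsto (fun t : ℝ => ∫ r in Ioi (t + R), |ut t r| ^ 2 * r ^ 5) atTop (𝓝 ℓ) ∧
      (3 / 20) * ∫ r in Ioi R, |radialProjPerp hR u₁ r| ^ 2 * r ^ 5 ≤ ℓ := by
  have hmemr : ∀ t, 0 ≤ t → MemLp (ur t) 2 (radialMeasure (t + R)) := fun t ht => by
    have h1 := (radialNorm_radialDeriv_sub_le ∅ (fun _ => 0) hR hu hur ht).1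
    rw [add_comm R t] at h1
    refine (memLp_congr_ae (Eventually.of_forall fun r => ?_)).1
      (h1.add ((hasRadiation_extSolR ∅ (fun _ => 0) hR).memLp hR ht))
    simp
  have hmemt : ∀ t, 0 ≤ t → MemLp (ut t) 2 (radialMeasure (t + R)) := fun t ht => by
    have h1 := (radialNorm_timeDeriv_sub_le ∅ (fun _ => 0) hR hu hut ht).1
    rw [add_comm R t] at h1
    refine (memLp_congr_ae (Eventually.of_forall fun r => ?_)).1
      (h1.add ((hasRadiation_extSol_one ∅ (fun _ => 0) hR).memLp hR ht))
    simp
  refine ⟨fun t ht => ⟨(memLp_radialMeasure_iff (by positivity) (hmemr t ht).1).1 (hmemr t ht),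
    (memLp_radialMeasure_iff (by positivity) (hmemt t ht).1).1 (hmemt t ht)⟩, ?_⟩
  have hmain : ∀ ε > 0, ∃ ℓ, (∀ᶠ t in atTop, |radialNorm (t + R) (ur t) - ℓ| ≤ ε) ∧
      (∀ᶠ t in atTop, |radialNorm (t + R) (ut t) - ℓ| ≤ ε) ∧
      √(3 / 20) * ‖radialProjPerp hR u₁‖ ≤ ℓ + ε := by
    intro ε hε
    obtain ⟨s, a, hsa⟩ := exists_radialNorm_sub_extData_le hR (Lp.memLp u₁) (half_pos hε)
    have hdata : extSol s a 1 0 =ᵐ[radialMeasure R] extData s a :=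
      (ae_radialMeasure_iff hR.le).2 ((ae_restrict_mem measurableSet_Ioi).mono fun r hr =>
        extSol_one_zero s a (hR.trans hr))
    have hN : radialNorm R (dataDiff s a u₁) ≤ ε / 2 := by
      refine le_of_eq_of_le (congrArg ENNReal.toReal (eLpNorm_congr_ae ?_)) hsa
      filter_upwards [hdata] with r hr
      rw [dataDiff, hr]
    have hextm : MemLp (extData s a) 2 (radialMeasure R) :=
      (memLp_congr_ae hdata).1 (memLp_extSol_zero s a hR 1)
    obtain ⟨c, hc⟩ := exists_integral_extData_sub_sq_le s a hR
    set L := ∫ x in Ioi R, extRad s a x ^ 2 with hL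
    have hr := (hasRadiation_extSolR s a hR).eventually_abs_radialNorm_sub_le hR (half_pos hε)
      fun t ht => radialNorm_radialDeriv_sub_le s a hR hu hur ht
    have ht := (hasRadiation_extSol_one s a hR).eventually_abs_radialNorm_sub_le hR (half_pos hε)
      fun t ht => radialNorm_timeDeriv_sub_le s a hR hu hut ht
    simp only [neg_sq] at hr
    refine ⟨√L, hr.mono fun t h => h.trans (by linarith), ht.mono fun t h => h.trans (by linarith),
      ?_⟩
    have hcm : MemLp (fun r : ℝ => c * (1 / r ^ 4)) 2 (radialMeasure R) :=
      (memLp_inv_pow_four hR).const_mul c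
    have hem := hextm.sub hcm
    have hq : √(3 / 20) * radialNorm R (extData s a - fun r => c * (1 / r ^ 4)) ≤ √L := by
      refine Real.le_sqrt_of_sq_le ?_
      rw [mul_pow, Real.sq_sqrt (by norm_num), radialNorm_sq hR.le hem]
      exact hc
    have hperp : ‖radialProjPerp hR u₁‖ ≤
        ε / 2 + radialNorm R (extData s a - fun r => c * (1 / r ^ 4)) := by
      refine (norm_radialProjPerp_le hR u₁ c).trans ?_
      have e : (u₁ - c • invPowFour hR : RadialL2 R) =
          ((Lp.memLp u₁).sub hextm).toLp _ + hem.toLp _ := by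
        have h1 : c • invPowFour hR = hcm.toLp _ := rfl
        have h2 : u₁ = (Lp.memLp u₁).toLp _ := (Lp.toLp_coeFn u₁ _).symm
        rw [h1, MemLp.toLp_sub (Lp.memLp u₁) hextm, MemLp.toLp_sub hextm hcm, ← h2]
        abel
      rw [e]
      refine (norm_add_le _ _).trans (add_le_add ?_ ?_)
      · rw [Lp.norm_toLp]
        exact hsa
      · rw [Lp.norm_toLp]
        exact le_rfl
    have h1 : √(3 / 20) ≤ 1 := Real.sqrt_le_one.2 (by norm_num)
    calc √(3 / 20) * ‖radialProjPerp hR u₁‖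
        ≤ √(3 / 20) * (ε / 2 + radialNorm R (extData s a - fun r => c * (1 / r ^ 4))) := by gcongr
      _ ≤ 1 * (ε / 2) + √L := by
          rw [mul_add]
          gcongr
      _ ≤ √L + ε := by linarith
  obtain ⟨ℓ, hr, ht, hm⟩ := exists_tendsto_of_forall_eventually_close hmain
  refine ⟨ℓ ^ 2, (hr.pow 2).congr' ?_, (ht.pow 2).congr' ?_, ?_⟩
  · filter_upwards [eventually_ge_atTop 0] with t ht0
    exact radialNorm_sq (by positivity) (hmemr t ht0)
  · filter_upwards [eventually_ge_atTop 0] with t ht0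
    exact radialNorm_sq (by positivity) (hmemt t ht0)
  · have h1 := pow_le_pow_left₀ (by positivity) hm 2
    rw [mul_pow, Real.sq_sqrt (by norm_num), Lp.norm_def] at h1
    rw [← radialNorm_sq hR.le (Lp.memLp (radialProjPerp hR u₁))]
    exact h1
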